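/- Let $d\ge 1$ be an integer, let $\alpha\ge 0$ and $\beta>0$ be real, and put $$f_0(t)=\frac{e^{it^\alpha}}{(1+t)^\beta}\qquad(t\ge 0),$$ where $t^0=1$ for all $t\ge 0$. For $x\in\mathbb{R}^d$ let $|x|_{p,d}=\Big(\sum_{j=1}^d|x_j|^p\Big)^{1/p}$ if $0<p<\infty$ and $|x|_{\infty,d}=\max_{1\le j\le d}|x_j|$. Let $A(\mathbb{R}^d)$ be the Wiener algebra, that is, the set of all functions $f:\mathbb{R}^d\to\mathbb{C}$ for which there is a $g\in L_1(\mathbb{R}^d)$ with $$f(x)=\int_{\mathbb{R}^d}g(y)\,e^{-i(x,y)}\,dy\quad\text{for all }x\in\mathbb{R}^d,\qquad (x,y)=\sum_{j=1}^d x_jy_j.$$ (i) If $2\beta>d\alpha$, then the function $x\mapsto f_0(|x|_{p,d})$ belongs to $A(\mathbb{R}^d)$ for every $p\in[1,\infty]$. (ii) If $\beta>d\alpha$, then the function $x\mapsto f_0(|x|_{p,d})$ belongs to $A(\mathbb{R}^d)$ for every $p\in(0,1)$. -/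

import Mathlib

open MeasureTheory
open scoped ENNReal

noncomputable section

/-- The Wiener algebra `A(ℝ^d)`: the functions on `ℝ^d` that are everywhere equal to
`x ↦ ∫ g(y) e^{-i(x,y)} dy` for some complex-valued Lebesgue integrable `g`. -/
def wienerAlgebra (d : ℕ) : Set (EuclideanSpace ℝ (Fin d) → ℂ) :=
  {f | ∃ g : EuclideanSpace ℝ (Fin d) → ℂ, Integrable g volume ∧
    ∀ x, f x = ∫ y, g y * Complex.exp (-Complex.I * ((∑ j, x j * y j : ℝ) : ℂ))}

/-- `|x|_{p,d} = (∑ |x_j|^p)^{1/p}` for `0 < p < ∞`, and `|x|_{∞,d} = max |x_j|`. -/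
def lpGauge {d : ℕ} (p : ℝ≥0∞) (x : EuclideanSpace ℝ (Fin d)) : ℝ :=
  if p = ∞ then ⨆ j, |x j| else (∑ j, |x j| ^ p.toReal) ^ (1 / p.toReal)

/-- `f₀(t) = e^{i t^α} / (1 + t)^β` for `t ≥ 0` (with `t^0 = 1`, also at `t = 0`). -/
def oscProfile (α β t : ℝ) : ℂ :=
  Complex.exp (Complex.I * ((t ^ α : ℝ) : ℂ)) / (((1 + t) ^ β : ℝ) : ℂ)

/-- For `p ≠ 0` the gauge is Mathlib's `ℓ^p` (quasi-)norm on `PiLp`. -/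
theorem lpGauge_eq_norm {d : ℕ} (p : ℝ≥0∞) (hp : p ≠ 0) (x : EuclideanSpace ℝ (Fin d)) :
    lpGauge p x = ‖(WithLp.toLp p (fun j => x j) : PiLp p (fun _ : Fin d => ℝ))‖ := by
  unfold lpGauge
  split_ifs with h
  · subst h
    simp [PiLp.norm_eq_ciSup]
  · rw [PiLp.norm_eq_sum (ENNReal.toReal_pos hp h)]
    simp

end

/-! Call the least `L¹` norm of a `G` with `F = 𝓕 G` the Wiener norm of `F`. It is invariant under
dilations of `F` and countably subadditive, so it suffices to cut the profile into dyadic shells of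
the gauge and to sum the norms of the pieces. On the shell where the gauge is about `2^j`, the
profile has size `2^(-jβ)` and phase `2^(jα)`. Dilated to unit scale it becomes `h ∘ gauge` with `h`
supported in `[1/2, 2]` and `‖h⁽ⁿ⁾‖ ≤ c n * A * N^n`, where `A = 2^(-jβ)`, `N = 2^(jα)` and `c` does
not depend on `j`. If every such function has Wiener norm at most `C * A * N^κ`, the sum converges
for `α κ < β`; the shells near the origin have positive powers of `2^(-j)` to spare. This is
`exists_wienerBound_oscProfile_comp`. It remains to find `κ` for each gauge.

For finite `p` the gauge is replaced by `Γ = 2^(p+1) ∑ |x_j|^p`, the missing root being moved into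
the exponents of the profile. Fourier inversion writes `h(Γ)` as a superposition of plane waves
`e^{2πiuΓ}`, and each of these is a product over the coordinates of factors `e^{iw|x_j|^p}` times a
cutoff. The transform of one factor has `L¹` norm `O((1+|w|)^{1/2})`
(`exists_lintegral_fourier_oscFactor_le`), so Bernstein's inequality with weight `(1+|u|)^{d/2}`
(`exists_lintegral_weight_fourier_le`) gives `κ = (d+1)/2`, which is at most `d`: enough for `p <
1`. For `p ≥ 1` the factor has no cusp at `0`, and its transform has only bounded mass beyond
frequencies of order `|w|` (`exists_lintegral_tail_oscFactor_le`). On the cube of half-side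
`N^{1+ε}`, Cauchy-Schwarz and Plancherel give `N^{(1+ε)d/2}`; off the cube some coordinate
contributes `O(1)` in place of `(1+|u|)^{1/2}`, and Bernstein gives `N^{d/2}`. Hence `κ = (1+ε)d/2`
(`exists_wienerBound_comp_powGauge_of_one_le`).

For `p = ∞`, `h(max |x_j|)` is minus the superposition of indicators of cubes `[-u, u]^d` with
weight `h'(u)`. The transform of a cube is a product of sines, that is, a sum of `2^d` plane waves
in `u` of frequencies `∑ ±y_j` with amplitudes `O(∏ (1+|y_j|)⁻¹)`; integration in `u` gives an extra
decay in `∑ ±y_j`, and a small power of it makes the product integrable. This yields `κ = 1 + δ`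
(`exists_wienerBound_comp_iSup`), enough for `d ≥ 2`; for `d = 1` the gauge is that of `p = 1`. -/

open FourierTransform

/-! ### Functions with integrable Fourier transform and their Wiener norm -/

section

/-- `F` is the Fourier transform of an integrable function of `L¹` norm at most `c`. -/
def WienerBound {d : ℕ} (F : EuclideanSpace ℝ (Fin d) → ℂ) (c : ℝ) : Prop :=
  ∃ G : EuclideanSpace ℝ (Fin d) → ℂ, Integrable G ∧ ∫ y, ‖G y‖ ≤ c ∧ ∀ x, F x = 𝓕 G x

theorem fourier_comp_smul {V : Type*} [NormedAddCommGroup V] [InnerProductSpace ℝ V]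
    [MeasurableSpace V] [BorelSpace V] [FiniteDimensional ℝ V] (G : V → ℂ) {R : ℝ} (hR : R ≠ 0)
    (x : V) :
    𝓕 (fun y => G (R • y)) x = |(R ^ Module.finrank ℝ V)⁻¹| • 𝓕 G (R⁻¹ • x) := by
  rw [Real.fourier_eq, Real.fourier_eq, ← Measure.integral_comp_smul]
  congr 1 with y
  rw [real_inner_smul_left, real_inner_smul_right, mul_inv_cancel_left₀ hR]

namespace WienerBound

variable {d : ℕ} {F F' : EuclideanSpace ℝ (Fin d) → ℂ} {c c' : ℝ}

theorem mono (h : WienerBound F c) (hc : c ≤ c') : WienerBound F c' := by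
  obtain ⟨G, h1, h2, h3⟩ := h
  exact ⟨G, h1, h2.trans hc, h3⟩

theorem dilate (h : WienerBound F c) {r : ℝ} (hr : 0 < r) :
    WienerBound (fun x => F (r • x)) c := by
  obtain ⟨G, h1, h2, h3⟩ := h
  have e : 0 < r⁻¹ ^ Module.finrank ℝ (EuclideanSpace ℝ (Fin d)) := by positivity
  refine ⟨fun y => ((r⁻¹ ^ Module.finrank ℝ (EuclideanSpace ℝ (Fin d)) : ℝ) : ℂ) • G (r⁻¹ • y),
    (h1.comp_smul (inv_ne_zero hr.ne')).smul (_ : ℂ), ?_, fun x => ?_⟩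
  · simp_rw [norm_smul]
    rw [integral_const_mul, Measure.integral_comp_smul volume (fun y => ‖G y‖), smul_eq_mul,
      ← mul_assoc, Complex.norm_real, Real.norm_eq_abs, ← abs_mul, mul_inv_cancel₀ e.ne']
    simpa using h2
  · have := fourier_comp_smul G (inv_ne_zero hr.ne') x
    rw [inv_inv] at this
    have h4 : 𝓕 (fun y => ((r⁻¹ ^ Module.finrank ℝ (EuclideanSpace ℝ (Fin d)) : ℝ) : ℂ) •
        G (r⁻¹ • y)) x = ((r⁻¹ ^ Module.finrank ℝ (EuclideanSpace ℝ (Fin d)) : ℝ) : ℂ) •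
        𝓕 (fun y => G (r⁻¹ • y)) x := by
      simp only [Real.fourier_eq]
      rw [← integral_smul]
      congr 1 with y
      rw [smul_comm]
    simp only [h3]
    rw [h4, this, abs_of_pos (inv_pos.mpr e), Complex.coe_smul, smul_smul,
      mul_inv_cancel₀ e.ne', one_smul]

theorem mem_wienerAlgebra (h : WienerBound F c) : F ∈ wienerAlgebra d := by
  -- Dilation by `2π` passes from the kernel `e^{-2πi(x,y)}` of `𝓕` to the kernel `e^{-i(x,y)}`.
  obtain ⟨G, h1, -, h3⟩ := h.dilate (r := 2 * Real.pi) (by positivity)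
  refine ⟨G, h1, fun x => ?_⟩
  have := h3 ((2 * Real.pi)⁻¹ • x)
  simp only [] at this
  rw [smul_inv_smul₀ (by positivity)] at this
  rw [this, Real.fourier_eq']
  congr 1 with y
  rw [smul_eq_mul, mul_comm]
  congr 2
  rw [real_inner_smul_right, PiLp.inner_apply]
  have : (2 * Real.pi : ℂ) ≠ 0 := by exact_mod_cast (by positivity : (2 * Real.pi) ≠ 0)
  simp only [RCLike.inner_apply, conj_trivial]
  push_cast
  field_simp

/-- Completeness of `L¹`: the norms of the representing functions are summable, so their series
converges almost everywhere to an integrable function, and summation commutes with the Fourier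
integral. Only pointwise convergence to `F` is needed, because it identifies the value at each
point. -/
theorem hasSum {ι : Type*} [Countable ι] {f : ι → EuclideanSpace ℝ (Fin d) → ℂ} {b : ι → ℝ}
    (h : ∀ k, WienerBound (f k) (b k)) (hb : Summable b)
    (hF : ∀ x, HasSum (fun k => f k x) (F x)) : WienerBound F (∑' k, b k) := by
  choose G h1 h2 h3 using h
  have hs : Summable fun k => ∫ y, ‖G k y‖ :=
    Summable.of_nonneg_of_le (fun k => integral_nonneg fun _ => norm_nonneg _) h2 hb
  have hen : ∀ k, ∫⁻ y, ‖G k y‖ₑ = ENNReal.ofReal (∫ y, ‖G k y‖) := fun k => by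
    rw [ofReal_integral_norm_eq_lintegral_enorm (h1 k)]
  have hfin : ∫⁻ y, ∑' k, ‖G k y‖ₑ ≤ ENNReal.ofReal (∑' k, b k) := by
    rw [lintegral_tsum fun k => (h1 k).1.enorm]
    simp_rw [hen]
    rw [← ENNReal.ofReal_tsum_of_nonneg (fun k => integral_nonneg fun _ => norm_nonneg _) hs]
    exact ENNReal.ofReal_le_ofReal (hs.tsum_le_tsum h2 hb)
  have hae : ∀ᵐ y, Summable fun k => G k y := by
    have : ∀ᵐ y, ∑' k, ‖G k y‖ₑ < ∞ :=
      ae_lt_top' (AEMeasurable.tsum fun k => (h1 k).1.enorm)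
        (hfin.trans_lt ENNReal.ofReal_lt_top).ne
    filter_upwards [this] with y hy
    exact (tsum_enorm_ne_top_iff_summable_norm.mp hy.ne).of_norm
  have hle : ∀ᵐ y, ‖∑' k, G k y‖ₑ ≤ ∑' k, ‖G k y‖ₑ := by
    filter_upwards [hae] with y hy
    exact enorm_tsum_le_tsum_enorm
  have hm : AEStronglyMeasurable (fun y => ∑' k, G k y) volume :=
    (AEMeasurable.tsum fun k => (h1 k).1.aemeasurable).aestronglyMeasurable
  have hi : Integrable (fun y => ∑' k, G k y) :=
    ⟨hm, ((lintegral_mono_ae hle).trans hfin).trans_lt ENNReal.ofReal_lt_top⟩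
  refine ⟨fun y => ∑' k, G k y, hi, ?_, fun x => ?_⟩
  · rw [← ENNReal.ofReal_le_ofReal_iff (tsum_nonneg fun k =>
      (integral_nonneg fun _ => norm_nonneg _).trans (h2 k)),
      ofReal_integral_norm_eq_lintegral_enorm hi]
    exact (lintegral_mono_ae hle).trans hfin
  · refine (hF x).unique ?_
    simp_rw [h3, Real.fourier_eq]
    have := hasSum_integral_of_summable_integral_norm (μ := volume)
      (F := fun k y => Real.fourierChar (-inner ℝ y x) • G k y)
      (fun k => (Real.fourierIntegral_convergent_iff x).2 (h1 k)) (by simpa using hs)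
    convert! this using 3 with y
    simp only [Circle.smul_def, smul_eq_mul]
    exact tsum_mul_left.symm

theorem add (h : WienerBound F c) (h' : WienerBound F' c') :
    WienerBound (fun x => F x + F' x) (c + c') := by
  have := hasSum (ι := Bool) (f := fun b => bif b then F else F') (b := fun b => bif b then c else c')
    (F := fun x => F x + F' x) (by rintro (_ | _) <;> simpa) (Summable.of_finite) (fun x => by
      have := hasSum_fintype (fun b : Bool => (bif b then F else F') x)
      simpa using this)
  simpa [tsum_fintype] using this

theorem const_mul (h : WienerBound F c) (a : ℂ) : WienerBound (fun x => a * F x) (‖a‖ * c) := by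
  obtain ⟨G, h1, h2, h3⟩ := h
  refine ⟨fun y => a * G y, h1.const_mul a, ?_, fun x => ?_⟩
  · simp_rw [norm_mul]
    rw [integral_const_mul]
    gcongr
  · simp only [h3, Real.fourier_eq]
    rw [← integral_const_mul]
    congr 1 with y
    rw [mul_smul_comm]

/-- Fourier inversion: `y ↦ 𝓕 F (-y)` represents `F`, and continuity of `F` makes the identity hold
at every point. -/
theorem of_fourier (hc : Continuous F) (hi : Integrable F) {c : ℝ} (h0 : 0 ≤ c)
    (h : ∫⁻ y, ‖𝓕 F y‖ₑ ≤ ENNReal.ofReal c) : WienerBound F c := by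
  have hm : Continuous (𝓕 F) := VectorFourier.fourierIntegral_continuous
    Real.continuous_fourierChar (by exact continuous_inner) hi
  have hF : Integrable (𝓕 F) := ⟨hm.aestronglyMeasurable, h.trans_lt ENNReal.ofReal_lt_top⟩
  refine ⟨fun y => 𝓕 F (-y), hF.comp_neg, ?_, fun x => ?_⟩
  · rw [integral_neg_eq_self (fun y => ‖𝓕 F y‖), ← ENNReal.ofReal_le_ofReal_iff h0,
      ofReal_integral_norm_eq_lintegral_enorm hF]
    exact h
  · have := congrFun (hc.fourierInv_fourier_eq hi hF) x
    rw [← this, Real.fourierInv_eq_fourier_comp_neg]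

end WienerBound

end

/-! ### Plancherel for functions in `L¹ ∩ L²` -/

section

section Plancherel

variable {V : Type*} [NormedAddCommGroup V] [InnerProductSpace ℝ V]
    [MeasurableSpace V] [BorelSpace V] [FiniteDimensional ℝ V] {f : V → ℂ}

theorem continuous_fourier_of_integrable (hf : Integrable f) : Continuous (𝓕 f) :=
  VectorFourier.fourierIntegral_continuous Real.continuous_fourierChar
    (by exact continuous_inner) hf

theorem norm_fourier_le_integral_norm (f : V → ℂ) (y : V) : ‖𝓕 f y‖ ≤ ∫ x, ‖f x‖ :=
  VectorFourier.norm_fourierIntegral_le_integral_norm _ _ _ _ _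

/-- Plancherel's theorem for functions in `L¹ ∩ L²`. -/
theorem eLpNorm_fourier_eq (hf : Integrable f) (hf2 : MemLp f 2) :
    eLpNorm (𝓕 f) 2 volume = eLpNorm f 2 volume := by
  set g : Lp ℂ 2 (volume : Measure V) := hf2.toLp f with hg
  -- The Fourier integral and the `L²` transform are the same tempered distribution: tested against
  -- a smooth compactly supported `φ`, both move the transform onto `φ`.
  have hae : 𝓕 f =ᵐ[volume] (𝓕 g : Lp ℂ 2 (volume : Measure V)) := by
    refine ae_eq_of_integral_contDiff_smul_eq
      (continuous_fourier_of_integrable hf).locallyIntegrable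
      ((Lp.memLp _).locallyIntegrable (by norm_num)) fun φ hφ hφc => ?_
    have hψ1 : HasCompactSupport fun x => (φ x : ℂ) := hφc.comp_left (g := Complex.ofReal) rfl
    have hψ2 : ContDiff ℝ ((⊤ : ℕ∞) : WithTop ℕ∞) fun x => (φ x : ℂ) := Complex.ofRealCLM.contDiff.comp hφ
    set ψ : SchwartzMap V ℂ := hψ1.toSchwartzMap hψ2 with hψ
    have hψa : ∀ x, ψ x = φ x := fun x => rfl
    have e1 := congrArg (fun T => T ψ) (Lp.fourier_toTemperedDistribution_eq g)
    simp only [TemperedDistribution.fourier_apply, Lp.toTemperedDistribution_apply] at e1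
    have e2 := VectorFourier.integral_fourierIntegral_smul_eq_flip (μ := (volume : Measure V))
      (ν := (volume : Measure V)) (L := innerₗ V) (f := ψ) (g := f)
      Real.continuous_fourierChar (by exact continuous_inner) ψ.integrable hf
    rw [flip_innerₗ] at e2
    calc ∫ x, φ x • 𝓕 f x = ∫ x, ψ x • 𝓕 f x := by
          simp only [hψa, Complex.coe_smul]
      _ = ∫ x, 𝓕 ψ x • f x := e2.symm
      _ = ∫ x, 𝓕 ψ x • g x := by
          refine integral_congr_ae ?_
          filter_upwards [hf2.coeFn_toLp] with x hx
          rw [hx]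
      _ = ∫ x, ψ x • (𝓕 g : Lp ℂ 2 (volume : Measure V)) x := e1
      _ = _ := by simp only [hψa, Complex.coe_smul]
  rw [eLpNorm_congr_ae hae, ← ENNReal.toReal_eq_toReal_iff' (Lp.eLpNorm_ne_top _) hf2.eLpNorm_ne_top]
  have := Lp.norm_fourier_eq g
  rw [Lp.norm_def, Lp.norm_def] at this
  rw [this, eLpNorm_congr_ae hf2.coeFn_toLp]

/-- Cauchy-Schwarz followed by Plancherel; this is where the square roots in all the band estimates
come from. -/
theorem lintegral_mul_enorm_fourier_le (hf : Integrable f) (hf2 : MemLp f 2) {w : V → ℝ≥0∞}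
    (hw : AEMeasurable w) :
    ∫⁻ y, w y * ‖𝓕 f y‖ₑ ≤
      (∫⁻ y, w y ^ (2 : ℝ)) ^ (1 / 2 : ℝ) * (∫⁻ x, ‖f x‖ₑ ^ (2 : ℝ)) ^ (1 / 2 : ℝ) := by
  have h1 := ENNReal.lintegral_mul_le_Lp_mul_Lq volume Real.HolderConjugate.two_two hw
    (continuous_fourier_of_integrable hf).enorm.measurable.aemeasurable
  have h2 := eLpNorm_fourier_eq hf hf2
  rw [eLpNorm_eq_lintegral_rpow_enorm_toReal (by norm_num) (by norm_num),
    eLpNorm_eq_lintegral_rpow_enorm_toReal (by norm_num) (by norm_num)] at h2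
  simp only [ENNReal.toReal_ofNat] at h2
  rw [← h2]
  exact h1

end Plancherel

end

/-! ### Derivative bounds with amplitude and frequency; Bernstein's inequality -/

section

/-- `f` is smooth and its `n`-th derivative is bounded by `c n * A * N ^ n` for every `n`. -/
structure DerivBound {E : Type*} [NormedAddCommGroup E] [NormedSpace ℝ E]
    (c : ℕ → ℝ) (A N : ℝ) (f : ℝ → E) : Prop where
  contDiff : ContDiff ℝ ((⊤ : ℕ∞) : WithTop ℕ∞) f
  bound : ∀ n x, ‖iteratedDeriv n f x‖ ≤ c n * A * N ^ n

theorem lintegral_rpow_neg_tail {s : ℝ} (hs : 1 < s) {R : ℝ} (hR : 0 < R) :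
    ∫⁻ u in {u : ℝ | R < |u|}, ENNReal.ofReal (|u| ^ (-s)) =
      ENNReal.ofReal (2 / (s - 1) * R ^ (1 - s)) := by
  have e : {u : ℝ | R < |u|} = Set.Ioi R ∪ Set.Iio (-R) := by
    ext u
    simp only [Set.mem_ofPred_eq, lt_abs, Set.mem_union, Set.mem_Ioi, Set.mem_Iio]
    constructor <;> rintro (h | h) <;> first | exact Or.inl h | (right; linarith)
  have hd : Disjoint (Set.Ioi R) (Set.Iio (-R)) := by
    rw [Set.disjoint_left]
    intro u hu hu'
    simp only [Set.mem_Ioi, Set.mem_Iio] at hu hu'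
    linarith
  have h1 : ∫⁻ u in Set.Ioi R, ENNReal.ofReal (|u| ^ (-s)) =
      ENNReal.ofReal (1 / (s - 1) * R ^ (1 - s)) := by
    have hi := integrableOn_Ioi_rpow_of_lt (a := -s) (by linarith) hR
    rw [setLIntegral_congr_fun (g := fun u => ENNReal.ofReal (u ^ (-s))) measurableSet_Ioi
      fun u hu => by simp only [abs_of_pos (hR.trans hu)],
      ← ofReal_integral_eq_lintegral_ofReal hi, integral_Ioi_rpow_of_lt (by linarith) hR]
    · congr 1
      rw [show -s + 1 = 1 - s by ring, show 1 - s = -(s - 1) by ring]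
      have : s - 1 ≠ 0 := by linarith
      field_simp
    · filter_upwards [ae_restrict_mem measurableSet_Ioi] with u hu
      exact Real.rpow_nonneg (hR.trans hu).le _
  have h2 : ∫⁻ u in Set.Iio (-R), ENNReal.ofReal (|u| ^ (-s)) =
      ∫⁻ u in Set.Ioi R, ENNReal.ofReal (|u| ^ (-s)) := by
    have := (Measure.measurePreserving_neg (volume : Measure ℝ)).setLIntegral_comp_preimage_emb
      (MeasurableEquiv.neg ℝ).measurableEmbedding (fun u => ENNReal.ofReal (|u| ^ (-s))) (Set.Ioi R)
    rw [← this]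
    simp
  rw [e, lintegral_union measurableSet_Iio hd, h2, h1, ← ENNReal.ofReal_add]
  · congr 1; ring
  all_goals
    have : 0 < s - 1 := by linarith
    positivity

section Compact

variable {h : ℝ → ℂ} {r : ℝ}

theorem iteratedDeriv_eq_zero_of_abs_gt (hs : ∀ x, r < |x| → h x = 0) (n : ℕ) {x : ℝ}
    (hx : r < |x|) : iteratedDeriv n h x = 0 := by
  have : h =ᶠ[nhds x] fun _ => 0 := by
    filter_upwards [(isOpen_lt continuous_const continuous_abs).mem_nhds hx] with y hy
    exact hs y hy
  rw [this.iteratedDeriv_eq, iteratedDeriv_const]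
  simp

theorem lintegral_rpow_enorm_le {B : ℝ} (hB : ∀ x, ‖h x‖ ≤ B)
    (hs : ∀ x, r < |x| → h x = 0) {q : ℝ} (hq : 0 < q) :
    ∫⁻ x, ‖h x‖ₑ ^ q ≤ ENNReal.ofReal (2 * r * B ^ q) := by
  have hB0 : 0 ≤ B := (norm_nonneg _).trans (hB 0)
  calc ∫⁻ x, ‖h x‖ₑ ^ q ≤ ∫⁻ x, (Set.Icc (-r) r).indicator (fun _ => ENNReal.ofReal (B ^ q)) x := by
        refine lintegral_mono fun x => ?_
        by_cases hx : x ∈ Set.Icc (-r) r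
        · rw [Set.indicator_of_mem hx, ← ENNReal.ofReal_rpow_of_nonneg hB0 hq.le]
          gcongr
          rw [← ofReal_norm]
          exact ENNReal.ofReal_le_ofReal (hB x)
        · rw [Set.mem_Icc, ← abs_le, not_le] at hx
          simp [hs x hx, hq]
    _ = _ := by
        rw [lintegral_indicator_const measurableSet_Icc, Real.volume_Icc,
          ← ENNReal.ofReal_mul (by positivity)]
        congr 1; ring

theorem hasCompactSupport_of_abs_gt (hs : ∀ x, r < |x| → h x = 0) : HasCompactSupport h := by
  refine HasCompactSupport.intro (isCompact_Icc (a := -r) (b := r)) fun x hx => hs x ?_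
  rwa [Set.mem_Icc, ← abs_le, not_le] at hx

end Compact

namespace DerivBound

variable {c : ℕ → ℝ} {A N r : ℝ} {h : ℝ → ℂ}

theorem nonneg (H : DerivBound c A N h) (n : ℕ) : 0 ≤ c n * A * N ^ n :=
  (norm_nonneg _).trans (H.bound n 0)

theorem continuous_iteratedDeriv (H : DerivBound c A N h) (n : ℕ) :
    Continuous (iteratedDeriv n h) :=
  H.contDiff.continuous_iteratedDeriv n (by exact_mod_cast le_top)

theorem integrable_iteratedDeriv (H : DerivBound c A N h) (hs : ∀ x, r < |x| → h x = 0) (n : ℕ) :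
    Integrable (iteratedDeriv n h) :=
  (H.continuous_iteratedDeriv n).integrable_of_hasCompactSupport
    (hasCompactSupport_of_abs_gt fun _ hx => iteratedDeriv_eq_zero_of_abs_gt hs n hx)

theorem memLp_iteratedDeriv (H : DerivBound c A N h) (hs : ∀ x, r < |x| → h x = 0) (n : ℕ) :
    MemLp (iteratedDeriv n h) 2 :=
  (H.continuous_iteratedDeriv n).memLp_of_hasCompactSupport
    (hasCompactSupport_of_abs_gt fun _ hx => iteratedDeriv_eq_zero_of_abs_gt hs n hx)

theorem fourier_eq (H : DerivBound c A N h) (hs : ∀ x, r < |x| → h x = 0) (n : ℕ) (u : ℝ) :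
    ‖𝓕 (iteratedDeriv n h) u‖ = (2 * Real.pi * |u|) ^ n * ‖𝓕 h u‖ := by
  rw [Real.fourier_iteratedDeriv (N := ⊤) H.contDiff
    (fun k _ => H.integrable_iteratedDeriv hs k) le_top]
  simp [abs_of_pos Real.pi_pos]

theorem pow_mul_norm_fourier_le (H : DerivBound c A N h) (hr : 0 ≤ r)
    (hs : ∀ x, r < |x| → h x = 0) (n : ℕ) (u : ℝ) :
    |u| ^ n * ‖𝓕 h u‖ ≤ 2 * r * (c n * A * N ^ n) := by
  have h1 : ∫ x, ‖iteratedDeriv n h x‖ ≤ 2 * r * (c n * A * N ^ n) := by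
    have h0 := H.nonneg n
    rw [← ENNReal.ofReal_le_ofReal_iff (by positivity),
      ofReal_integral_norm_eq_lintegral_enorm (H.integrable_iteratedDeriv hs n)]
    simpa using lintegral_rpow_enorm_le (H.bound n)
      (fun _ hx => iteratedDeriv_eq_zero_of_abs_gt hs n hx) one_pos
  refine le_trans ?_ ((norm_fourier_le_integral_norm _ u).trans h1)
  rw [H.fourier_eq hs]
  gcongr
  have := Real.pi_gt_three
  nlinarith [abs_nonneg u]

/-- The `L¹` norm of the Fourier transform on `|u| > R`. -/
theorem lintegral_fourier_tail_le (H : DerivBound c A N h) (hr : 0 ≤ r)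
    (hs : ∀ x, r < |x| → h x = 0) {n : ℕ} (hn : 2 ≤ n) {R : ℝ} (hR : 0 < R) :
    ∫⁻ u in {u : ℝ | R < |u|}, ‖𝓕 h u‖ₑ ≤
      ENNReal.ofReal (4 * r * (c n * A * N ^ n) * R ^ (1 - n : ℝ)) := by
  have h0 := H.nonneg n
  have hn' : (2 : ℝ) ≤ n := by exact_mod_cast hn
  calc ∫⁻ u in {u : ℝ | R < |u|}, ‖𝓕 h u‖ₑ
      ≤ ∫⁻ u in {u : ℝ | R < |u|}, ENNReal.ofReal (2 * r * (c n * A * N ^ n)) *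
          ENNReal.ofReal (|u| ^ (-n : ℝ)) := by
        refine setLIntegral_mono' (measurableSet_lt measurable_const measurable_norm) fun u hu => ?_
        rw [← ENNReal.ofReal_mul (by positivity), ← ofReal_norm]
        refine ENNReal.ofReal_le_ofReal ?_
        have hu0 : 0 < |u| := hR.trans hu
        rw [Real.rpow_neg hu0.le, ← div_eq_mul_inv, le_div_iff₀ (by positivity), Real.rpow_natCast,
          mul_comm]
        exact H.pow_mul_norm_fourier_le hr hs n u
    _ = ENNReal.ofReal (2 * r * (c n * A * N ^ n)) *
          ENNReal.ofReal (2 / (n - 1) * R ^ (1 - n : ℝ)) := by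
        rw [lintegral_const_mul' _ _ ENNReal.ofReal_ne_top,
          lintegral_rpow_neg_tail (by linarith) hR]
    _ ≤ _ := by
        rw [← ENNReal.ofReal_mul (by positivity)]
        refine ENNReal.ofReal_le_ofReal ?_
        have : 2 / ((n : ℝ) - 1) ≤ 2 := by
          rw [div_le_iff₀ (by linarith)]
          linarith
        calc _ ≤ 2 * r * (c n * A * N ^ n) * (2 * R ^ (1 - n : ℝ)) := by gcongr
          _ = _ := by ring

end DerivBound

theorem ENNReal.rpow_half_le_ofReal {X : ℝ≥0∞} {a : ℝ} (ha : 0 ≤ a)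
    (h : X ≤ ENNReal.ofReal (a ^ 2)) : X ^ (1 / 2 : ℝ) ≤ ENNReal.ofReal a := by
  calc X ^ (1 / 2 : ℝ) ≤ ENNReal.ofReal (a ^ 2) ^ (1 / 2 : ℝ) := by gcongr
    _ = _ := by
      rw [ENNReal.ofReal_rpow_of_nonneg (by positivity) (by norm_num), ← Real.sqrt_eq_rpow,
        Real.sqrt_sq ha]

/-- Bernstein's inequality with a polynomial weight. -/
theorem exists_lintegral_weight_fourier_le (c : ℕ → ℝ) {m : ℝ} (hm : 0 ≤ m) {r : ℝ} (hr : 0 ≤ r) :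
    ∃ C, 0 ≤ C ∧ ∀ (A N : ℝ) (h : ℝ → ℂ), 0 ≤ A → 1 ≤ N → DerivBound c A N h →
      (∀ x, r < |x| → h x = 0) →
      ∫⁻ u, ENNReal.ofReal ((1 + |u|) ^ m) * ‖𝓕 h u‖ₑ ≤ ENNReal.ofReal (C * A * N ^ (m + 1 / 2)) := by
  -- With `n ≥ m + 1` the function `|u|^(2(m-n))` is integrable at infinity, so `n` derivatives pay
  -- for the weight.
  set n : ℕ := ⌈m⌉₊ + 1 with hn
  have hnm : m + 1 ≤ n := by
    rw [hn]; push_cast; linarith [Nat.le_ceil m]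
  refine ⟨2 ^ (m + 1 / 2) * (√(2 * r) * |c 0|) + 2 ^ (m + 1 / 2) * (√(2 * r) * |c n|),
    by positivity, fun A N h hA hN H hs => ?_⟩
  have hN0 : 0 < N := by linarith
  have hL2 : ∀ k, (∫⁻ x, ‖iteratedDeriv k h x‖ₑ ^ (2 : ℝ)) ^ (1 / 2 : ℝ) ≤
      ENNReal.ofReal (√(2 * r) * (|c k| * A * N ^ k)) := fun k => by
    refine ENNReal.rpow_half_le_ofReal (by positivity) ?_
    refine (lintegral_rpow_enorm_le (B := |c k| * A * N ^ k) (r := r) (fun x => ?_)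
      (fun _ hx => iteratedDeriv_eq_zero_of_abs_gt hs k hx) two_pos).trans
      (ENNReal.ofReal_le_ofReal ?_)
    · refine (H.bound k x).trans ?_
      gcongr
      exact le_abs_self _
    · rw [mul_pow, Real.sq_sqrt (by positivity), Real.rpow_two]
  -- Below the frequency `N` the weight is at most `(2N)^m` and lives on an interval of length `2N`;
  -- above it the `n`-th derivative is used. Both parts come out as `A * N^(m + 1/2)`.
  set S : Set ℝ := {u | N < |u|} with hS
  have hSm : MeasurableSet S := measurableSet_lt measurable_const measurable_norm
  have low : ∫⁻ u in Sᶜ, ENNReal.ofReal ((1 + |u|) ^ m) * ‖𝓕 h u‖ₑ ≤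
      ENNReal.ofReal (2 ^ (m + 1 / 2) * (√(2 * r) * |c 0|) * A * N ^ (m + 1 / 2)) := by
    calc ∫⁻ u in Sᶜ, ENNReal.ofReal ((1 + |u|) ^ m) * ‖𝓕 h u‖ₑ
        ≤ ∫⁻ u in Sᶜ, ENNReal.ofReal ((2 * N) ^ m) * ‖𝓕 h u‖ₑ := by
          refine setLIntegral_mono' hSm.compl fun u hu => ?_
          have : |u| ≤ N := not_lt.mp hu
          gcongr
          linarith
      _ = ∫⁻ u, Sᶜ.indicator (fun _ => ENNReal.ofReal ((2 * N) ^ m)) u * ‖𝓕 h u‖ₑ := by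
          rw [← lintegral_indicator hSm.compl]
          congr 1 with u
          by_cases hu : u ∈ Sᶜ <;> simp [hu]
      _ ≤ _ := lintegral_mul_enorm_fourier_le (by simpa using H.integrable_iteratedDeriv hs 0)
          (by simpa using H.memLp_iteratedDeriv hs 0)
          (measurable_const.indicator hSm.compl).aemeasurable
      _ ≤ ENNReal.ofReal ((2 * N) ^ (m + 1 / 2)) *
          ENNReal.ofReal (√(2 * r) * (|c 0| * A * N ^ 0)) := by
          gcongr
          · refine ENNReal.rpow_half_le_ofReal (by positivity) ?_
            have hv : volume Sᶜ = ENNReal.ofReal (2 * N) := by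
              have : Sᶜ = Set.Icc (-N) N := by ext; simp [hS, abs_le]
              rw [this, Real.volume_Icc]; congr 1; ring
            have : ∀ u, Sᶜ.indicator (fun _ => ENNReal.ofReal ((2 * N) ^ m)) u ^ (2 : ℝ) =
                Sᶜ.indicator (fun _ => ENNReal.ofReal ((2 * N) ^ (m * 2))) u := fun u => by
              by_cases hu : u ∈ Sᶜ
              · simp only [Set.indicator_of_mem hu]
                rw [ENNReal.ofReal_rpow_of_nonneg (by positivity) two_pos.le, ← Real.rpow_mul]
                positivity
              · simp [Set.indicator_of_notMem hu]
            simp_rw [this]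
            rw [lintegral_indicator_const hSm.compl, hv, ← ENNReal.ofReal_mul (by positivity)]
            refine ENNReal.ofReal_le_ofReal (le_of_eq ?_)
            rw [← Real.rpow_natCast, ← Real.rpow_mul (by positivity)]
            nth_rw 2 [← Real.rpow_one (2 * N)]
            rw [← Real.rpow_add (by positivity)]
            congr 1
            push_cast; ring
          · simpa using hL2 0
      _ = _ := by
          rw [← ENNReal.ofReal_mul (by positivity), Real.mul_rpow two_pos.le hN0.le]
          congr 1; ring
  have high : ∫⁻ u in S, ENNReal.ofReal ((1 + |u|) ^ m) * ‖𝓕 h u‖ₑ ≤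
      ENNReal.ofReal (2 ^ (m + 1 / 2) * (√(2 * r) * |c n|) * A * N ^ (m + 1 / 2)) := by
    calc ∫⁻ u in S, ENNReal.ofReal ((1 + |u|) ^ m) * ‖𝓕 h u‖ₑ
        ≤ ∫⁻ u in S, ENNReal.ofReal (2 ^ m * |u| ^ (m - n)) * ‖𝓕 (iteratedDeriv n h) u‖ₑ := by
          refine setLIntegral_mono' hSm fun u hu => ?_
          have hu0 : 1 < |u| := hN.trans_lt hu
          rw [← ofReal_norm, ← ofReal_norm, ← ENNReal.ofReal_mul (by positivity),
            ← ENNReal.ofReal_mul (by positivity), H.fourier_eq hs, mul_pow]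
          refine ENNReal.ofReal_le_ofReal ?_
          have h1 : (1 + |u|) ^ m ≤ 2 ^ m * |u| ^ m := by
            rw [← Real.mul_rpow two_pos.le (abs_nonneg u)]
            gcongr
            linarith
          have h2 : (1 : ℝ) ≤ (2 * Real.pi) ^ n := one_le_pow₀ (by linarith [Real.pi_gt_three])
          have h3 : |u| ^ (m - n) * |u| ^ n = |u| ^ m := by
            rw [← Real.rpow_natCast, ← Real.rpow_add (by linarith)]
            congr 1; ring
          calc (1 + |u|) ^ m * ‖𝓕 h u‖ ≤ 2 ^ m * |u| ^ m * (1 * ‖𝓕 h u‖) := by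
                rw [one_mul]; gcongr
            _ ≤ 2 ^ m * |u| ^ m * ((2 * Real.pi) ^ n * ‖𝓕 h u‖) := by gcongr
            _ = _ := by rw [← h3]; ring
      _ = ∫⁻ u, S.indicator (fun u => ENNReal.ofReal (2 ^ m * |u| ^ (m - n))) u *
          ‖𝓕 (iteratedDeriv n h) u‖ₑ := by
          rw [← lintegral_indicator hSm]
          congr 1 with u
          by_cases hu : u ∈ S <;> simp [hu]
      _ ≤ _ := lintegral_mul_enorm_fourier_le (H.integrable_iteratedDeriv hs n)
          (H.memLp_iteratedDeriv hs n) (by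
            refine Measurable.aemeasurable (Measurable.indicator ?_ hSm)
            fun_prop)
      _ ≤ ENNReal.ofReal (2 ^ (m + 1 / 2) * N ^ (m - n + 1 / 2)) *
          ENNReal.ofReal (√(2 * r) * (|c n| * A * N ^ n)) := by
          gcongr
          · refine ENNReal.rpow_half_le_ofReal (by positivity) ?_
            have : ∀ u, S.indicator (fun u => ENNReal.ofReal (2 ^ m * |u| ^ (m - n))) u ^ (2 : ℝ) =
                S.indicator (fun u => ENNReal.ofReal (2 ^ (m * 2)) *
                  ENNReal.ofReal (|u| ^ (-(2 * (n - m))))) u := fun u => by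
              by_cases hu : u ∈ S
              · simp only [Set.indicator_of_mem hu]
                rw [ENNReal.ofReal_rpow_of_nonneg (by positivity) two_pos.le, Real.mul_rpow
                  (by positivity) (by positivity), ← Real.rpow_mul two_pos.le,
                  ← Real.rpow_mul (abs_nonneg u), ENNReal.ofReal_mul (by positivity)]
                congr 3; ring
              · simp [Set.indicator_of_notMem hu]
            simp_rw [this]
            rw [lintegral_indicator hSm, lintegral_const_mul' _ _ ENNReal.ofReal_ne_top,
              lintegral_rpow_neg_tail (by linarith) hN0, ← ENNReal.ofReal_mul (by positivity)]
            refine ENNReal.ofReal_le_ofReal ?_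
            have e1 : ((2 : ℝ) ^ (m + 1 / 2)) ^ 2 = 2 ^ (m * 2) * 2 := by
              rw [← Real.rpow_natCast, ← Real.rpow_mul two_pos.le,
                show (m + 1 / 2) * ((2 : ℕ) : ℝ) = m * 2 + 1 by push_cast; ring,
                Real.rpow_add two_pos, Real.rpow_one]
            have e2 : (N ^ (m - n + 1 / 2)) ^ 2 = N ^ (1 - 2 * (n - m)) := by
              rw [← Real.rpow_natCast, ← Real.rpow_mul hN0.le]
              congr 1; push_cast; ring
            rw [mul_pow, e1, e2, mul_assoc]
            gcongr
            rw [div_le_iff₀ (by linarith)]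
            linarith
          · exact hL2 n
      _ = _ := by
          rw [← ENNReal.ofReal_mul (by positivity)]
          have : N ^ (m + 1 / 2) = N ^ (m - n + 1 / 2) * N ^ n := by
            rw [← Real.rpow_natCast, ← Real.rpow_add hN0]
            congr 1; ring
          rw [this]
          congr 1; ring
  rw [← lintegral_add_compl _ hSm, add_comm]
  refine (add_le_add low high).trans ?_
  rw [← ENNReal.ofReal_add (by positivity) (by positivity)]
  refine ENNReal.ofReal_le_ofReal (le_of_eq ?_)
  ring

end

/-! ### Calculus of derivative bounds: products, exponentials, powers -/

section

/-- The constants of a product in the Leibniz rule. -/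
abbrev leibnizConst (c c' : ℕ → ℝ) (n : ℕ) : ℝ :=
  ∑ i ∈ Finset.range (n + 1), n.choose i * c i * c' (n - i)

namespace DerivBound

variable {c c' : ℕ → ℝ} {A A' N N' : ℝ} {f g : ℝ → ℂ}

theorem contDiffAt (H : DerivBound c A N f) (n : ℕ) (x : ℝ) : ContDiffAt ℝ n f x :=
  (H.contDiff.of_le (by exact_mod_cast le_top)).contDiffAt

theorem mono (H : DerivBound c A N f) (hA : 0 ≤ A) (hAA : A ≤ A') (hN : 0 ≤ N) (hNN : N ≤ N') :
    DerivBound (fun n => |c n|) A' N' f := by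
  refine ⟨H.contDiff, fun n x => (H.bound n x).trans ?_⟩
  have : c n * A ≤ |c n| * A' := (mul_le_mul_of_nonneg_right (le_abs_self _) hA).trans
    (by gcongr)
  exact mul_le_mul this (by gcongr) (by positivity) (by positivity [hA.trans hAA])

theorem mul (H : DerivBound c A N f) (H' : DerivBound c' A' N g) :
    DerivBound (leibnizConst c c') (A * A') N
      (fun x => f x * g x) := by
  refine ⟨H.contDiff.mul H'.contDiff, fun n x => ?_⟩
  rw [iteratedDeriv_fun_mul (H.contDiffAt n x) (H'.contDiffAt n x), leibnizConst, Finset.sum_mul, Finset.sum_mul]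
  refine (norm_sum_le _ _).trans (Finset.sum_le_sum fun i hi => ?_)
  have hi : i ≤ n := Nat.lt_succ_iff.mp (Finset.mem_range.mp hi)
  rw [norm_mul, norm_mul, Complex.norm_natCast]
  calc _ ≤ n.choose i * (c i * A * N ^ i) * (c' (n - i) * A' * N ^ (n - i)) := by
        gcongr
        · exact mul_nonneg (by positivity) ((norm_nonneg _).trans (H.bound i x))
        · exact H.bound i x
        · exact H'.bound _ x
    _ = n.choose i * c i * c' (n - i) * (A * A') * (N ^ i * N ^ (n - i)) := by ring
    _ = _ := by rw [← pow_add, Nat.add_sub_cancel' hi]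

theorem const_mul (H : DerivBound c A N f) (a : ℂ) :
    DerivBound c (‖a‖ * A) N (fun x => a * f x) := by
  refine ⟨contDiff_const.mul H.contDiff, fun n x => ?_⟩
  rw [iteratedDeriv_const_mul_field, norm_mul]
  calc ‖a‖ * ‖iteratedDeriv n f x‖ ≤ ‖a‖ * (c n * A * N ^ n) := by gcongr; exact H.bound n x
    _ = _ := by ring

theorem comp_mul (H : DerivBound c A N f) {r : ℝ} (hr : 0 ≤ r) :
    DerivBound c A (r * N) (fun x => f (r * x)) := by
  refine ⟨H.contDiff.comp (contDiff_const.mul contDiff_id), fun n x => ?_⟩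
  rw [iteratedDeriv_comp_const_smul (H.contDiff.of_le (by exact_mod_cast le_top))]
  rw [norm_smul, norm_pow, Real.norm_eq_abs, abs_of_nonneg hr, mul_pow]
  calc _ ≤ r ^ n * (c n * A * N ^ n) := by gcongr; exact H.bound n _
    _ = _ := by ring

/-- The bound on `f` itself is an independent input: for functions such as `e^{iνθ} - 1` it is
smaller than the size of the two terms, and differentiation kills the constant. -/
theorem of_deriv (hf : Differentiable ℝ f) {g : ℝ → ℂ} (hg : ∀ x, deriv f x = g x)
    (H : DerivBound c (A * N) N g) {C : ℝ} (h0 : ∀ x, ‖f x‖ ≤ C * A) :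
    DerivBound (fun n => Nat.casesOn n C c) A N f := by
  obtain rfl : deriv f = g := funext hg
  refine ⟨contDiff_infty_iff_deriv.mpr ⟨hf, H.contDiff⟩, fun n x => ?_⟩
  cases n with
  | zero => simpa using h0 x
  | succ n =>
    rw [iteratedDeriv_succ']
    refine (H.bound n x).trans (le_of_eq ?_)
    simp only
    ring

end DerivBound

theorem exists_derivBound {ι : Type*} {f : ι → ℝ → ℂ} {A N : ι → ℝ}
    (hf : ∀ i, ContDiff ℝ ((⊤ : ℕ∞) : WithTop ℕ∞) (f i))
    (h : ∀ n, ∃ C, ∀ i x, ‖iteratedDeriv n (f i) x‖ ≤ C * A i * N i ^ n) :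
    ∃ c, ∀ i, DerivBound c (A i) (N i) (f i) := by
  choose c hc using h
  exact ⟨c, fun i => ⟨hf i, fun n x => hc n i x⟩⟩

/-- Each derivative is continuous, hence bounded on the compact interval, and off it only the value
`a` itself survives. -/
theorem exists_derivBound_of_eq_const {f : ℝ → ℂ} (hf : ContDiff ℝ ((⊤ : ℕ∞) : WithTop ℕ∞) f)
    {r : ℝ} {a : ℂ} (h : ∀ x, r < |x| → f x = a) : ∃ c, DerivBound c 1 1 f := by
  obtain ⟨c, hc⟩ := exists_derivBound (ι := Unit) (f := fun _ => f) (A := fun _ => 1)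
    (N := fun _ => 1) (fun _ => hf) (fun n => by
      have hcont : Continuous (iteratedDeriv n f) :=
        hf.continuous_iteratedDeriv n (by exact_mod_cast le_top)
      obtain ⟨C, hC⟩ := (isCompact_Icc (a := -r) (b := r)).exists_bound_of_continuousOn
        hcont.continuousOn
      refine ⟨max C ‖a‖, fun _ x => ?_⟩
      rw [one_pow, mul_one, mul_one]
      by_cases hx : x ∈ Set.Icc (-r) r
      · exact (hC x hx).trans (le_max_left _ _)
      · rw [Set.mem_Icc, ← abs_le, not_le] at hx
        have : f =ᶠ[nhds x] fun _ => a := by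
          filter_upwards [(isOpen_lt continuous_const continuous_abs).mem_nhds hx] with y hy
          exact h y hy
        rw [this.iteratedDeriv_eq, iteratedDeriv_const]
        split_ifs <;> simp)
  exact ⟨c, hc ()⟩

theorem DerivBound.deriv_ofReal {c : ℕ → ℝ} {θ : ℝ → ℝ} (hd : Differentiable ℝ θ)
    (H : DerivBound c 1 1 (fun x => ((θ x : ℝ) : ℂ))) :
    DerivBound (fun n => c (n + 1)) 1 1 (fun x => ((deriv θ x : ℝ) : ℂ)) := by
  have e : deriv (fun x => ((θ x : ℝ) : ℂ)) = fun x => ((deriv θ x : ℝ) : ℂ) :=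
    funext fun x => (hd x).hasDerivAt.ofReal_comp.deriv
  refine ⟨e ▸ (contDiff_infty_iff_deriv.mp H.contDiff).2, fun n x => ?_⟩
  have := H.bound (n + 1) x
  rw [iteratedDeriv_succ', e] at this
  simpa using this

section Phase

variable {θ : ℝ → ℝ} {c : ℕ → ℝ}

theorem hasDerivAt_cexp_phase (hθ : Differentiable ℝ θ) (ν x : ℝ) :
    HasDerivAt (fun x => Complex.exp (Complex.I * ((ν * θ x : ℝ) : ℂ)))
      ((ν : ℂ) * (Complex.I * ((deriv θ x : ℝ) : ℂ) *
        Complex.exp (Complex.I * ((ν * θ x : ℝ) : ℂ)))) x := by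
  have h1 : HasDerivAt (fun x => ((ν * θ x : ℝ) : ℂ)) ((ν * deriv θ x : ℝ) : ℂ) x :=
    ((hθ x).hasDerivAt.const_mul ν).ofReal_comp
  convert! (h1.const_mul Complex.I).cexp using 1
  push_cast
  ring

theorem norm_cexp_phase (t : ℝ) : ‖Complex.exp (Complex.I * (t : ℂ))‖ = 1 := by
  rw [mul_comm, Complex.norm_exp_ofReal_mul_I]

/-- The derivative is `iνθ'` times the function, so the Leibniz rule and strong induction cost one
factor `ν` per derivative. The frequency is `max 1 |ν|` so that derivatives falling on `θ'` are
covered too. -/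
theorem exists_derivBound_cexp (hθ : ContDiff ℝ ((⊤ : ℕ∞) : WithTop ℕ∞) θ)
    (H : DerivBound c 1 1 (fun x => ((deriv θ x : ℝ) : ℂ))) :
    ∃ c', ∀ ν : ℝ, DerivBound c' 1 (max 1 |ν|)
      (fun x => Complex.exp (Complex.I * ((ν * θ x : ℝ) : ℂ))) := by
  have hd : Differentiable ℝ θ := hθ.differentiable (by simp)
  have hsm : ∀ ν : ℝ, ContDiff ℝ ((⊤ : ℕ∞) : WithTop ℕ∞)
      (fun x => Complex.exp (Complex.I * ((ν * θ x : ℝ) : ℂ))) := fun ν =>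
    (contDiff_const.mul (Complex.ofRealCLM.contDiff.comp (contDiff_const.mul hθ))).cexp
  refine exists_derivBound (hsm) fun n => ?_
  induction n using Nat.strong_induction_on with
  | _ n ih =>
  cases n with
  | zero => exact ⟨1, fun ν x => by simp [-Complex.ofReal_mul]⟩
  | succ n =>
    choose! C hC using ih
    refine ⟨∑ i ∈ Finset.range (n + 1), n.choose i * c i * C (n - i), fun ν x => ?_⟩
    have e : deriv (fun x => Complex.exp (Complex.I * ((ν * θ x : ℝ) : ℂ))) = fun x =>
        (ν : ℂ) * Complex.I * (((deriv θ x : ℝ) : ℂ) *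
          Complex.exp (Complex.I * ((ν * θ x : ℝ) : ℂ))) := by
      ext x
      rw [(hasDerivAt_cexp_phase hd ν x).deriv]
      ring
    rw [iteratedDeriv_succ', e, iteratedDeriv_const_mul_field, norm_mul,
      iteratedDeriv_fun_mul (H.contDiffAt n x)
        (((hsm ν).of_le (by exact_mod_cast le_top)).contDiffAt)]
    have h1 : ‖(ν : ℂ) * Complex.I‖ ≤ max 1 |ν| := by
      simp
    have h2 : ‖∑ i ∈ Finset.range (n + 1), (n.choose i : ℂ) *
        iteratedDeriv i (fun x => ((deriv θ x : ℝ) : ℂ)) x * iteratedDeriv (n - i)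
          (fun x => Complex.exp (Complex.I * ((ν * θ x : ℝ) : ℂ))) x‖ ≤
        (∑ i ∈ Finset.range (n + 1), n.choose i * c i * C (n - i)) * (max 1 |ν|) ^ n := by
      rw [Finset.sum_mul]
      refine (norm_sum_le _ _).trans (Finset.sum_le_sum fun i hi => ?_)
      have hi : i ≤ n := Nat.lt_succ_iff.mp (Finset.mem_range.mp hi)
      rw [norm_mul, norm_mul, Complex.norm_natCast]
      have b1 := H.bound i x
      have b2 := hC (n - i) (by omega) ν x
      rw [one_pow, mul_one, mul_one] at b1
      rw [mul_one] at b2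
      have b3 : (max 1 |ν|) ^ (n - i) ≤ (max 1 |ν|) ^ n :=
        pow_le_pow_right₀ (le_max_left _ _) (by omega)
      -- The inductive constants come without a sign; a negative one would bound a norm by a
      -- negative number.
      have b4 : 0 ≤ C (n - i) := by
        by_contra hcon
        have : C (n - i) * (max 1 |ν|) ^ (n - i) < 0 :=
          mul_neg_of_neg_of_pos (not_le.mp hcon) (by positivity)
        linarith [norm_nonneg (iteratedDeriv (n - i)
          (fun x => Complex.exp (Complex.I * ((ν * θ x : ℝ) : ℂ))) x)]
      calc _ ≤ n.choose i * c i * (C (n - i) * max 1 |ν| ^ (n - i)) := by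
            gcongr
            exact mul_nonneg (by positivity) ((norm_nonneg _).trans b1)
        _ ≤ n.choose i * c i * (C (n - i) * max 1 |ν| ^ n) := by
            have : 0 ≤ c i := (norm_nonneg _).trans b1
            gcongr
        _ = _ := by ring
    calc _ ≤ max 1 |ν| * ((∑ i ∈ Finset.range (n + 1), n.choose i * c i * C (n - i)) *
          (max 1 |ν|) ^ n) := by gcongr
      _ = _ := by ring

/-- For small `ν` the difference is of size `|ν|`, and its derivative has size `|ν| = min 1 |ν| *
max 1 |ν|`, which is the amplitude times the frequency. The gain `|ν|` is what makes the dyadic sums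
near the origin converge. -/
theorem exists_derivBound_cexp_sub_one (hθ : ContDiff ℝ ((⊤ : ℕ∞) : WithTop ℕ∞) θ)
    (H : DerivBound c 1 1 (fun x => ((θ x : ℝ) : ℂ))) :
    ∃ c', ∀ ν : ℝ, DerivBound c' (min 1 |ν|) (max 1 |ν|)
      (fun x => Complex.exp (Complex.I * ((ν * θ x : ℝ) : ℂ)) - 1) := by
  have hd : Differentiable ℝ θ := hθ.differentiable (by simp)
  have H' := H.deriv_ofReal hd
  obtain ⟨c1, hc1⟩ := exists_derivBound_cexp hθ H'
  have hθb : ∀ x, |θ x| ≤ c 0 := fun x => by simpa using H.bound 0 x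
  have hc0 : 0 ≤ c 0 := (abs_nonneg _).trans (hθb 0)
  refine ⟨fun n => Nat.casesOn n (2 + c 0)
    (leibnizConst (fun n => |c (n + 1)|) c1),
    fun ν => DerivBound.of_deriv (C := 2 + c 0)
    (g := fun x => (ν : ℂ) * Complex.I * (((deriv θ x : ℝ) : ℂ) *
      Complex.exp (Complex.I * ((ν * θ x : ℝ) : ℂ)))) (fun x =>
      ((hasDerivAt_cexp_phase hd ν x).sub_const 1).differentiableAt) (fun x => ?_) ?_ fun x => ?_⟩
  · rw [((hasDerivAt_cexp_phase hd ν x).sub_const 1).deriv]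
    ring
  · have := ((H'.mono zero_le_one le_rfl zero_le_one (le_max_left 1 |ν|)).mul (hc1 ν)).const_mul
      ((ν : ℂ) * Complex.I)
    convert! this using 1
    simp [min_mul_max]
  · have h1 : ‖Complex.exp (Complex.I * ((ν * θ x : ℝ) : ℂ)) - 1‖ ≤ 2 := by
      refine (norm_sub_le _ _).trans ?_
      rw [norm_cexp_phase]
      norm_num
    have h2 : ‖Complex.exp (Complex.I * ((ν * θ x : ℝ) : ℂ)) - 1‖ ≤ |ν| * c 0 := by
      refine (Real.norm_exp_I_mul_ofReal_sub_one_le).trans ?_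
      rw [Real.norm_eq_abs, abs_mul]
      gcongr
      exact hθb x
    rcases min_cases 1 |ν| with ⟨h, -⟩ | ⟨h, -⟩ <;> rw [h] <;> nlinarith [abs_nonneg ν]

theorem hasDerivAt_rpow_symbol (hθ : Differentiable ℝ θ) {β μ ν x : ℝ} (hx : 0 < μ + ν * θ x) :
    HasDerivAt (fun x => (((μ + ν * θ x) ^ (-β) : ℝ) : ℂ))
      (((-β * ν : ℝ) : ℂ) * (((deriv θ x : ℝ) : ℂ) * (((μ + ν * θ x) ^ (-(β + 1)) : ℝ) : ℂ))) x := by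
  have h1 : HasDerivAt (fun x => μ + ν * θ x) (ν * deriv θ x) x :=
    ((hθ x).hasDerivAt.const_mul ν).const_add μ
  convert! (h1.rpow_const (p := -β) (Or.inl hx.ne')).ofReal_comp using 1
  rw [show -(β + 1) = -β - 1 by ring]
  push_cast
  ring

/-- Differentiation replaces `β` by `β + 1` and produces the factor `ν θ'`, so the induction runs
over all `β ≥ 0` at once. Two parameters are kept because far shells use the base `r^(-b) + θ` and
near shells the base `1 + r^b θ`, with one constant for all `r`. -/
theorem exists_derivBound_rpow (hθ : ContDiff ℝ ((⊤ : ℕ∞) : WithTop ℕ∞) θ)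
    (H : DerivBound c 1 1 (fun x => ((deriv θ x : ℝ) : ℂ))) {κ : ℝ} (hκ : 0 < κ)
    {β : ℝ} (hβ : 0 ≤ β) :
    ∃ c', ∀ μν : {μν : ℝ × ℝ // |μν.2| ≤ 1 ∧ ∀ x, κ ≤ μν.1 + μν.2 * θ x},
      DerivBound c' 1 1 (fun x => (((μν.1.1 + μν.1.2 * θ x) ^ (-β) : ℝ) : ℂ)) := by
  have hd : Differentiable ℝ θ := hθ.differentiable (by simp)
  have hsm : ∀ (β : ℝ) (μν : {μν : ℝ × ℝ // |μν.2| ≤ 1 ∧ ∀ x, κ ≤ μν.1 + μν.2 * θ x}),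
      ContDiff ℝ ((⊤ : ℕ∞) : WithTop ℕ∞)
      (fun x => (((μν.1.1 + μν.1.2 * θ x) ^ (-β) : ℝ) : ℂ)) := fun β μν =>
    Complex.ofRealCLM.contDiff.comp ((contDiff_const.add (contDiff_const.mul hθ)).rpow_const_of_ne
      fun x => (hκ.trans_le (μν.2.2 x)).ne')
  refine exists_derivBound (hsm β) fun n => ?_
  induction n using Nat.strong_induction_on generalizing β with
  | _ n ih =>
  cases n with
  | zero =>
    refine ⟨κ ^ (-β), fun μν x => ?_⟩
    rw [iteratedDeriv_zero, Complex.norm_real, Real.norm_eq_abs,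
      abs_of_nonneg (Real.rpow_nonneg (hκ.le.trans (μν.2.2 x)) _)]
    simpa using Real.rpow_le_rpow_of_nonpos hκ (μν.2.2 x) (by linarith)
  | succ n =>
    have ih' := fun m hm => @ih m hm (β + 1) (by linarith)
    choose! C hC using ih'
    refine ⟨β * ∑ i ∈ Finset.range (n + 1), n.choose i * c i * C (n - i), fun μν x => ?_⟩
    have e : deriv (fun x => (((μν.1.1 + μν.1.2 * θ x) ^ (-β) : ℝ) : ℂ)) = fun x =>
        ((-β * μν.1.2 : ℝ) : ℂ) * (((deriv θ x : ℝ) : ℂ) *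
          (((μν.1.1 + μν.1.2 * θ x) ^ (-(β + 1)) : ℝ) : ℂ)) := by
      ext x
      rw [(hasDerivAt_rpow_symbol hd (hκ.trans_le (μν.2.2 x))).deriv]
    rw [iteratedDeriv_succ', e, iteratedDeriv_const_mul_field, norm_mul,
      iteratedDeriv_fun_mul (H.contDiffAt n x)
        (((hsm (β + 1) μν).of_le (by exact_mod_cast le_top)).contDiffAt)]
    simp only [one_pow, mul_one]
    have h1 : ‖((-β * μν.1.2 : ℝ) : ℂ)‖ ≤ β := by
      rw [Complex.norm_real, Real.norm_eq_abs, abs_mul, abs_neg, abs_of_nonneg hβ]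
      nlinarith [μν.2.1]
    refine mul_le_mul h1 ((norm_sum_le _ _).trans (Finset.sum_le_sum fun i hi => ?_))
      (norm_nonneg _) hβ
    rw [norm_mul, norm_mul, Complex.norm_natCast]
    have b1 := H.bound i x
    have b2 := hC (n - i) (by omega) μν x
    simp only [one_pow, mul_one] at b1 b2
    gcongr
    exact mul_nonneg (by positivity) ((norm_nonneg _).trans b1)

/-- The difference vanishes to first order in `ν`, and each derivative carries a factor `ν`, so `ν`
serves as amplitude at frequency `1`. -/
theorem exists_derivBound_rpow_sub_one (hθ : ContDiff ℝ ((⊤ : ℕ∞) : WithTop ℕ∞) θ)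
    (H : DerivBound c 1 1 (fun x => ((deriv θ x : ℝ) : ℂ))) {B : ℝ} (h0 : ∀ x, 0 ≤ θ x)
    (hB : ∀ x, θ x ≤ B) {β : ℝ} (hβ : 0 ≤ β) :
    ∃ c', ∀ ν : ℝ, 0 ≤ ν → ν ≤ 1 →
      DerivBound c' ν 1 (fun x => (((1 + ν * θ x) ^ (-β) : ℝ) : ℂ) - 1) := by
  have hd : Differentiable ℝ θ := hθ.differentiable (by simp)
  obtain ⟨c1, hc1⟩ := exists_derivBound_rpow hθ H one_pos (β := β + 1) (by linarith)
  refine ⟨fun n => Nat.casesOn n (β * B) fun n => β * ∑ i ∈ Finset.range (n + 1), n.choose i * c i * c1 (n - i),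
    fun ν hν hν1 => ?_⟩
  have hpos : ∀ x, 1 ≤ 1 + ν * θ x := fun x => by nlinarith [h0 x]
  have hder := fun x => (hasDerivAt_rpow_symbol hd (β := β)
    (one_pos.trans_le (hpos x))).sub_const 1
  refine DerivBound.of_deriv (fun x => (hder x).differentiableAt) (fun x => (hder x).deriv) ?_
    fun x => ?_
  · have := (H.mul (hc1 ⟨(1, ν), by simpa [abs_of_nonneg hν], hpos⟩)).const_mul ((-β * ν : ℝ) : ℂ)
    refine ⟨this.contDiff, fun n x => (this.bound n x).trans (le_of_eq ?_)⟩
    rw [Complex.norm_real, Real.norm_eq_abs, abs_mul, abs_neg, abs_of_nonneg hβ, abs_of_nonneg hν]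
    ring
  · have h1 : (1 + ν * θ x) ^ (-β) ≤ 1 := Real.rpow_le_one_of_one_le_of_nonpos (hpos x) (by linarith)
    -- Bernoulli's inequality for a negative exponent, from `1 + x ≤ e^x` and `log x ≤ x - 1`.
    have h2 : 1 - β * (ν * θ x) ≤ (1 + ν * θ x) ^ (-β) := by
      have hx := one_pos.trans_le (hpos x)
      rw [Real.rpow_def_of_pos hx]
      have := Real.add_one_le_exp (Real.log (1 + ν * θ x) * -β)
      nlinarith [Real.log_le_sub_one_of_pos hx]
    rw [← Complex.ofReal_one, ← Complex.ofReal_sub, Complex.norm_real, Real.norm_eq_abs,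
      abs_of_nonpos (by linarith)]
    have : β * (ν * θ x) ≤ β * (ν * B) := by gcongr; exact hB x
    linarith

end Phase

end

/-! ### Cutoffs, the dyadic partition and powers made globally smooth -/

noncomputable section

/-- A smooth function equal to `1` on `(-∞, 1]` and to `0` on `[2, ∞)`. -/
def lowCut (s : ℝ) : ℝ := Real.smoothTransition (2 - s)

/-- The dyadic bump `lowCut s - lowCut (2 * s)`, supported in `[1/2, 2]`. -/
def bumpCut (s : ℝ) : ℝ := lowCut s - lowCut (2 * s)

/-- An even smooth function equal to `1` on `[-1/2, 1/2]` and to `0` off `(-1, 1)`. -/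
def evenCut (s : ℝ) : ℝ := lowCut (2 * s) * lowCut (-(2 * s))

theorem lowCut_of_le {s : ℝ} (h : s ≤ 1) : lowCut s = 1 :=
  Real.smoothTransition.one_of_one_le (by linarith)

theorem lowCut_of_ge {s : ℝ} (h : 2 ≤ s) : lowCut s = 0 :=
  Real.smoothTransition.zero_of_nonpos (by linarith)

theorem contDiff_lowCut : ContDiff ℝ ((⊤ : ℕ∞) : WithTop ℕ∞) lowCut :=
  Real.smoothTransition.contDiff.comp (contDiff_const.sub contDiff_id)

theorem contDiff_bumpCut : ContDiff ℝ ((⊤ : ℕ∞) : WithTop ℕ∞) bumpCut :=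
  contDiff_lowCut.sub (contDiff_lowCut.comp (contDiff_const.mul contDiff_id))

theorem contDiff_evenCut : ContDiff ℝ ((⊤ : ℕ∞) : WithTop ℕ∞) evenCut :=
  (contDiff_lowCut.comp (contDiff_const.mul contDiff_id)).mul
    (contDiff_lowCut.comp (contDiff_const.mul contDiff_id).neg)

theorem bumpCut_of_le {s : ℝ} (h : s ≤ 1 / 2) : bumpCut s = 0 := by
  rw [bumpCut, lowCut_of_le (by linarith), lowCut_of_le (by linarith), sub_self]

theorem bumpCut_of_ge {s : ℝ} (h : 2 ≤ s) : bumpCut s = 0 := by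
  rw [bumpCut, lowCut_of_ge h, lowCut_of_ge (by linarith), sub_self]

theorem evenCut_of_abs_le {s : ℝ} (h : |s| ≤ 1 / 2) : evenCut s = 1 := by
  have := abs_le.mp h
  rw [evenCut, lowCut_of_le (by linarith), lowCut_of_le (by linarith), one_mul]

theorem evenCut_of_le_abs {s : ℝ} (h : 1 ≤ |s|) : evenCut s = 0 := by
  rcases le_abs.mp h with h | h
  · rw [evenCut, lowCut_of_ge (by linarith), zero_mul]
  · rw [evenCut, lowCut_of_ge (s := -(2 * s)) (by linarith), mul_zero]

theorem evenCut_neg (s : ℝ) : evenCut (-s) = evenCut s := by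
  simp [evenCut, mul_comm]

theorem lowCut_eq_evenCut {s : ℝ} (h : 0 ≤ s) : lowCut (2 * s) = evenCut s := by
  rw [evenCut, lowCut_of_le (s := -(2 * s)) (by linarith), mul_one]

theorem exists_derivBound_bumpCut : ∃ c, DerivBound c 1 1 (fun x => (bumpCut x : ℂ)) :=
  exists_derivBound_of_eq_const (r := 2) (a := 0) (Complex.ofRealCLM.contDiff.comp contDiff_bumpCut)
    fun x hx => by
      rcases lt_abs.mp hx with h | h
      · simp [bumpCut_of_ge h.le]
      · simp [bumpCut_of_le (s := x) (by linarith)]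

theorem exists_derivBound_evenCut : ∃ c, DerivBound c 1 1 (fun x => (evenCut x : ℂ)) :=
  exists_derivBound_of_eq_const (r := 1) (a := 0) (Complex.ofRealCLM.contDiff.comp contDiff_evenCut)
    fun x hx => by simp [evenCut_of_le_abs hx.le]

theorem sum_bumpCut_two_pow (n : ℕ) (t : ℝ) :
    ∑ j ∈ Finset.range n, bumpCut (2 ^ j * t) = lowCut t - lowCut (2 ^ n * t) := by
  induction n with
  | zero => simp
  | succ n ih =>
    rw [Finset.sum_range_succ, ih, bumpCut, pow_succ', mul_assoc]
    ring

/-- The bumps telescope, and for `t > 0` only finitely many of them are nonzero. At `t = 0` every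
bump vanishes and the identity fails. -/
theorem hasSum_bumpCut_two_pow {t : ℝ} (ht : 0 < t) :
    HasSum (fun j : ℕ => bumpCut (2 ^ j * t)) (lowCut t) := by
  obtain ⟨n, hn⟩ := pow_unbounded_of_one_lt (2 / t) (one_lt_two (α := ℝ))
  rw [div_lt_iff₀ ht] at hn
  have h := hasSum_sum_of_ne_finset_zero (L := .unconditional ℕ) (f := fun j : ℕ => bumpCut (2 ^ j * t))
    (s := Finset.range n) fun j hj => bumpCut_of_ge (hn.le.trans (by
      have : n ≤ j := by simpa using hj
      gcongr
      norm_num))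
  rwa [sum_bumpCut_two_pow, lowCut_of_ge hn.le, sub_zero] at h

theorem sum_bumpCut_two_inv_pow (n : ℕ) (t : ℝ) :
    ∑ j ∈ Finset.range n, bumpCut ((2⁻¹ : ℝ) ^ j * t) =
      lowCut ((2⁻¹ : ℝ) ^ n * (2 * t)) - lowCut (2 * t) := by
  induction n with
  | zero => simp
  | succ n ih =>
    rw [Finset.sum_range_succ, ih, bumpCut, pow_succ]
    have : (2⁻¹ : ℝ) ^ n * 2⁻¹ * (2 * t) = 2⁻¹ ^ n * t := by ring
    rw [this, mul_left_comm]
    ring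

theorem hasSum_bumpCut_two_inv_pow (t : ℝ) :
    HasSum (fun j : ℕ => bumpCut ((2⁻¹ : ℝ) ^ j * t)) (1 - lowCut (2 * t)) := by
  obtain ⟨n, hn⟩ := pow_unbounded_of_one_lt (2 * t) (one_lt_two (α := ℝ))
  have hle : ∀ j, n ≤ j → (2⁻¹ : ℝ) ^ j * (2 * t) ≤ 1 := fun j hj => by
    rw [inv_pow, inv_mul_le_iff₀ (by positivity), mul_one]
    exact hn.le.trans (pow_le_pow_right₀ one_le_two hj)
  have h := hasSum_sum_of_ne_finset_zero (L := .unconditional ℕ) (f := fun j : ℕ => bumpCut ((2⁻¹ : ℝ) ^ j * t))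
    (s := Finset.range n) fun j hj => bumpCut_of_le (by
      have := hle j (by simpa using hj)
      linarith)
  rwa [sum_bumpCut_two_inv_pow, lowCut_of_le (hle n le_rfl)] at h

/-- A smooth function equal to the identity on `[1/2, 2]`, with values in `[1/4, 3]`. -/
def clampId (s : ℝ) : ℝ :=
  1 + Real.smoothTransition (4 * s - 1) * Real.smoothTransition (3 - s) * (s - 1)

theorem contDiff_clampId : ContDiff ℝ ((⊤ : ℕ∞) : WithTop ℕ∞) clampId :=
  contDiff_const.add (((Real.smoothTransition.contDiff.comp
    ((contDiff_const.mul contDiff_id).sub contDiff_const)).mul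
    (Real.smoothTransition.contDiff.comp (contDiff_const.sub contDiff_id))).mul
    (contDiff_id.sub contDiff_const))

theorem clampId_of_mem {s : ℝ} (h1 : 1 / 2 ≤ s) (h2 : s ≤ 2) : clampId s = s := by
  rw [clampId, Real.smoothTransition.one_of_one_le (by linarith),
    Real.smoothTransition.one_of_one_le (by linarith)]
  ring

theorem clampId_of_abs_gt {s : ℝ} (h : 3 < |s|) : clampId s = 1 := by
  rcases lt_abs.mp h with h | h
  · rw [clampId, Real.smoothTransition.zero_of_nonpos (x := 3 - s) (by linarith)]
    ring
  · rw [clampId, Real.smoothTransition.zero_of_nonpos (x := 4 * s - 1) (by linarith)]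
    ring

theorem clampId_mem (s : ℝ) : 1 / 4 ≤ clampId s ∧ clampId s ≤ 3 := by
  have h1 := Real.smoothTransition.nonneg (4 * s - 1)
  have h2 := Real.smoothTransition.le_one (4 * s - 1)
  have h3 := Real.smoothTransition.nonneg (3 - s)
  have h4 := Real.smoothTransition.le_one (3 - s)
  rcases le_or_gt s (1 / 4) with h | h
  · rw [clampId, Real.smoothTransition.zero_of_nonpos (x := 4 * s - 1) (by linarith)]
    norm_num
  rcases le_or_gt 3 s with h' | h'
  · rw [clampId, Real.smoothTransition.zero_of_nonpos (x := 3 - s) (by linarith)]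
    norm_num
  have h5 : Real.smoothTransition (4 * s - 1) * Real.smoothTransition (3 - s) ≤ 1 :=
    mul_le_one₀ h2 h3 h4
  have h6 : 0 ≤ Real.smoothTransition (4 * s - 1) * Real.smoothTransition (3 - s) := by positivity
  unfold clampId
  constructor <;> nlinarith

/-- A positive smooth function equal to `s ^ a` on `[1/2, 2]`. -/
def powSymbol (a s : ℝ) : ℝ := clampId s ^ a

theorem powSymbol_of_mem {a s : ℝ} (h1 : 1 / 2 ≤ s) (h2 : s ≤ 2) : powSymbol a s = s ^ a := by
  rw [powSymbol, clampId_of_mem h1 h2]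

theorem contDiff_powSymbol (a : ℝ) : ContDiff ℝ ((⊤ : ℕ∞) : WithTop ℕ∞) (powSymbol a) :=
  contDiff_clampId.rpow_const_of_ne fun s => by linarith [(clampId_mem s).1]

theorem powSymbol_mem {a : ℝ} (ha : 0 ≤ a) (s : ℝ) :
    (1 / 4) ^ a ≤ powSymbol a s ∧ powSymbol a s ≤ 3 ^ a := by
  have := clampId_mem s
  exact ⟨Real.rpow_le_rpow (by norm_num) this.1 ha, Real.rpow_le_rpow (by linarith) this.2 ha⟩

/-- Clamping the base away from `0` and making it constant far out removes the singularity of `s ^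
a`; products with `bumpCut` do not see the change. -/
theorem exists_derivBound_powSymbol (a : ℝ) :
    ∃ c, DerivBound c 1 1 (fun x => ((powSymbol a x : ℝ) : ℂ)) :=
  exists_derivBound_of_eq_const (r := 3) (a := 1)
    (Complex.ofRealCLM.contDiff.comp (contDiff_powSymbol a)) fun x hx => by
      simp [powSymbol, clampId_of_abs_gt hx]

end

/-! ### The one-dimensional factor `e^{iw|x|^p}`: total mass and tail of its transform -/

noncomputable section

/-- A dilation of the function keeps the `L¹` mass of its transform and only rescales the threshold.
-/
theorem lintegral_tail_fourier_dilate (g : ℝ → ℂ) {r : ℝ} (hr : r ≠ 0) (M : ℝ) :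
    ∫⁻ ξ in {ξ : ℝ | M < |ξ|}, ‖𝓕 (fun x => g (r * x)) ξ‖ₑ =
      ∫⁻ ξ in {ξ : ℝ | M / |r| < |ξ|}, ‖𝓕 g ξ‖ₑ := by
  have hr' : r⁻¹ ≠ 0 := inv_ne_zero hr
  have hr0 : 0 < |r| := abs_pos.mpr hr
  have h1 : ∀ ξ, ‖𝓕 (fun x => g (r * x)) ξ‖ₑ = ENNReal.ofReal |r⁻¹| * ‖𝓕 g (r⁻¹ * ξ)‖ₑ := fun ξ => by
    have := fourier_comp_smul g hr ξ
    simp only [smul_eq_mul, Module.finrank_self, pow_one] at this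
    rw [this, Complex.real_smul, enorm_mul, ← ofReal_norm, Complex.norm_real, Real.norm_eq_abs,
      abs_abs]
  simp_rw [h1]
  rw [lintegral_const_mul' _ _ ENNReal.ofReal_ne_top]
  conv_rhs => rw [← Real.smul_map_volume_mul_left hr', Measure.restrict_smul,
    lintegral_smul_measure, smul_eq_mul]
  congr 1
  have := (MeasurableEquiv.mulLeft₀ r⁻¹ hr').measurableEmbedding.restrict_map volume
    {ξ : ℝ | M / |r| < |ξ|}
  have h2 : (⇑(MeasurableEquiv.mulLeft₀ r⁻¹ hr') : ℝ → ℝ) = fun x => r⁻¹ * x := rfl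
  rw [h2] at this
  rw [this, ← h2, lintegral_map_equiv, h2]
  congr 2
  ext ξ
  simp only [Set.mem_ofPred_eq, Set.mem_preimage, abs_mul, abs_inv]
  rw [inv_mul_eq_div, div_lt_div_iff_of_pos_right hr0]

theorem enorm_fourier_add_le {V : Type*} [NormedAddCommGroup V]
    [InnerProductSpace ℝ V] [MeasurableSpace V] [BorelSpace V] [FiniteDimensional ℝ V]
    {f g : V → ℂ} (hf : Integrable f) (hg : Integrable g) (ξ : V) :
    ‖𝓕 (fun x => f x + g x) ξ‖ₑ ≤ ‖𝓕 f ξ‖ₑ + ‖𝓕 g ξ‖ₑ := by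
  have : 𝓕 (fun x => f x + g x) ξ = 𝓕 f ξ + 𝓕 g ξ := by
    simp only [Real.fourier_eq, smul_add]
    exact integral_add ((Real.fourierIntegral_convergent_iff ξ).2 hf)
      ((Real.fourierIntegral_convergent_iff ξ).2 hg)
  rw [this]
  exact enorm_add_le _ _

theorem enorm_fourier_le_tsum {ι : Type*} [Countable ι] {V : Type*} [NormedAddCommGroup V]
    [InnerProductSpace ℝ V] [MeasurableSpace V] [BorelSpace V] [FiniteDimensional ℝ V]
    {f : ι → V → ℂ} {F : V → ℂ} (hi : ∀ j, Integrable (f j)) (hs : Summable fun j => ∫ x, ‖f j x‖)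
    (hF : ∀ x, HasSum (fun j => f j x) (F x)) (ξ : V) : ‖𝓕 F ξ‖ₑ ≤ ∑' j, ‖𝓕 (f j) ξ‖ₑ := by
  have h := hasSum_integral_of_summable_integral_norm (μ := volume)
    (F := fun j x => Real.fourierChar (-inner ℝ x ξ) • f j x)
    (fun j => (Real.fourierIntegral_convergent_iff ξ).2 (hi j)) (by simpa using hs)
  have e : 𝓕 F ξ = ∑' j, 𝓕 (f j) ξ := by
    simp only [Real.fourier_eq]
    rw [h.tsum_eq]
    congr 1 with x
    simp only [Circle.smul_def, smul_eq_mul]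
    rw [tsum_mul_left, (hF x).tsum_eq]
  rw [e]
  exact enorm_tsum_le_tsum_enorm

/-- The localized oscillating factor `e^{i w |x|^p}`. -/
def oscFactor (p w x : ℝ) : ℂ := Complex.exp (Complex.I * ((w * |x| ^ p : ℝ) : ℂ)) * (evenCut x : ℂ)

/-- A dyadic piece of `oscFactor p w - evenCut`, rescaled to `[1/2, 2]`. -/
def oscPiece (p v : ℝ) (j : ℕ) (x : ℝ) : ℂ :=
  (Complex.exp (Complex.I * ((v * powSymbol p x : ℝ) : ℂ)) - 1) *
    ((evenCut ((2⁻¹ : ℝ) ^ j * x) : ℂ) * (bumpCut x : ℂ))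

theorem exists_derivBound_oscPiece (p : ℝ) :
    ∃ c, ∀ v j, DerivBound c (min 1 |v|) (max 1 |v|) (oscPiece p v j) := by
  obtain ⟨c0, h0⟩ := exists_derivBound_powSymbol p
  obtain ⟨c1, h1⟩ := exists_derivBound_cexp_sub_one (contDiff_powSymbol p) h0
  obtain ⟨c2, h2⟩ := exists_derivBound_evenCut
  obtain ⟨c3, h3⟩ := exists_derivBound_bumpCut
  refine ⟨leibnizConst c1 (fun n => |leibnizConst (fun n => |c2 n|) c3 n|), fun v j => ?_⟩
  have h4 := (((h2.comp_mul (r := (2⁻¹ : ℝ) ^ j) (by positivity)).mono zero_le_one le_rfl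
    (by positivity) (N' := 1) (by
      rw [mul_one]; exact pow_le_one₀ (by norm_num) (by norm_num))).mul h3)
  have := (h1 v).mul (h4.mono (by norm_num) le_rfl zero_le_one (le_max_left 1 |v|))
  rw [mul_one, mul_one] at this
  exact this

theorem oscPiece_of_le {p v : ℝ} {j : ℕ} {x : ℝ} (hx : x ≤ 1 / 2) : oscPiece p v j x = 0 := by
  simp [oscPiece, bumpCut_of_le hx]

theorem oscPiece_of_ge {p v : ℝ} {j : ℕ} {x : ℝ} (hx : 2 ≤ x) : oscPiece p v j x = 0 := by
  simp [oscPiece, bumpCut_of_ge hx]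

theorem oscPiece_of_abs_gt {p v : ℝ} {j : ℕ} (x : ℝ) (hx : 2 < |x|) : oscPiece p v j x = 0 := by
  rcases lt_abs.mp hx with h | h
  · exact oscPiece_of_ge h.le
  · exact oscPiece_of_le (by linarith)

/-- A piece lives on `[1/2, 2]`, so the dilations by `2^j` and `-2^j` see `x > 0` and `x < 0`
separately. The `1` subtracted from the exponential makes the pieces small as the phase `w *
2^(-jp)` tends to zero; in the sum it amounts to the plain cutoff. -/
theorem hasSum_oscPiece {p : ℝ} (hp : 0 < p) (w x : ℝ) :
    HasSum (fun j : ℕ => oscPiece p (w * ((2⁻¹ : ℝ) ^ j) ^ p) j (2 ^ j * x) +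
      oscPiece p (w * ((2⁻¹ : ℝ) ^ j) ^ p) j (-2 ^ j * x)) (oscFactor p w x - (evenCut x : ℂ)) := by
  rcases eq_or_ne x 0 with rfl | hx
  · simp [oscFactor, hp.ne', oscPiece_of_le, hasSum_zero]
  have key : ∀ j : ℕ, oscPiece p (w * ((2⁻¹ : ℝ) ^ j) ^ p) j (2 ^ j * x) +
      oscPiece p (w * ((2⁻¹ : ℝ) ^ j) ^ p) j (-2 ^ j * x) =
      (oscFactor p w x - (evenCut x : ℂ)) * ((bumpCut (2 ^ j * |x|) : ℝ) : ℂ) := fun j => by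
    have h2 : (0 : ℝ) < 2 ^ j := by positivity
    have main : ∀ t : ℝ, 0 < t → oscPiece p (w * ((2⁻¹ : ℝ) ^ j) ^ p) j (2 ^ j * t) =
        (oscFactor p w t - (evenCut t : ℂ)) * ((bumpCut (2 ^ j * t) : ℝ) : ℂ) := fun t ht => by
      have e1 : (2⁻¹ : ℝ) ^ j * (2 ^ j * t) = t := by
        rw [← mul_assoc, ← mul_pow]; norm_num
      rcases le_or_gt (2 ^ j * t) (1 / 2) with h | h
      · rw [oscPiece_of_le h, bumpCut_of_le h]; simp
      rcases le_or_gt 2 (2 ^ j * t) with h' | h'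
      · rw [oscPiece_of_ge h', bumpCut_of_ge h']; simp
      rw [oscPiece, powSymbol_of_mem h.le h'.le, mul_assoc w, ← Real.mul_rpow (by positivity)
        (by positivity), e1, oscFactor, abs_of_pos ht]
      ring
    rcases hx.lt_or_gt with h | h
    · rw [oscPiece_of_le (x := 2 ^ j * x) (by nlinarith), zero_add, abs_of_neg h, neg_mul,
        ← mul_neg, main _ (neg_pos.mpr h), oscFactor, oscFactor, evenCut_neg, abs_neg]
    · rw [oscPiece_of_le (x := -2 ^ j * x) (by nlinarith), add_zero, abs_of_pos h, main _ h]
  simp_rw [key]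
  have h := ((hasSum_bumpCut_two_pow (abs_pos.mpr hx)).mapL Complex.ofRealCLM).mul_left
    (oscFactor p w x - (evenCut x : ℂ))
  convert! h using 1
  -- The bumps sum to `lowCut |x|`, which is `1` on the support of the even cutoff.
  rcases le_or_gt |x| 1 with h1 | h1
  · simp [lowCut_of_le h1]
  · simp [oscFactor, evenCut_of_le_abs h1.le]

theorem continuous_oscPiece (p v : ℝ) (j : ℕ) : Continuous (oscPiece p v j) := by
  obtain ⟨c, hc⟩ := exists_derivBound_oscPiece p
  exact (hc v j).contDiff.continuous

theorem continuous_evenCut : Continuous evenCut := contDiff_evenCut.continuous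

theorem integrable_evenCut : Integrable (fun x => (evenCut x : ℂ)) :=
  (Complex.continuous_ofReal.comp continuous_evenCut).integrable_of_hasCompactSupport
    (hasCompactSupport_of_abs_gt (r := 1) fun x hx => by simp [evenCut_of_le_abs hx.le])

theorem integrable_oscPiece (p v : ℝ) (j : ℕ) : Integrable (oscPiece p v j) :=
  (continuous_oscPiece p v j).integrable_of_hasCompactSupport
    (hasCompactSupport_of_abs_gt oscPiece_of_abs_gt)

theorem exists_integral_norm_oscPiece_le (p : ℝ) :
    ∃ C, ∀ v j, ∫ x, ‖oscPiece p v j x‖ ≤ C := by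
  obtain ⟨c, hc⟩ := exists_derivBound_oscPiece p
  refine ⟨4 * |c 0|, fun v j => ?_⟩
  rw [← ENNReal.ofReal_le_ofReal_iff (by positivity),
    ofReal_integral_norm_eq_lintegral_enorm (integrable_oscPiece p v j)]
  have := lintegral_rpow_enorm_le (h := oscPiece p v j) (B := |c 0|) (r := 2) (fun x => by
    have h1 := (hc v j).bound 0 x
    rw [iteratedDeriv_zero, pow_zero, mul_one] at h1
    have h2 : (0 : ℝ) ≤ min 1 |v| := by positivity
    have h3 : min 1 |v| ≤ 1 := min_le_left _ _
    nlinarith [le_abs_self (c 0), abs_nonneg (c 0)]) oscPiece_of_abs_gt one_pos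
  refine (le_of_eq ?_).trans (this.trans (le_of_eq ?_))
  · simp
  · rw [Real.rpow_one]; norm_num

/-- The piece at distance about `2^(-j)` from the origin, brought to unit scale, has its threshold
lowered from `M` to `M / 2^j`. A negative `M` is allowed and gives the total mass. -/
theorem lintegral_tail_oscFactor_le {p : ℝ} (hp : 0 < p) (w M : ℝ) :
    ∫⁻ ξ in {ξ : ℝ | M < |ξ|}, ‖𝓕 (oscFactor p w) ξ‖ₑ ≤
      (∫⁻ ξ in {ξ : ℝ | M < |ξ|}, ‖𝓕 (fun x => (evenCut x : ℂ)) ξ‖ₑ) +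
      ∑' j : ℕ, 2 * ∫⁻ ξ in {ξ : ℝ | M / 2 ^ j < |ξ|},
        ‖𝓕 (oscPiece p (w * ((2⁻¹ : ℝ) ^ j) ^ p) j) ξ‖ₑ := by
  set g : ℕ → ℝ → ℂ := fun j => oscPiece p (w * ((2⁻¹ : ℝ) ^ j) ^ p) j with hg
  have h2 : ∀ j : ℕ, (2 : ℝ) ^ j ≠ 0 := fun j => by positivity
  have h2' : ∀ j : ℕ, -(2 : ℝ) ^ j ≠ 0 := fun j => neg_ne_zero.mpr (h2 j)
  have hgi : ∀ j, Integrable (g j) := fun j => integrable_oscPiece _ _ _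
  have hg1 : ∀ j, Integrable (fun x => g j (2 ^ j * x)) := fun j => (hgi j).comp_mul_left' (h2 j)
  have hg2 : ∀ j, Integrable (fun x => g j (-2 ^ j * x)) := fun j => (hgi j).comp_mul_left' (h2' j)
  obtain ⟨C, hC⟩ := exists_integral_norm_oscPiece_le p
  have hsum : Summable fun j => ∫ x, ‖g j (2 ^ j * x) + g j (-2 ^ j * x)‖ := by
    refine Summable.of_nonneg_of_le (fun j => integral_nonneg fun _ => norm_nonneg _) (fun j => ?_)
      ((summable_geometric_two).mul_left (2 * C))
    calc ∫ x, ‖g j (2 ^ j * x) + g j (-2 ^ j * x)‖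
        ≤ ∫ x, (‖g j (2 ^ j * x)‖ + ‖g j (-2 ^ j * x)‖) :=
          integral_mono ((hg1 j).add (hg2 j)).norm ((hg1 j).norm.add (hg2 j).norm)
            fun x => norm_add_le _ _
      _ = 2 * (∫ x, ‖g j x‖) * (1 / 2) ^ j := by
          rw [integral_add (hg1 j).norm (hg2 j).norm,
            Measure.integral_comp_mul_left (fun x => ‖g j x‖),
            Measure.integral_comp_mul_left (fun x => ‖g j x‖)]
          simp
          ring
      _ ≤ _ := by
          gcongr
          exact hC _ _
  have hdiff : Integrable (fun x => oscFactor p w x - (evenCut x : ℂ)) := by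
    refine Integrable.sub ?_ integrable_evenCut
    refine integrable_evenCut.bdd_mul (c := 1) ?_ ?_
    · refine Continuous.aestronglyMeasurable ?_
      have := hp.le
      fun_prop (disch := assumption)
    · exact Filter.Eventually.of_forall fun x => (norm_cexp_phase _).le
  have hpt : ∀ ξ, ‖𝓕 (oscFactor p w) ξ‖ₑ ≤ ‖𝓕 (fun x => (evenCut x : ℂ)) ξ‖ₑ +
      ∑' j, (‖𝓕 (fun x => g j (2 ^ j * x)) ξ‖ₑ + ‖𝓕 (fun x => g j (-2 ^ j * x)) ξ‖ₑ) := fun ξ => by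
    have h := enorm_fourier_add_le integrable_evenCut hdiff ξ
    simp only [add_sub_cancel] at h
    refine h.trans (add_le_add_right ?_ _)
    refine (enorm_fourier_le_tsum (fun j => (hg1 j).add (hg2 j)) hsum
      (hasSum_oscPiece hp w) ξ).trans ?_
    exact ENNReal.tsum_le_tsum fun j => enorm_fourier_add_le (hg1 j) (hg2 j) ξ
  have hm : ∀ {f : ℝ → ℂ}, Integrable f → Measurable fun ξ => ‖𝓕 f ξ‖ₑ := fun hf =>
    (continuous_fourier_of_integrable hf).enorm.measurable
  refine (lintegral_mono hpt).trans ?_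
  rw [lintegral_add_left (hm integrable_evenCut)]
  refine add_le_add_right ?_ _
  rw [lintegral_tsum (f := fun j ξ => ‖𝓕 (fun x => g j (2 ^ j * x)) ξ‖ₑ +
    ‖𝓕 (fun x => g j (-2 ^ j * x)) ξ‖ₑ) fun j => ((hm (hg1 j)).add (hm (hg2 j))).aemeasurable]
  refine ENNReal.tsum_le_tsum fun j => ?_
  rw [lintegral_add_left (hm (hg1 j)), lintegral_tail_fourier_dilate _ (h2 j),
    lintegral_tail_fourier_dilate _ (h2' j), abs_neg, abs_of_pos (a := (2 : ℝ) ^ j) (by positivity), two_mul]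

/-- The total mass of the transform of a localized oscillating factor. -/
theorem exists_lintegral_fourier_oscFactor_le {p : ℝ} (hp : 0 < p) :
    ∃ C, 0 ≤ C ∧ ∀ w, ∫⁻ ξ, ‖𝓕 (oscFactor p w) ξ‖ₑ ≤
      ENNReal.ofReal (C * (1 + |w|) ^ (1 / 2 : ℝ)) := by
  obtain ⟨c, hc⟩ := exists_derivBound_oscPiece p
  obtain ⟨c2, h2⟩ := exists_derivBound_evenCut
  obtain ⟨C1, hC1, hB1⟩ := exists_lintegral_weight_fourier_le c le_rfl (r := 2) two_pos.le
  obtain ⟨C2, hC2, hB2⟩ := exists_lintegral_weight_fourier_le c2 le_rfl (r := 1) one_pos.le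
  simp only [Real.rpow_zero, ENNReal.ofReal_one, one_mul, zero_add] at hB1 hB2
  -- The phase of the `j`-th piece is `v = w * 2^(-jp)`, and its mass `|v|^(1/2)` is `|w|^(1/2) *
  -- q^j`.
  set q : ℝ := (2⁻¹ : ℝ) ^ (p / 2) with hq
  have hq0 : 0 < q := by positivity
  have hq1 : q < 1 := Real.rpow_lt_one (by norm_num) (by norm_num) (by linarith)
  have hsum : Summable fun j : ℕ => q ^ j := summable_geometric_of_lt_one hq0.le hq1
  refine ⟨C2 + 2 * C1 * ∑' j : ℕ, q ^ j, by positivity, fun w => ?_⟩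
  have hpiece : ∀ j : ℕ, ∫⁻ ξ, ‖𝓕 (oscPiece p (w * ((2⁻¹ : ℝ) ^ j) ^ p) j) ξ‖ₑ ≤
      ENNReal.ofReal (C1 * |w| ^ (1 / 2 : ℝ) * q ^ j) := fun j => by
    set v := w * ((2⁻¹ : ℝ) ^ j) ^ p with hv
    refine (hB1 _ _ _ (by positivity) (le_max_left _ _) (hc v j) oscPiece_of_abs_gt).trans
      (ENNReal.ofReal_le_ofReal ?_)
    have e : |v| ^ (1 / 2 : ℝ) = |w| ^ (1 / 2 : ℝ) * q ^ j := by
      rw [hv, abs_mul, abs_of_pos (a := ((2⁻¹ : ℝ) ^ j) ^ p) (by positivity),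
        Real.mul_rpow (abs_nonneg _) (by positivity), hq, ← Real.rpow_mul (by positivity),
        ← Real.rpow_natCast, ← Real.rpow_natCast, ← Real.rpow_mul (by positivity),
        ← Real.rpow_mul (by positivity)]
      congr 2; ring
    rw [mul_assoc, mul_assoc, ← e]
    gcongr
    -- For `|v| ≥ 1` Bernstein gives exactly `|v|^(1/2)`; for `|v| ≤ 1` the amplitude `|v|` is
    -- smaller than that.
    rcases le_total 1 |v| with h | h
    · rw [min_eq_left h, max_eq_right h, one_mul]
    · rw [min_eq_right h, max_eq_left h, Real.one_rpow, mul_one]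
      calc |v| = |v| ^ (1 : ℝ) := (Real.rpow_one _).symm
        _ ≤ _ := Real.rpow_le_rpow_of_exponent_ge' (abs_nonneg _) h (by norm_num) (by norm_num)
  have huniv : ∀ j : ℕ, {ξ : ℝ | (-1 : ℝ) / 2 ^ j < |ξ|} = Set.univ := fun j => by
    refine Set.eq_univ_of_forall fun ξ => ?_
    have : (-1 : ℝ) / 2 ^ j < 0 := div_neg_of_neg_of_pos (by norm_num) (by positivity)
    exact this.trans_le (abs_nonneg ξ)
  -- With the threshold `-1` every tail is the whole line.
  have h := lintegral_tail_oscFactor_le hp w (-1)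
  have hu0 := huniv 0
  rw [pow_zero, div_one] at hu0
  simp only [huniv, hu0, Measure.restrict_univ] at h
  refine h.trans ?_
  have hchi : ∫⁻ ξ, ‖𝓕 (fun x => (evenCut x : ℂ)) ξ‖ₑ ≤ ENNReal.ofReal C2 := by
    have := hB2 1 1 _ zero_le_one le_rfl h2 fun x hx => by simp [evenCut_of_le_abs hx.le]
    simpa using this
  have hs : ∑' j : ℕ, 2 * ∫⁻ ξ, ‖𝓕 (oscPiece p (w * ((2⁻¹ : ℝ) ^ j) ^ p) j) ξ‖ₑ ≤
      ENNReal.ofReal (2 * C1 * |w| ^ (1 / 2 : ℝ) * ∑' j : ℕ, q ^ j) := by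
    rw [← tsum_mul_left, ENNReal.ofReal_tsum_of_nonneg (fun j => by positivity) (hsum.mul_left _)]
    refine ENNReal.tsum_le_tsum fun j => ?_
    calc _ ≤ 2 * ENNReal.ofReal (C1 * |w| ^ (1 / 2 : ℝ) * q ^ j) := by gcongr; exact hpiece j
      _ = _ := by
        rw [← ENNReal.ofReal_ofNat 2, ← ENNReal.ofReal_mul (by norm_num)]
        congr 1; ring
  refine (add_le_add hchi hs).trans ?_
  have hS : 0 ≤ ∑' j : ℕ, q ^ j := tsum_nonneg fun j => by positivity
  rw [← ENNReal.ofReal_add hC2 (by positivity)]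
  refine ENNReal.ofReal_le_ofReal ?_
  have h3 : |w| ^ (1 / 2 : ℝ) ≤ (1 + |w|) ^ (1 / 2 : ℝ) := by gcongr; linarith
  have h4 : (1 : ℝ) ≤ (1 + |w|) ^ (1 / 2 : ℝ) :=
    Real.one_le_rpow (by linarith [abs_nonneg w]) (by norm_num)
  calc _ ≤ C2 * (1 + |w|) ^ (1 / 2 : ℝ) + 2 * C1 * (1 + |w|) ^ (1 / 2 : ℝ) * ∑' j : ℕ, q ^ j := by
        gcongr
        exact le_mul_of_one_le_right hC2 h4
    _ = _ := by ring

/-- The mass at high frequencies of the transform of a localized oscillating factor. -/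
theorem exists_lintegral_tail_oscFactor_le {p : ℝ} (hp : 1 ≤ p) {K : ℕ} (hK : 2 ≤ K) :
    ∃ C, 0 ≤ C ∧ ∀ w M, 0 < M → ∫⁻ ξ in {ξ : ℝ | M < |ξ|}, ‖𝓕 (oscFactor p w) ξ‖ₑ ≤
      ENNReal.ofReal (C * (1 + |w| ^ K * M ^ (1 - K : ℝ))) := by
  have hp0 : 0 < p := by linarith
  have hK' : (2 : ℝ) ≤ K := by exact_mod_cast hK
  obtain ⟨c, hc⟩ := exists_derivBound_oscPiece p
  obtain ⟨c2, h2⟩ := exists_derivBound_evenCut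
  obtain ⟨C1, hC1, hB1⟩ := exists_lintegral_weight_fourier_le c le_rfl (r := 2) two_pos.le
  obtain ⟨C2, hC2, hB2⟩ := exists_lintegral_weight_fourier_le c2 le_rfl (r := 1) one_pos.le
  simp only [Real.rpow_zero, ENNReal.ofReal_one, one_mul, zero_add] at hB1 hB2
  set D : ℝ := C1 + 8 * |c K| with hD
  have hD0 : 0 ≤ D := by positivity
  -- The weaker of the two terms below is a `1/K`-th power of a quantity decaying like `2^(-j)`.
  set q : ℝ := (2⁻¹ : ℝ) ^ (1 / K : ℝ) with hq
  have hq0 : 0 < q := by positivity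
  have hq1 : q < 1 := Real.rpow_lt_one (by norm_num) (by norm_num) (by positivity)
  have hsum : Summable fun j : ℕ => q ^ j := summable_geometric_of_lt_one hq0.le hq1
  have hS : 0 ≤ ∑' j : ℕ, q ^ j := tsum_nonneg fun j => by positivity
  -- Put `Y = |v|^K * R^(1-K)`. For `|v| ≥ 1` the tail estimate gives `Y`. For `|v| ≤ 1` the total
  -- mass `|v|` and the tail `|v| * R^(1-K)` are both available, and their minimum is at most `|v| *
  -- (R^(1-K))^(1/K) = Y^(1/K)`.
  have hpiece : ∀ (v : ℝ) (j : ℕ) (R : ℝ), 0 < R →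
      ∫⁻ ξ in {ξ : ℝ | R < |ξ|}, ‖𝓕 (oscPiece p v j) ξ‖ₑ ≤
      ENNReal.ofReal (D * (|v| ^ K * R ^ (1 - K : ℝ) +
        (|v| ^ K * R ^ (1 - K : ℝ)) ^ (1 / K : ℝ))) := fun v j R hR => by
    have b1 := (setLIntegral_le_lintegral {ξ : ℝ | R < |ξ|} _).trans
      (hB1 _ _ _ (by positivity) (le_max_left _ _) (hc v j) oscPiece_of_abs_gt)
    have b2 := (hc v j).lintegral_fourier_tail_le two_pos.le oscPiece_of_abs_gt hK hR
    have hcK := le_abs_self (c K)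
    rcases le_total 1 |v| with h | h
    · rw [min_eq_left h, max_eq_right h] at b2
      refine b2.trans (ENNReal.ofReal_le_ofReal ?_)
      calc 4 * 2 * (c K * 1 * |v| ^ K) * R ^ (1 - K : ℝ)
          = 8 * c K * (|v| ^ K * R ^ (1 - K : ℝ)) := by ring
        _ ≤ D * (|v| ^ K * R ^ (1 - K : ℝ)) := by gcongr; linarith
        _ ≤ _ := by gcongr; exact le_add_of_nonneg_right (by positivity)
    · rw [min_eq_right h, max_eq_left h] at b1 b2
      simp only [Real.one_rpow, one_pow, mul_one] at b1 b2
      set y := R ^ (1 - K : ℝ) with hy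
      have hy0 : 0 < y := by positivity
      have e : (|v| ^ K * y) ^ (1 / K : ℝ) = |v| * y ^ (1 / K : ℝ) := by
        rw [Real.mul_rpow (by positivity) hy0.le, one_div,
          Real.pow_rpow_inv_natCast (abs_nonneg v) (by omega)]
      have h3 : |v| * y ^ (1 / K : ℝ) ≤ |v| ^ K * y + (|v| ^ K * y) ^ (1 / K : ℝ) := by
        rw [e]; exact le_add_of_nonneg_left (by positivity)
      rcases le_total 1 y with h' | h'
      · refine b1.trans (ENNReal.ofReal_le_ofReal ?_)
        have h4 : (1 : ℝ) ≤ y ^ (1 / K : ℝ) := Real.one_le_rpow h' (by positivity)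
        calc C1 * |v| ≤ D * (|v| * y ^ (1 / K : ℝ)) := by
              gcongr
              · linarith [abs_nonneg (c K)]
              · exact le_mul_of_one_le_right (abs_nonneg v) h4
          _ ≤ _ := by gcongr
      · refine b2.trans (ENNReal.ofReal_le_ofReal ?_)
        have h4 : y ≤ y ^ (1 / K : ℝ) := by
          calc y = y ^ (1 : ℝ) := (Real.rpow_one y).symm
            _ ≤ _ := Real.rpow_le_rpow_of_exponent_ge hy0 h' (by
              rw [div_le_one (by linarith)]; linarith)
        calc 4 * 2 * (c K * |v|) * y = 8 * c K * (|v| * y) := by ring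
          _ ≤ D * (|v| * y ^ (1 / K : ℝ)) := by
              gcongr
              linarith
          _ ≤ _ := by gcongr
  refine ⟨C2 + 4 * D * ∑' j : ℕ, q ^ j, by positivity, fun w M hM => ?_⟩
  set Z := |w| ^ K * M ^ (1 - K : ℝ) with hZ
  have hZ0 : 0 ≤ Z := by positivity
  have hZj : ∀ j : ℕ, |w * ((2⁻¹ : ℝ) ^ j) ^ p| ^ K * (M / 2 ^ j) ^ (1 - K : ℝ) ≤
      Z * (2⁻¹ : ℝ) ^ j := fun j => by
    set t := (2⁻¹ : ℝ) ^ j with ht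
    have ht0 : 0 < t := by positivity
    have ht1 : t ≤ 1 := pow_le_one₀ (by norm_num) (by norm_num)
    have e1 : M / 2 ^ j = M * t := by rw [ht, inv_pow, div_eq_mul_inv]
    -- This is where `p ≥ 1` enters: the exponent `pK + 1 - K` is then at least `1`, so the tails of
    -- the pieces decay geometrically in `j`.
    have e2 : (t ^ p) ^ K * t ^ (1 - K : ℝ) ≤ t := by
      rw [← Real.rpow_natCast, ← Real.rpow_mul ht0.le, ← Real.rpow_add ht0]
      calc t ^ (p * K + (1 - K)) ≤ t ^ (1 : ℝ) :=
            Real.rpow_le_rpow_of_exponent_ge ht0 ht1 (by nlinarith)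
        _ = t := Real.rpow_one t
    rw [e1, abs_mul, abs_of_pos (a := t ^ p) (by positivity), mul_pow,
      Real.mul_rpow hM.le ht0.le, hZ]
    calc _ = |w| ^ K * M ^ (1 - K : ℝ) * ((t ^ p) ^ K * t ^ (1 - K : ℝ)) := by ring
      _ ≤ _ := by gcongr
  have hZ1 : Z ^ (1 / K : ℝ) ≤ 1 + Z := by
    rcases le_total 1 Z with h | h
    · have : Z ^ (1 / K : ℝ) ≤ Z ^ (1 : ℝ) := Real.rpow_le_rpow_of_exponent_le h (by
        rw [div_le_one (by linarith)]; linarith)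
      rw [Real.rpow_one] at this
      linarith
    · linarith [Real.rpow_le_one hZ0 h (by positivity : (0 : ℝ) ≤ 1 / K)]
  have hchi : ∫⁻ ξ in {ξ : ℝ | M < |ξ|}, ‖𝓕 (fun x => (evenCut x : ℂ)) ξ‖ₑ ≤ ENNReal.ofReal C2 := by
    have := hB2 1 1 _ zero_le_one le_rfl h2 fun x hx => by simp [evenCut_of_le_abs hx.le]
    refine (setLIntegral_le_lintegral _ _).trans ?_
    simpa using this
  have hs : ∑' j : ℕ, 2 * ∫⁻ ξ in {ξ : ℝ | M / 2 ^ j < |ξ|},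
        ‖𝓕 (oscPiece p (w * ((2⁻¹ : ℝ) ^ j) ^ p) j) ξ‖ₑ ≤
      ENNReal.ofReal (4 * D * (1 + Z) * ∑' j : ℕ, q ^ j) := by
    rw [← tsum_mul_left, ENNReal.ofReal_tsum_of_nonneg (fun j => by positivity) (hsum.mul_left _)]
    refine ENNReal.tsum_le_tsum fun j => ?_
    calc _ ≤ 2 * ENNReal.ofReal (D * (2 * (1 + Z) * q ^ j)) := by
          gcongr
          refine (hpiece _ j _ (by positivity)).trans (ENNReal.ofReal_le_ofReal ?_)
          gcongr
          have a1 : (2⁻¹ : ℝ) ^ j ≤ q ^ j := by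
            gcongr
            calc (2⁻¹ : ℝ) = 2⁻¹ ^ (1 : ℝ) := (Real.rpow_one _).symm
              _ ≤ _ := Real.rpow_le_rpow_of_exponent_ge (by norm_num) (by norm_num) (by
                rw [div_le_one (by linarith)]; linarith)
          have a2 : (Z * (2⁻¹ : ℝ) ^ j) ^ (1 / K : ℝ) = Z ^ (1 / K : ℝ) * q ^ j := by
            rw [Real.mul_rpow hZ0 (by positivity), hq, ← Real.rpow_natCast, ← Real.rpow_natCast,
              ← Real.rpow_mul (by positivity), ← Real.rpow_mul (by positivity), mul_comm (j : ℝ)]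
          calc _ ≤ Z * (2⁻¹ : ℝ) ^ j + (Z * (2⁻¹ : ℝ) ^ j) ^ (1 / K : ℝ) := by
                exact add_le_add (hZj j) (Real.rpow_le_rpow (by positivity) (hZj j) (by positivity))
            _ ≤ Z * q ^ j + (1 + Z) * q ^ j := by
                rw [a2]
                gcongr
            _ ≤ _ := by nlinarith [pow_pos hq0 j]
      _ = _ := by
        rw [← ENNReal.ofReal_ofNat 2, ← ENNReal.ofReal_mul (by norm_num)]
        congr 1; ring
  refine (lintegral_tail_oscFactor_le hp0 w M).trans ((add_le_add hchi hs).trans ?_)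
  rw [← ENNReal.ofReal_add hC2 (by positivity)]
  refine ENNReal.ofReal_le_ofReal ?_
  have : C2 ≤ C2 * (1 + Z) := le_mul_of_one_le_right hC2 (by linarith)
  nlinarith

end

/-! ### Functions of `∑ |x_j|^p` as superpositions of product functions -/

noncomputable section

theorem lintegral_pi_prod_eq_prod {d : ℕ} {f : Fin d → ℝ → ℝ≥0∞} (hf : ∀ i, Measurable (f i)) :
    ∫⁻ x : Fin d → ℝ, ∏ i, f i (x i) = ∏ i, ∫⁻ t, f i t := by
  induction d with
  | zero =>
    rw [volume_pi, Measure.pi_of_empty]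
    simp
  | succ n ih =>
    have hmp := (volume_preserving_piFinSuccAbove (fun _ : Fin (n + 1) => ℝ) 0).symm
    rw [← hmp.lintegral_comp_emb (MeasurableEquiv.measurableEmbedding _)]
    simp only [MeasurableEquiv.piFinSuccAbove_symm_apply, Fin.insertNthEquiv,
      Fin.prod_univ_succ, Fin.insertNth_zero, Equiv.coe_fn_mk, Fin.cons_succ, Fin.cons_zero,
      Fin.zero_succAbove, cast_eq]
    rw [Measure.volume_eq_prod, lintegral_prod_mul (f := f 0)
      (g := fun x : Fin n → ℝ => ∏ i, f (Fin.succ i) (x i))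
      (hf 0).aemeasurable
      (Finset.measurable_fun_prod _ fun i _ => (hf i.succ).comp (measurable_pi_apply i)).aemeasurable,
      ih fun i => hf i.succ]

section Euclidean

variable {d : ℕ}

theorem lintegral_euclidean_prod_eq_prod {f : Fin d → ℝ → ℝ≥0∞} (hf : ∀ i, Measurable (f i)) :
    ∫⁻ x : EuclideanSpace ℝ (Fin d), ∏ i, f i (x i) = ∏ i, ∫⁻ t, f i t := by
  rw [← lintegral_pi_prod_eq_prod hf]
  exact (PiLp.volume_preserving_ofLp (Fin d)).lintegral_comp_emb
    (MeasurableEquiv.toLp 2 (Fin d → ℝ)).symm.measurableEmbedding (fun x => ∏ i, f i (x i))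

theorem volume_euclidean_cube {M : ℝ} (hM : 0 ≤ M) :
    volume {y : EuclideanSpace ℝ (Fin d) | ∀ i, |y i| ≤ M} = ENNReal.ofReal ((2 * M) ^ d) := by
  have h1 := lintegral_euclidean_prod_eq_prod (d := d)
    (f := fun _ => (Set.Icc (-M) M).indicator fun _ => 1)
    fun _ => measurable_const.indicator measurableSet_Icc
  have hS : MeasurableSet {y : EuclideanSpace ℝ (Fin d) | ∀ i, |y i| ≤ M} := by
    have : {y : EuclideanSpace ℝ (Fin d) | ∀ i, |y i| ≤ M} =
      ⋂ i, {y : EuclideanSpace ℝ (Fin d) | |y i| ≤ M} := by ext; simp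
    rw [this]
    exact MeasurableSet.iInter fun i =>
      (isClosed_le (by fun_prop) continuous_const).measurableSet
  have h2 : ∀ y : EuclideanSpace ℝ (Fin d),
      ∏ i, (Set.Icc (-M) M).indicator (fun _ => (1 : ℝ≥0∞)) (y i) =
      {y : EuclideanSpace ℝ (Fin d) | ∀ i, |y i| ≤ M}.indicator (fun _ => 1) y := fun y => by
    by_cases hy : ∀ i, |y i| ≤ M
    · rw [Set.indicator_of_mem (by exact hy), Finset.prod_eq_one]
      intro i _
      rw [Set.indicator_of_mem (Set.mem_Icc.mpr (abs_le.mp (hy i)))]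
    · rw [Set.indicator_of_notMem (by exact hy)]
      push Not at hy
      obtain ⟨i, hi⟩ := hy
      refine Finset.prod_eq_zero (Finset.mem_univ i) (Set.indicator_of_notMem ?_ _)
      rw [Set.mem_Icc, ← abs_le]
      exact not_le.mpr hi
  simp_rw [h2] at h1
  rw [lintegral_indicator_const hS, one_mul] at h1
  rw [h1]
  simp only [lintegral_indicator_const measurableSet_Icc, Real.volume_Icc, one_mul,
    Finset.prod_const, Finset.card_univ, Fintype.card_fin]
  rw [ENNReal.ofReal_pow (by positivity)]
  congr 2; ring

theorem fourier_euclidean_prod (f : Fin d → ℝ → ℂ) (y : EuclideanSpace ℝ (Fin d)) :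
    𝓕 (fun x : EuclideanSpace ℝ (Fin d) => ∏ i, f i (x i)) y = ∏ i, 𝓕 (f i) (y i) := by
  simp only [Real.fourier_eq']
  rw [← integral_fintype_prod_volume_eq_prod]
  rw [← (PiLp.volume_preserving_ofLp (Fin d)).integral_comp
    (MeasurableEquiv.toLp 2 (Fin d → ℝ)).symm.measurableEmbedding]
  congr 1 with x
  simp only [smul_eq_mul, Finset.prod_mul_distrib]
  rw [← Complex.exp_sum, PiLp.inner_apply, Finset.mul_sum, Complex.ofReal_sum, Finset.sum_mul]

end Euclidean

theorem continuous_oscFactor {p : ℝ} (hp : 0 < p) :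
    Continuous fun q : ℝ × ℝ => oscFactor p q.1 q.2 := by
  have h1 : Continuous fun q : ℝ × ℝ => |q.2| ^ p :=
    (continuous_abs.comp continuous_snd).rpow_const fun _ => Or.inr hp.le
  have h2 := continuous_evenCut
  unfold oscFactor
  fun_prop

theorem norm_oscFactor_le (p w x : ℝ) : ‖oscFactor p w x‖ ≤ ‖(evenCut x : ℂ)‖ := by
  rw [oscFactor, norm_mul, norm_cexp_phase, one_mul]

theorem integrable_oscFactor {p : ℝ} (hp : 0 < p) (w : ℝ) : Integrable (oscFactor p w) :=
  integrable_evenCut.mono ((continuous_oscFactor hp).comp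
    (Continuous.prodMk_right w)).aestronglyMeasurable
    (Filter.Eventually.of_forall fun x => norm_oscFactor_le p w x)

theorem continuous_fourier_oscFactor {p : ℝ} (hp : 0 < p) :
    Continuous fun q : ℝ × ℝ => 𝓕 (oscFactor p q.1) q.2 := by
  simp only [Real.fourier_eq]
  have hc := continuous_oscFactor hp
  refine continuous_of_dominated (bound := fun x => ‖(evenCut x : ℂ)‖) (fun q => ?_)
    (fun q => Filter.Eventually.of_forall fun x => ?_) integrable_evenCut.norm
    (Filter.Eventually.of_forall fun x => ?_)
  · exact ((Real.fourierIntegral_convergent_iff q.2).2 (integrable_oscFactor hp q.1)).1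
  · rw [Circle.norm_smul]
    exact norm_oscFactor_le p q.1 x
  · have h1 : Continuous fun q : ℝ × ℝ => oscFactor p q.1 x :=
      hc.comp (continuous_fst.prodMk continuous_const)
    have h2 : Continuous fun q : ℝ × ℝ => Real.fourierChar (-inner ℝ x q.2) :=
      Real.continuous_fourierChar.comp (by fun_prop)
    exact h2.smul h1

/-- The scaled gauge `2^{p+1} ∑ |x_j|^p`. -/
def powGauge {d : ℕ} (p : ℝ) (x : EuclideanSpace ℝ (Fin d)) : ℝ := 2 ^ (p + 1) * ∑ j, |x j| ^ p

section PowGauge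

variable {d : ℕ} {p : ℝ} {h : ℝ → ℂ}

theorem continuous_powGauge (hp : 0 < p) :
    Continuous (powGauge p : EuclideanSpace ℝ (Fin d) → ℝ) := by
  refine continuous_const.mul (continuous_finsetSum _ fun j _ => ?_)
  exact Continuous.rpow_const (by fun_prop) fun _ => Or.inr hp.le

/-- This fixes the factor `2^(p+1)` in the gauge: where `h ∘ powGauge p` may be nonzero, all `|x_j|
≤ 1/2`, and there the cutoffs equal `1`. -/
theorem two_lt_powGauge (hp : 0 < p) {x : EuclideanSpace ℝ (Fin d)} {j : Fin d}
    (hj : 1 / 2 < |x j|) : 2 < powGauge p x := by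
  have h1 : (1 / 2 : ℝ) ^ p < ∑ j, |x j| ^ p :=
    (Real.rpow_lt_rpow (by norm_num) hj hp).trans_le
      (Finset.single_le_sum (f := fun j => |x j| ^ p) (fun i _ => by positivity) (Finset.mem_univ j))
  have h2 : (2 : ℝ) ^ (p + 1) * (1 / 2) ^ p = 2 := by
    rw [Real.rpow_add two_pos, Real.rpow_one, one_div, Real.inv_rpow two_pos.le]
    field_simp
  calc (2 : ℝ) = 2 ^ (p + 1) * (1 / 2) ^ p := h2.symm
    _ < _ := by unfold powGauge; gcongr

/-- The phase coefficient of the factors of a plane wave in `powGauge p`. -/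
def gaugeFreq (p u : ℝ) : ℝ := 2 * Real.pi * 2 ^ (p + 1) * u

theorem continuous_gaugeFreq (p : ℝ) : Continuous (gaugeFreq p) := by
  unfold gaugeFreq
  fun_prop

/-- Inversion for `h` at the point `powGauge p x`: the gauge is a sum over coordinates, so each
plane wave splits into a product. The cutoffs are inserted free of charge, being `1` wherever the
left side can be nonzero. -/
theorem comp_powGauge_eq_integral (hp : 0 < p) (hc : Continuous h) (hi : Integrable h)
    (hF : Integrable (𝓕 h)) (hs : ∀ s, 2 < |s| → h s = 0) (x : EuclideanSpace ℝ (Fin d)) :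
    h (powGauge p x) = ∫ u, 𝓕 h u * ∏ j, oscFactor p (gaugeFreq p u) (x j) := by
  have e1 : ∀ u, 𝓕 h u * ∏ j, oscFactor p (gaugeFreq p u) (x j) =
      (Real.fourierChar (inner ℝ u (powGauge p x)) • 𝓕 h u) * ∏ j, (evenCut (x j) : ℂ) := fun u => by
    simp only [oscFactor, Finset.prod_mul_distrib]
    rw [← Complex.exp_sum, Circle.smul_def, Real.fourierChar_apply, smul_eq_mul, ← Finset.mul_sum,
      ← Complex.ofReal_sum, ← Finset.mul_sum, RCLike.inner_apply, conj_trivial]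
    have : Complex.I * ((gaugeFreq p u * ∑ j, |x j| ^ p : ℝ) : ℂ) =
        ((2 * Real.pi * (powGauge p x * u) : ℝ) : ℂ) * Complex.I := by
      rw [gaugeFreq, powGauge]; push_cast; ring
    rw [this]
    push_cast
    ring
  simp_rw [e1]
  rw [integral_mul_const]
  have := congrFun (hc.fourierInv_fourier_eq hi hF) (powGauge p x)
  rw [Real.fourierInv_eq] at this
  rw [this]
  by_cases hx : ∀ j, |x j| ≤ 1 / 2
  · rw [Finset.prod_eq_one fun j _ => by rw [evenCut_of_abs_le (hx j), Complex.ofReal_one], mul_one]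
  · push Not at hx
    obtain ⟨j, hj⟩ := hx
    have := two_lt_powGauge hp hj
    rw [hs _ (this.trans_le (le_abs_self _)), zero_mul]

theorem integrable_prod_evenCut :
    Integrable fun x : EuclideanSpace ℝ (Fin d) => ∏ j, (evenCut (x j) : ℂ) := by
  rw [← (PiLp.volume_preserving_toLp (Fin d)).integrable_comp_emb
    (MeasurableEquiv.toLp 2 (Fin d → ℝ)).measurableEmbedding]
  exact Integrable.fintype_prod (f := fun _ t => (evenCut t : ℂ)) fun _ => integrable_evenCut

/-- Fubini; the product of the cutoffs times `𝓕 h` is an integrable majorant. -/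
theorem fourier_comp_powGauge (hp : 0 < p) (hc : Continuous h) (hi : Integrable h)
    (hF : Integrable (𝓕 h)) (hs : ∀ s, 2 < |s| → h s = 0) (y : EuclideanSpace ℝ (Fin d)) :
    𝓕 (fun x => h (powGauge p x)) y =
      ∫ u, 𝓕 h u * ∏ j, 𝓕 (oscFactor p (gaugeFreq p u)) (y j) := by
  have e1 : 𝓕 (fun x => h (powGauge p x)) y = ∫ x, ∫ u, Real.fourierChar (-inner ℝ x y) •
      (𝓕 h u * ∏ j, oscFactor p (gaugeFreq p u) (x j)) := by
    rw [Real.fourier_eq]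
    congr 1 with x
    rw [comp_powGauge_eq_integral hp hc hi hF hs]
    simp only [Circle.smul_def, smul_eq_mul]
    rw [integral_const_mul]
  rw [e1, integral_integral_swap]
  · congr 1 with u
    rw [← fourier_euclidean_prod, Real.fourier_eq _ y, ← integral_const_mul]
    congr 1 with x
    rw [mul_smul_comm]
  · have hcF : Continuous (𝓕 h) := continuous_fourier_of_integrable hi
    have hco := continuous_oscFactor hp
    have hcg := continuous_gaugeFreq p
    refine Integrable.mono ((integrable_prod_evenCut (d := d)).mul_prod hF) ?_
      (Filter.Eventually.of_forall fun q => ?_)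
    · refine Continuous.aestronglyMeasurable ?_
      have h2 : Continuous fun q : EuclideanSpace ℝ (Fin d) × ℝ =>
          Real.fourierChar (-inner ℝ q.1 y) := Real.continuous_fourierChar.comp (by fun_prop)
      refine h2.smul ((hcF.comp continuous_snd).mul (continuous_finsetProd _ fun j _ => ?_))
      exact hco.comp ((hcg.comp continuous_snd).prodMk (by fun_prop))
    · simp only [Function.uncurry]
      rw [Circle.norm_smul, norm_mul, norm_mul, norm_prod, norm_prod, mul_comm]
      gcongr with j
      exact norm_oscFactor_le _ _ _

/-- The mass of the transform of `h ∘ powGauge p` on a product set. -/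
theorem setLIntegral_fourier_comp_powGauge_le (hp : 0 < p) (hc : Continuous h) (hi : Integrable h)
    (hF : Integrable (𝓕 h)) (hs : ∀ s, 2 < |s| → h s = 0) {S : Fin d → Set ℝ}
    (hS : ∀ j, MeasurableSet (S j)) :
    ∫⁻ y in {y : EuclideanSpace ℝ (Fin d) | ∀ j, y j ∈ S j}, ‖𝓕 (fun x => h (powGauge p x)) y‖ₑ ≤
      ∫⁻ u, ‖𝓕 h u‖ₑ * ∏ j, ∫⁻ t in S j, ‖𝓕 (oscFactor p (gaugeFreq p u)) t‖ₑ := by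
  have hcF : Continuous (𝓕 h) := continuous_fourier_of_integrable hi
  have hco := continuous_fourier_oscFactor hp
  have hcg := continuous_gaugeFreq p
  have hcoj : ∀ j, Continuous fun q : EuclideanSpace ℝ (Fin d) × ℝ =>
      𝓕 (oscFactor p (gaugeFreq p q.2)) (q.1 j) := fun j => by
    have hj : Continuous fun q : EuclideanSpace ℝ (Fin d) × ℝ => (gaugeFreq p q.2, q.1 j) :=
      (hcg.comp continuous_snd).prodMk (by fun_prop)
    have := hco.comp hj
    exact this
  calc ∫⁻ y in {y : EuclideanSpace ℝ (Fin d) | ∀ j, y j ∈ S j},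
        ‖𝓕 (fun x => h (powGauge p x)) y‖ₑ
      ≤ ∫⁻ y in {y : EuclideanSpace ℝ (Fin d) | ∀ j, y j ∈ S j},
          ∫⁻ u, ‖𝓕 h u‖ₑ * ∏ j, ‖𝓕 (oscFactor p (gaugeFreq p u)) (y j)‖ₑ := by
        refine lintegral_mono fun y => ?_
        rw [fourier_comp_powGauge hp hc hi hF hs]
        refine (enorm_integral_le_lintegral_enorm _).trans (lintegral_mono fun u => ?_)
        rw [enorm_mul]
        simp [enorm_eq_nnnorm, nnnorm_prod]
    _ = ∫⁻ u, ∫⁻ y in {y : EuclideanSpace ℝ (Fin d) | ∀ j, y j ∈ S j},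
          ‖𝓕 h u‖ₑ * ∏ j, ‖𝓕 (oscFactor p (gaugeFreq p u)) (y j)‖ₑ := by
        refine lintegral_lintegral_swap (Measurable.aemeasurable ?_)
        exact ((hcF.comp continuous_snd).enorm.measurable).mul
          (Finset.measurable_fun_prod _ fun j _ => (hcoj j).enorm.measurable)
    _ = _ := by
        congr 1 with u
        have hm : ∀ j, Measurable ((S j).indicator fun t =>
            ‖𝓕 (oscFactor p (gaugeFreq p u)) t‖ₑ) := fun j =>
          ((continuous_fourier_of_integrable
            (integrable_oscFactor hp _)).enorm.measurable).indicator (hS j)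
        rw [lintegral_const_mul' _ _ enorm_ne_top]
        congr 1
        simp_rw [← lintegral_indicator (hS _)]
        rw [← lintegral_euclidean_prod_eq_prod hm, ← lintegral_indicator]
        · congr 1 with y
          by_cases hy : ∀ j, y j ∈ S j
          · rw [Set.indicator_of_mem (by exact hy)]
            exact Finset.prod_congr rfl fun j _ => by
              rw [Set.indicator_of_mem (hy j)]
          · rw [Set.indicator_of_notMem (by exact hy)]
            push Not at hy
            obtain ⟨j, hj⟩ := hy
            exact (Finset.prod_eq_zero (Finset.mem_univ j) (Set.indicator_of_notMem hj _)).symm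
        · have : {y : EuclideanSpace ℝ (Fin d) | ∀ j, y j ∈ S j} =
            ⋂ j, (fun y : EuclideanSpace ℝ (Fin d) => y j) ⁻¹' S j := by ext; simp
          rw [this]
          exact MeasurableSet.iInter fun j =>
            (Continuous.measurable (by fun_prop)) (hS j)

end PowGauge

end

/-! ### Band estimates for finite `p` -/

noncomputable section

theorem DerivBound.continuous {c : ℕ → ℝ} {A N : ℝ} {h : ℝ → ℂ} (H : DerivBound c A N h) :
    Continuous h := H.contDiff.continuous

theorem DerivBound.integrable {c : ℕ → ℝ} {A N r : ℝ} {h : ℝ → ℂ} (H : DerivBound c A N h)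
    (hs : ∀ s, r < |s| → h s = 0) : Integrable h := by
  simpa using H.integrable_iteratedDeriv hs 0

theorem DerivBound.integrable_fourier {c : ℕ → ℝ} {A N r : ℝ} {h : ℝ → ℂ} (H : DerivBound c A N h)
    (hA : 0 ≤ A) (hN : 1 ≤ N) (hr : 0 ≤ r) (hs : ∀ s, r < |s| → h s = 0) : Integrable (𝓕 h) := by
  obtain ⟨C, -, hC⟩ := exists_lintegral_weight_fourier_le c le_rfl hr
  have := hC A N h hA hN H hs
  simp only [Real.rpow_zero, ENNReal.ofReal_one, one_mul] at this
  exact ⟨(continuous_fourier_of_integrable (H.integrable hs)).aestronglyMeasurable,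
    this.trans_lt ENNReal.ofReal_lt_top⟩

theorem one_add_abs_gaugeFreq_le {p : ℝ} (hp : 0 < p) (u : ℝ) :
    1 + |gaugeFreq p u| ≤ 2 * Real.pi * 2 ^ (p + 1) * (1 + |u|) := by
  have h1 : (1 : ℝ) ≤ 2 ^ (p + 1) := Real.one_le_rpow one_le_two (by linarith)
  have h2 := Real.pi_gt_three
  rw [gaugeFreq, abs_mul, abs_of_pos (by positivity), mul_add, mul_one]
  nlinarith

theorem exists_lintegral_fourier_gaugeFactor_le {p : ℝ} (hp : 0 < p) :
    ∃ C, 0 ≤ C ∧ ∀ u, ∫⁻ ξ, ‖𝓕 (oscFactor p (gaugeFreq p u)) ξ‖ₑ ≤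
      ENNReal.ofReal (C * (1 + |u|) ^ (1 / 2 : ℝ)) := by
  obtain ⟨C, hC, h⟩ := exists_lintegral_fourier_oscFactor_le hp
  refine ⟨C * (2 * Real.pi * 2 ^ (p + 1)) ^ (1 / 2 : ℝ), by positivity, fun u =>
    (h _).trans (ENNReal.ofReal_le_ofReal ?_)⟩
  rw [mul_assoc, ← Real.mul_rpow (by positivity) (by positivity)]
  gcongr
  exact one_add_abs_gaugeFreq_le hp u

theorem exists_lintegral_tail_gaugeFactor_le {p : ℝ} (hp : 1 ≤ p) {K : ℕ} (hK : 2 ≤ K) :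
    ∃ C, 0 ≤ C ∧ ∀ u M, 0 < M → ∫⁻ ξ in {ξ : ℝ | M < |ξ|}, ‖𝓕 (oscFactor p (gaugeFreq p u)) ξ‖ₑ ≤
      ENNReal.ofReal (C * (1 + (1 + |u|) ^ K * M ^ (1 - K : ℝ))) := by
  obtain ⟨C, hC, h⟩ := exists_lintegral_tail_oscFactor_le hp hK
  set G := 2 * Real.pi * 2 ^ (p + 1) with hG
  have hG1 : 1 ≤ G := by
    have h1 : (1 : ℝ) ≤ 2 ^ (p + 1) := Real.one_le_rpow one_le_two (by linarith)
    nlinarith [Real.pi_gt_three]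
  refine ⟨C * G ^ K, by positivity, fun u M hM => (h _ M hM).trans (ENNReal.ofReal_le_ofReal ?_)⟩
  have h1 : |gaugeFreq p u| ^ K ≤ G ^ K * (1 + |u|) ^ K := by
    rw [← mul_pow]
    gcongr
    linarith [one_add_abs_gaugeFreq_le (by linarith : 0 < p) u]
  rw [mul_assoc]
  gcongr
  calc 1 + |gaugeFreq p u| ^ K * M ^ (1 - K : ℝ) ≤ G ^ K * 1 + G ^ K * (1 + |u|) ^ K * M ^ (1 - K : ℝ) := by
        gcongr
        rw [mul_one]
        exact one_le_pow₀ hG1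
    _ = _ := by ring

section

variable {d : ℕ} {p : ℝ} {h : ℝ → ℂ}

theorem lintegral_rpow_enorm_comp_powGauge_le (hp : 0 < p) {B : ℝ} (hB : ∀ s, ‖h s‖ ≤ B)
    (hs : ∀ s, 2 < |s| → h s = 0) {q : ℝ} (hq : 0 < q) :
    ∫⁻ x : EuclideanSpace ℝ (Fin d), ‖h (powGauge p x)‖ₑ ^ q ≤ ENNReal.ofReal (B ^ q) := by
  have hB0 : 0 ≤ B := (norm_nonneg _).trans (hB 0)
  set Q : Set (EuclideanSpace ℝ (Fin d)) := {y | ∀ i, |y i| ≤ 1 / 2} with hQ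
  have hQc : IsClosed Q := by
    have : Q = ⋂ i, {y : EuclideanSpace ℝ (Fin d) | |y i| ≤ 1 / 2} := by ext; simp [hQ]
    rw [this]
    exact isClosed_iInter fun i => isClosed_le (by fun_prop) continuous_const
  calc ∫⁻ x : EuclideanSpace ℝ (Fin d), ‖h (powGauge p x)‖ₑ ^ q
      ≤ ∫⁻ x, Q.indicator (fun _ => ENNReal.ofReal (B ^ q)) x := by
        refine lintegral_mono fun x => ?_
        by_cases hx : x ∈ Q
        · rw [Set.indicator_of_mem hx, ← ENNReal.ofReal_rpow_of_nonneg hB0 hq.le, ← ofReal_norm]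
          gcongr
          exact hB _
        · have hx' : ¬ ∀ i, |x i| ≤ 1 / 2 := hx
          push Not at hx'
          obtain ⟨j, hj⟩ := hx'
          rw [hs _ ((two_lt_powGauge hp hj).trans_le (le_abs_self _)), enorm_zero,
            ENNReal.zero_rpow_of_pos hq]
          exact zero_le
    _ = _ := by
        rw [lintegral_indicator_const hQc.measurableSet, hQ, volume_euclidean_cube (by norm_num)]
        norm_num

theorem integrable_comp_powGauge (hp : 0 < p) {B : ℝ} (hc : Continuous h) (hB : ∀ s, ‖h s‖ ≤ B)
    (hs : ∀ s, 2 < |s| → h s = 0) :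
    Integrable fun x : EuclideanSpace ℝ (Fin d) => h (powGauge p x) := by
  refine ⟨(hc.comp (continuous_powGauge hp)).aestronglyMeasurable, ?_⟩
  have := lintegral_rpow_enorm_comp_powGauge_le (d := d) hp hB hs one_pos
  simp only [ENNReal.rpow_one] at this
  exact this.trans_lt ENNReal.ofReal_lt_top

theorem memLp_comp_powGauge (hp : 0 < p) {B : ℝ} (hc : Continuous h) (hB : ∀ s, ‖h s‖ ≤ B)
    (hs : ∀ s, 2 < |s| → h s = 0) :
    MemLp (fun x : EuclideanSpace ℝ (Fin d) => h (powGauge p x)) 2 := by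
  refine ⟨(hc.comp (continuous_powGauge hp)).aestronglyMeasurable, ?_⟩
  rw [eLpNorm_lt_top_iff_lintegral_rpow_enorm_lt_top (by norm_num) (by norm_num)]
  exact (lintegral_rpow_enorm_comp_powGauge_le (d := d) hp hB hs (by norm_num)).trans_lt
    ENNReal.ofReal_lt_top

end

/-- The Wiener norm of a smooth function of `∑ |x_j|^p`, for every `p > 0`. -/
theorem exists_wienerBound_comp_powGauge (d : ℕ) {p : ℝ} (hp : 0 < p) (c : ℕ → ℝ) :
    ∃ C, 0 ≤ C ∧ ∀ (A N : ℝ) (h : ℝ → ℂ), 0 ≤ A → 1 ≤ N → DerivBound c A N h →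
      (∀ s, 2 < |s| → h s = 0) →
      WienerBound (fun x : EuclideanSpace ℝ (Fin d) => h (powGauge p x))
        (C * A * N ^ ((d + 1 : ℝ) / 2)) := by
  obtain ⟨C1, hC1, h1⟩ := exists_lintegral_fourier_gaugeFactor_le hp
  obtain ⟨C2, hC2, h2⟩ := exists_lintegral_weight_fourier_le c (m := d / 2) (by positivity)
    (r := 2) two_pos.le
  refine ⟨C1 ^ d * C2, by positivity, fun A N h hA hN H hs => ?_⟩
  have hi := H.integrable hs
  have hF := H.integrable_fourier hA hN two_pos.le hs
  have hB : ∀ s, ‖h s‖ ≤ c 0 * A * N ^ 0 := fun s => by simpa using H.bound 0 s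
  refine WienerBound.of_fourier (H.continuous.comp (continuous_powGauge hp))
    (integrable_comp_powGauge hp H.continuous hB hs) (by positivity) ?_
  have h3 := setLIntegral_fourier_comp_powGauge_le (d := d) hp H.continuous hi hF hs
    (S := fun _ => Set.univ) fun _ => MeasurableSet.univ
  simp only [Set.mem_univ, implies_true, Set.ofPred_true, Measure.restrict_univ] at h3
  refine h3.trans ?_
  -- Each of the `d` factors contributes `(1+|u|)^(1/2)`; Bernstein with the weight `(1+|u|)^(d/2)`
  -- adds the last half power of `N`.
  calc _ ≤ ∫⁻ u, ENNReal.ofReal (C1 ^ d) * (ENNReal.ofReal ((1 + |u|) ^ (d / 2 : ℝ)) * ‖𝓕 h u‖ₑ) := by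
        refine lintegral_mono fun u => ?_
        calc _ ≤ ‖𝓕 h u‖ₑ * ∏ _j : Fin d, ENNReal.ofReal (C1 * (1 + |u|) ^ (1 / 2 : ℝ)) := by
              gcongr
              exact h1 u
          _ = _ := by
              rw [Finset.prod_const, Finset.card_univ, Fintype.card_fin,
                ← ENNReal.ofReal_pow (by positivity), mul_pow, ENNReal.ofReal_mul (by positivity),
                ← Real.rpow_natCast ((1 + |u|) ^ (1 / 2 : ℝ)), ← Real.rpow_mul (by positivity),
                mul_comm, mul_assoc]
              congr 4; ring
    _ = ENNReal.ofReal (C1 ^ d) * ∫⁻ u, ENNReal.ofReal ((1 + |u|) ^ (d / 2 : ℝ)) * ‖𝓕 h u‖ₑ :=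
        lintegral_const_mul' _ _ ENNReal.ofReal_ne_top
    _ ≤ ENNReal.ofReal (C1 ^ d) * ENNReal.ofReal (C2 * A * N ^ ((d / 2 : ℝ) + 1 / 2)) := by
        gcongr
        exact h2 A N h hA hN H hs
    _ = _ := by
        rw [← ENNReal.ofReal_mul (by positivity)]
        congr 1
        rw [show ((d + 1 : ℝ) / 2) = d / 2 + 1 / 2 by ring]
        ring

/-- The Wiener norm of a smooth function of `∑ |x_j|^p`, for `p ≥ 1`. -/
theorem exists_wienerBound_comp_powGauge_of_one_le {d : ℕ} (hd : 1 ≤ d) {p : ℝ} (hp : 1 ≤ p) {ε : ℝ}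
    (hε : 0 < ε) (c : ℕ → ℝ) :
    ∃ C, 0 ≤ C ∧ ∀ (A N : ℝ) (h : ℝ → ℂ), 0 ≤ A → 1 ≤ N → DerivBound c A N h →
      (∀ s, 2 < |s| → h s = 0) →
      WienerBound (fun x : EuclideanSpace ℝ (Fin d) => h (powGauge p x))
        (C * A * N ^ ((1 + ε) * (d / 2))) := by
  have hp0 : 0 < p := by linarith
  have hd1 : (1 : ℝ) ≤ d := by exact_mod_cast hd
  -- This inequality is `M^(1-K) * N^K ≤ 1` for `M = N^(1+ε)`, the condition for the tail beyond `M`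
  -- to be harmless; `K - 1 ≥ 1/ε` suffices.
  obtain ⟨K, hK2, hK⟩ : ∃ K : ℕ, 2 ≤ K ∧ (K : ℝ) ≤ (1 + ε) * (K - 1) := by
    refine ⟨⌈1 + 1 / ε⌉₊ + 1, ?_, ?_⟩
    · have : 0 < ⌈1 + 1 / ε⌉₊ := Nat.ceil_pos.mpr (by positivity)
      omega
    · have := Nat.le_ceil (1 + 1 / ε)
      have h2 : ε * (1 + 1 / ε) = ε + 1 := by field_simp
      push_cast
      nlinarith
  obtain ⟨C1, hC1, h1⟩ := exists_lintegral_fourier_gaugeFactor_le hp0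
  obtain ⟨C2, hC2, h2⟩ := exists_lintegral_tail_gaugeFactor_le hp hK2
  obtain ⟨C3, hC3, h3⟩ := exists_lintegral_weight_fourier_le c (m := (d - 1) / 2) (by linarith)
    (r := 2) two_pos.le
  obtain ⟨C4, hC4, h4⟩ := exists_lintegral_weight_fourier_le c (m := (d - 1) / 2 + K) (by
    have : (0 : ℝ) ≤ (d - 1) / 2 := by linarith
    positivity) (r := 2) two_pos.le
  refine ⟨2 ^ (d / 2 : ℝ) * |c 0| + d * (C2 * C1 ^ (d - 1) * (C3 + C4)), by positivity,
    fun A N h hA hN H hs => ?_⟩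
  have hN0 : 0 < N := by linarith
  have hi := H.integrable hs
  have hF := H.integrable_fourier hA hN two_pos.le hs
  have hB : ∀ s, ‖h s‖ ≤ |c 0| * A := fun s => by
    have := H.bound 0 s
    rw [iteratedDeriv_zero, pow_zero, mul_one] at this
    refine this.trans ?_
    gcongr
    exact le_abs_self _
  have hI := integrable_comp_powGauge (d := d) hp0 H.continuous hB hs
  refine WienerBound.of_fourier (H.continuous.comp (continuous_powGauge hp0)) hI (by positivity) ?_
  set M := N ^ (1 + ε) with hM
  have hM0 : 0 < M := by positivity
  set Q : Set (EuclideanSpace ℝ (Fin d)) := {y | ∀ i, |y i| ≤ M} with hQ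
  have hQc : IsClosed Q := by
    have : Q = ⋂ i, {y : EuclideanSpace ℝ (Fin d) | |y i| ≤ M} := by ext; simp [hQ]
    rw [this]
    exact isClosed_iInter fun i => isClosed_le (by fun_prop) continuous_const
  -- In the cube no structure is used: the square root of its volume `(2M)^d` times the `L²` norm of
  -- the function, which is `O(A)`.
  have low : ∫⁻ y in Q, ‖𝓕 (fun x : EuclideanSpace ℝ (Fin d) => h (powGauge p x)) y‖ₑ ≤
      ENNReal.ofReal (2 ^ (d / 2 : ℝ) * |c 0| * A * N ^ ((1 + ε) * (d / 2))) := by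
    calc _ = ∫⁻ y, Q.indicator (fun _ => 1) y *
          ‖𝓕 (fun x : EuclideanSpace ℝ (Fin d) => h (powGauge p x)) y‖ₑ := by
          rw [← lintegral_indicator hQc.measurableSet]
          congr 1 with y
          by_cases hy : y ∈ Q <;> simp [hy]
      _ ≤ _ := lintegral_mul_enorm_fourier_le hI (memLp_comp_powGauge hp0 H.continuous hB hs)
          (measurable_const.indicator hQc.measurableSet).aemeasurable
      _ ≤ ENNReal.ofReal ((2 * M) ^ (d / 2 : ℝ)) * ENNReal.ofReal (|c 0| * A) := by
          gcongr
          · refine ENNReal.rpow_half_le_ofReal (by positivity) ?_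
            have : ∀ y, Q.indicator (fun _ => (1 : ℝ≥0∞)) y ^ (2 : ℝ) =
                Q.indicator (fun _ => 1) y := fun y => by
              by_cases hy : y ∈ Q <;> simp [hy]
            simp_rw [this]
            rw [lintegral_indicator_const hQc.measurableSet, one_mul, hQ,
              volume_euclidean_cube hM0.le]
            refine ENNReal.ofReal_le_ofReal (le_of_eq ?_)
            rw [← Real.rpow_natCast, ← Real.rpow_natCast, ← Real.rpow_mul (by positivity)]
            congr 1; push_cast; ring
          · refine ENNReal.rpow_half_le_ofReal (by positivity) ?_
            have := lintegral_rpow_enorm_comp_powGauge_le (d := d) hp0 hB hs (q := 2) two_pos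
            rwa [Real.rpow_two] at this
      _ = _ := by
          rw [← ENNReal.ofReal_mul (by positivity), Real.mul_rpow two_pos.le hM0.le, hM,
            ← Real.rpow_mul hN0.le]
          congr 1; ring
  -- Coordinate `j` contributes its tail `1 + (1+|u|)^K * M^(1-K)`, the other `d - 1` the full mass
  -- `(1+|u|)^(1/2)`. Bernstein turns the two terms into `N^(d/2)` and `N^(d/2) * (M^(1-K) * N^K)`.
  have tail : ∀ j : Fin d, ∫⁻ y in {y : EuclideanSpace ℝ (Fin d) | M < |y j|},
      ‖𝓕 (fun x : EuclideanSpace ℝ (Fin d) => h (powGauge p x)) y‖ₑ ≤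
      ENNReal.ofReal (C2 * C1 ^ (d - 1) * (C3 + C4) * A * N ^ ((1 + ε) * (d / 2))) := fun j => by
    have h5 := setLIntegral_fourier_comp_powGauge_le (d := d) hp0 H.continuous hi hF hs
      (S := fun i => if i = j then {ξ | M < |ξ|} else Set.univ) fun i => by
        split_ifs
        · exact measurableSet_lt measurable_const measurable_norm
        · exact MeasurableSet.univ
    have hset : {y : EuclideanSpace ℝ (Fin d) | ∀ i, y i ∈ if i = j then {ξ | M < |ξ|} else Set.univ}
        = {y | M < |y j|} := by
      ext y
      refine ⟨fun hy => by simpa using hy j, fun hy i => ?_⟩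
      split_ifs with hij
      · exact hij ▸ hy
      · trivial
    rw [hset] at h5
    refine h5.trans ?_
    have hpt : ∀ u, ∏ i, ∫⁻ t in (if i = j then {ξ | M < |ξ|} else Set.univ),
        ‖𝓕 (oscFactor p (gaugeFreq p u)) t‖ₑ ≤
        ENNReal.ofReal (C2 * C1 ^ (d - 1)) * (ENNReal.ofReal ((1 + |u|) ^ ((d - 1) / 2 : ℝ)) +
          ENNReal.ofReal (M ^ (1 - K : ℝ)) *
            ENNReal.ofReal ((1 + |u|) ^ ((d - 1) / 2 + K : ℝ))) := fun u => by
      rw [← Finset.mul_prod_erase Finset.univ _ (Finset.mem_univ j), if_pos rfl]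
      have hu : 0 < 1 + |u| := by positivity
      calc _ ≤ ENNReal.ofReal (C2 * (1 + (1 + |u|) ^ K * M ^ (1 - K : ℝ))) *
            ∏ i ∈ Finset.univ.erase j, ENNReal.ofReal (C1 * (1 + |u|) ^ (1 / 2 : ℝ)) := by
            gcongr with i hi
            · exact h2 u M hM0
            · rw [if_neg (Finset.ne_of_mem_erase hi), Measure.restrict_univ]
              exact h1 u
        _ = _ := by
            rw [Finset.prod_const, Finset.card_erase_of_mem (Finset.mem_univ j), Finset.card_univ,
              Fintype.card_fin, ← ENNReal.ofReal_pow (by positivity),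
              ← ENNReal.ofReal_mul (by positivity), ← ENNReal.ofReal_mul (by positivity),
              ← ENNReal.ofReal_add (by positivity) (by positivity),
              ← ENNReal.ofReal_mul (by positivity), Real.rpow_add hu, Real.rpow_natCast, mul_pow,
              ← Real.rpow_natCast ((1 + |u|) ^ (1 / 2 : ℝ)), ← Real.rpow_mul hu.le,
              Nat.cast_sub hd]
            congr 1
            rw [show (1 / 2 : ℝ) * ((d : ℝ) - ((1 : ℕ) : ℝ)) = (d - 1) / 2 by push_cast; ring]
            ring
    have hMK : M ^ (1 - K : ℝ) * N ^ (K : ℝ) ≤ 1 := by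
      rw [hM, ← Real.rpow_mul hN0.le, ← Real.rpow_add hN0]
      exact Real.rpow_le_one_of_one_le_of_nonpos hN (by nlinarith)
    have hNd : N ^ (d / 2 : ℝ) ≤ N ^ ((1 + ε) * (d / 2)) :=
      Real.rpow_le_rpow_of_exponent_le hN (by nlinarith)
    calc _ ≤ ∫⁻ u, ENNReal.ofReal (C2 * C1 ^ (d - 1)) *
          (ENNReal.ofReal ((1 + |u|) ^ ((d - 1) / 2 : ℝ)) * ‖𝓕 h u‖ₑ +
          ENNReal.ofReal (M ^ (1 - K : ℝ)) *
            (ENNReal.ofReal ((1 + |u|) ^ ((d - 1) / 2 + K : ℝ)) * ‖𝓕 h u‖ₑ)) := by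
          refine lintegral_mono fun u => ?_
          refine (mul_le_mul_right (hpt u) _).trans (le_of_eq ?_)
          ring
      _ = ENNReal.ofReal (C2 * C1 ^ (d - 1)) *
          (∫⁻ u, ENNReal.ofReal ((1 + |u|) ^ ((d - 1) / 2 : ℝ)) * ‖𝓕 h u‖ₑ) +
          ENNReal.ofReal (C2 * C1 ^ (d - 1)) * (ENNReal.ofReal (M ^ (1 - K : ℝ)) *
            ∫⁻ u, ENNReal.ofReal ((1 + |u|) ^ ((d - 1) / 2 + K : ℝ)) * ‖𝓕 h u‖ₑ) := by
          rw [lintegral_const_mul' _ _ ENNReal.ofReal_ne_top, lintegral_add_left, mul_add,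
            lintegral_const_mul' _ _ ENNReal.ofReal_ne_top]
          have := (continuous_fourier_of_integrable hi).enorm.measurable
          fun_prop
      _ ≤ ENNReal.ofReal (C2 * C1 ^ (d - 1)) *
          ENNReal.ofReal (C3 * A * N ^ ((d - 1) / 2 + 1 / 2 : ℝ)) +
          ENNReal.ofReal (C2 * C1 ^ (d - 1)) * (ENNReal.ofReal (M ^ (1 - K : ℝ)) *
            ENNReal.ofReal (C4 * A * N ^ ((d - 1) / 2 + K + 1 / 2 : ℝ))) := by
          gcongr
          · exact h3 A N h hA hN H hs
          · exact h4 A N h hA hN H hs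
      _ ≤ _ := by
          rw [← ENNReal.ofReal_mul (by positivity), ← ENNReal.ofReal_mul (by positivity),
            ← ENNReal.ofReal_mul (by positivity), ← ENNReal.ofReal_add (by positivity)
            (by positivity)]
          refine ENNReal.ofReal_le_ofReal ?_
          rw [show ((d - 1) / 2 + 1 / 2 : ℝ) = d / 2 by ring,
            show ((d - 1) / 2 + K + 1 / 2 : ℝ) = d / 2 + K by ring, Real.rpow_add hN0]
          calc _ = C2 * C1 ^ (d - 1) * A * (C3 + C4 * (M ^ (1 - K : ℝ) * N ^ (K : ℝ))) *
                N ^ (d / 2 : ℝ) := by ring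
            _ ≤ C2 * C1 ^ (d - 1) * A * (C3 + C4 * 1) * N ^ ((1 + ε) * (d / 2)) := by gcongr
            _ = _ := by ring
  have hQcompl : Qᶜ = ⋃ j : Fin d, {y | M < |y j|} := by
    ext y
    simp [hQ]
  rw [← lintegral_add_compl _ hQc.measurableSet]
  calc _ ≤ ENNReal.ofReal (2 ^ (d / 2 : ℝ) * |c 0| * A * N ^ ((1 + ε) * (d / 2))) +
        ∑ _j : Fin d, ENNReal.ofReal (C2 * C1 ^ (d - 1) * (C3 + C4) * A * N ^ ((1 + ε) * (d / 2))) := by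
        refine add_le_add low ?_
        rw [hQcompl]
        refine (lintegral_iUnion_le _ _).trans ?_
        rw [tsum_fintype]
        exact Finset.sum_le_sum fun j _ => tail j
    _ = _ := by
        rw [Finset.sum_const, Finset.card_univ, Fintype.card_fin, nsmul_eq_mul,
          ← ENNReal.ofReal_natCast, ← ENNReal.ofReal_mul (by positivity),
          ← ENNReal.ofReal_add (by positivity) (by positivity)]
        congr 1; ring

end

/-! ### Transforms of cubes as plane waves, and integrability of their amplitudes -/

noncomputable section

/-- The Fourier transform of the indicator of `[-u, u]`. -/
def boxTransform (u y : ℝ) : ℝ := ∫ x in (0 : ℝ)..u, 2 * Real.cos (2 * Real.pi * y * x)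

theorem hasDerivAt_boxTransform (u y : ℝ) :
    HasDerivAt (fun u => boxTransform u y) (2 * Real.cos (2 * Real.pi * y * u)) u := by
  have hc : Continuous fun x => 2 * Real.cos (2 * Real.pi * y * x) := by fun_prop
  exact (hc.integral_hasStrictDerivAt 0 u).hasDerivAt

theorem abs_boxTransform_le (u y : ℝ) : |boxTransform u y| ≤ 2 * |u| := by
  have := intervalIntegral.norm_integral_le_of_norm_le_const (a := 0) (b := u) (C := 2)
    (f := fun x => 2 * Real.cos (2 * Real.pi * y * x)) fun x _ => by
      rw [Real.norm_eq_abs, abs_mul, abs_two]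
      linarith [Real.abs_cos_le_one (2 * Real.pi * y * x)]
  rw [sub_zero] at this
  exact this

theorem boxTransform_eq_sin {y : ℝ} (hy : y ≠ 0) (u : ℝ) :
    boxTransform u y = Real.sin (2 * Real.pi * y * u) / (Real.pi * y) := by
  have h : 2 * Real.pi * y ≠ 0 := by positivity
  rw [boxTransform, intervalIntegral.integral_const_mul,
    intervalIntegral.integral_comp_mul_left (fun x => Real.cos x) h, integral_cos]
  simp only [mul_zero, Real.sin_zero, sub_zero, smul_eq_mul]
  field_simp

theorem fourier_indicator_Icc {u : ℝ} (hu : 0 ≤ u) (y : ℝ) :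
    𝓕 ((Set.Icc (-u) u).indicator fun _ => (1 : ℂ)) y = (boxTransform u y : ℂ) := by
  have hc : ∀ a b : ℝ, IntervalIntegrable
      (fun x : ℝ => Complex.exp (((-2 * Real.pi * (x * y) : ℝ) : ℂ) * Complex.I)) volume a b :=
    fun a b => Continuous.intervalIntegrable (by fun_prop) a b
  have h1 : 𝓕 ((Set.Icc (-u) u).indicator fun _ => (1 : ℂ)) y =
      ∫ x in (-u)..u, Complex.exp (((-2 * Real.pi * (x * y) : ℝ) : ℂ) * Complex.I) := by
    rw [Real.fourier_eq', intervalIntegral.integral_of_le (by linarith),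
      ← integral_Icc_eq_integral_Ioc, ← integral_indicator measurableSet_Icc]
    congr 1 with x
    by_cases hx : x ∈ Set.Icc (-u) u
    · simp [Set.indicator_of_mem hx, mul_comm]
    · simp [Set.indicator_of_notMem hx]
  have h2 : ∫ x in (-u)..0, Complex.exp (((-2 * Real.pi * (x * y) : ℝ) : ℂ) * Complex.I) =
      ∫ x in (0 : ℝ)..u, Complex.exp (((-2 * Real.pi * (-x * y) : ℝ) : ℂ) * Complex.I) := by
    have := intervalIntegral.integral_comp_neg (a := 0) (b := u)
      (f := fun x : ℝ => Complex.exp (((-2 * Real.pi * (x * y) : ℝ) : ℂ) * Complex.I))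
    rw [this, neg_zero]
  rw [h1, ← intervalIntegral.integral_add_adjacent_intervals (hc (-u) 0) (hc 0 u), h2,
    ← intervalIntegral.integral_add (Continuous.intervalIntegrable (by fun_prop) _ _) (hc 0 u),
    boxTransform, ← intervalIntegral.integral_ofReal]
  congr 1 with x
  push_cast
  rw [Complex.two_cos, show (2 * Real.pi * y * x : ℂ) * Complex.I =
    -2 * Real.pi * (-x * y) * Complex.I by ring, show -(2 * Real.pi * y * x : ℂ) * Complex.I =
    -2 * Real.pi * (x * y) * Complex.I by ring]

/-- The plane wave `u ↦ e^{2πi u s}`. -/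
def planeWave (s u : ℝ) : ℂ := Complex.exp (Complex.I * ((2 * Real.pi * s * u : ℝ) : ℂ))

theorem norm_planeWave (s u : ℝ) : ‖planeWave s u‖ = 1 := norm_cexp_phase _

theorem hasDerivAt_planeWave (s u : ℝ) :
    HasDerivAt (planeWave s) (Complex.I * ((2 * Real.pi * s : ℝ) : ℂ) * planeWave s u) u := by
  have h1 : HasDerivAt (fun u : ℝ => ((2 * Real.pi * s * u : ℝ) : ℂ)) ((2 * Real.pi * s : ℝ) : ℂ) u := by
    have := ((hasDerivAt_id u).const_mul (2 * Real.pi * s)).ofReal_comp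
    simpa using this
  convert! (h1.const_mul Complex.I).cexp using 1
  rw [planeWave]
  ring

/-- The amplitudes in the decomposition of `boxTransform` into two plane waves. -/
def boxAmp (b : Bool) (y u : ℝ) : ℂ :=
  if 1 ≤ |y| then (if b then 1 else -1) / (2 * Real.pi * y * Complex.I)
  else if b then (boxTransform u y : ℂ) * planeWave (-y) u else 0

/-- The sign attached to a Boolean. -/
def boolSign (b : Bool) : ℝ := if b then 1 else -1

/-- For `|y| ≥ 1` the sine is split into two exponentials. For `|y| < 1` that would create a pole at
`y = 0`, so the whole transform, which varies slowly in `u`, is taken as the amplitude of a single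
wave. -/
theorem boxTransform_eq_sum (y u : ℝ) :
    (boxTransform u y : ℂ) = ∑ b : Bool, boxAmp b y u * planeWave (boolSign b * y) u := by
  rw [Fintype.sum_bool]
  by_cases hy : 1 ≤ |y|
  · have hy0 : y ≠ 0 := by rintro rfl; norm_num at hy
    have hyc : (y : ℂ) ≠ 0 := by exact_mod_cast hy0
    have hpi : (Real.pi : ℂ) ≠ 0 := by exact_mod_cast Real.pi_ne_zero
    rw [boxTransform_eq_sin hy0]
    simp only [boxAmp, if_pos hy, planeWave, boolSign]
    push_cast
    rw [Complex.sin]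
    have e1 : -(2 * (Real.pi : ℂ) * y * u) * Complex.I = Complex.I * (2 * Real.pi * (-1 * y) * u) := by
      ring
    have e2 : 2 * (Real.pi : ℂ) * y * u * Complex.I = Complex.I * (2 * Real.pi * (1 * y) * u) := by
      ring
    rw [e1, e2]
    field_simp
    rw [Complex.I_sq]
    ring
  · simp only [boxAmp, if_neg hy, if_true, Bool.false_eq_true, if_false, zero_mul, add_zero,
      boolSign, one_mul]
    rw [mul_assoc, planeWave, planeWave, ← Complex.exp_add]
    have : Complex.I * ((2 * Real.pi * -y * u : ℝ) : ℂ) + Complex.I * ((2 * Real.pi * y * u : ℝ) : ℂ) = 0 := by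
      push_cast; ring
    rw [this, Complex.exp_zero, mul_one]

theorem exists_hasDerivAt_boxAmp (b : Bool) (y : ℝ) : ∃ a' : ℝ → ℂ,
    (∀ u, HasDerivAt (boxAmp b y) (a' u) u) ∧ Continuous a' ∧
    ∀ u, 0 ≤ u → u ≤ 2 → ‖boxAmp b y u‖ ≤ 80 / (1 + |y|) ∧ ‖a' u‖ ≤ 80 / (1 + |y|) := by
  -- For `|y| < 1` and `0 ≤ u ≤ 2` the amplitude is at most `4` and its derivative at most `2 + 8π <
  -- 40`; the factor `2` bounds `1 + |y|`.
  have h1 : ∀ {K : ℝ}, |y| < 1 → K ≤ 40 → K ≤ 80 / (1 + |y|) := fun hy hK => by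
    rw [le_div_iff₀ (by positivity)]
    nlinarith [abs_nonneg y]
  by_cases hy : 1 ≤ |y|
  · have e : boxAmp b y = fun _ => (if b then 1 else -1) / (2 * Real.pi * y * Complex.I) := by
      ext u; simp [boxAmp, hy]
    refine ⟨fun _ => 0, fun u => by rw [e]; exact hasDerivAt_const u _, continuous_const, fun u _ _ => ⟨?_, ?_⟩⟩
    · rw [e]
      have : ‖(if b then 1 else -1 : ℂ)‖ = 1 := by split_ifs <;> simp
      rw [norm_div, this]
      simp only [norm_mul, Complex.norm_I, Complex.norm_real, Complex.norm_ofNat, mul_one,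
        Real.norm_eq_abs, abs_of_pos Real.pi_pos]
      have hpi := Real.pi_gt_three
      rw [div_le_div_iff₀ (by positivity) (by positivity)]
      nlinarith
    · rw [norm_zero]; positivity
  · have hy' : |y| < 1 := not_le.mp hy
    cases b with
    | false =>
      have e : boxAmp false y = fun _ => 0 := by ext u; simp [boxAmp, hy]
      refine ⟨fun _ => 0, fun u => by rw [e]; exact hasDerivAt_const u _, continuous_const, fun u _ _ => ?_⟩
      rw [e, norm_zero]
      constructor <;> positivity
    | true =>
      have e : boxAmp true y = fun u => (boxTransform u y : ℂ) * planeWave (-y) u := by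
        ext u; simp [boxAmp, hy]
      have hd : ∀ u, HasDerivAt (boxAmp true y)
          (((2 * Real.cos (2 * Real.pi * y * u) : ℝ) : ℂ) * planeWave (-y) u +
            (boxTransform u y : ℂ) * (Complex.I * ((2 * Real.pi * -y : ℝ) : ℂ) *
              planeWave (-y) u)) u := fun u => by
        rw [e]
        exact (hasDerivAt_boxTransform u y).ofReal_comp.mul (hasDerivAt_planeWave (-y) u)
      refine ⟨_, hd, ?_, fun u hu0 hu2 => ?_⟩
      · have c1 : Continuous fun u => (boxTransform u y : ℂ) := Complex.continuous_ofReal.comp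
          (continuous_iff_continuousAt.mpr fun u => (hasDerivAt_boxTransform u y).continuousAt)
        have c2 : Continuous (planeWave (-y)) :=
          continuous_iff_continuousAt.mpr fun u => (hasDerivAt_planeWave (-y) u).continuousAt
        fun_prop
      · have hb : |boxTransform u y| ≤ 4 := (abs_boxTransform_le u y).trans (by
          rw [abs_of_nonneg hu0]; linarith)
        have hpi := Real.pi_lt_d2
        constructor
        · rw [e, norm_mul, norm_planeWave, mul_one, Complex.norm_real, Real.norm_eq_abs]
          exact h1 hy' (by linarith)
        · refine (norm_add_le _ _).trans (h1 hy' ?_)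
          simp only [norm_mul, norm_planeWave, mul_one, Complex.norm_real, Real.norm_eq_abs,
            Complex.norm_I, one_mul, abs_neg, abs_two, abs_of_pos Real.pi_pos]
          have hc := Real.abs_cos_le_one (2 * Real.pi * y * u)
          have hyb : |boxTransform u y| * |y| ≤ 4 * 1 :=
            mul_le_mul hb hy'.le (abs_nonneg _) (by norm_num)
          have hp : 0 < Real.pi := Real.pi_pos
          nlinarith [mul_nonneg (abs_nonneg (boxTransform u y)) (abs_nonneg y)]

theorem lintegral_affine_of_abs_eq_one (G : ℝ → ℝ≥0∞) {a : ℝ} (ha : |a| = 1) (b : ℝ) :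
    ∫⁻ t, G (a * t + b) = ∫⁻ t, G t := by
  rcases (abs_eq one_pos.le).mp ha with rfl | rfl
  · simp only [one_mul]
    exact lintegral_add_right_eq_self G b
  · have h := (Measure.measurePreserving_neg (volume : Measure ℝ)).lintegral_comp_emb
      (MeasurableEquiv.neg ℝ).measurableEmbedding (fun t => G (t + b))
    simp only [neg_mul, one_mul]
    rw [h]
    exact lintegral_add_right_eq_self G b

/-- The signed sum replaces the coordinate `y i` by a change of variable of Jacobian `1`, after
which the integrand is a product. -/
theorem lintegral_mul_shear {n : ℕ} {g : Fin n → ℝ → ℝ≥0∞} (hg : ∀ i, Measurable (g i))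
    {G : ℝ → ℝ≥0∞} (hG : Measurable G) {σ : Fin (n + 1) → ℝ} (i : Fin (n + 1)) (hσ : |σ i| = 1) :
    ∫⁻ y : Fin (n + 1) → ℝ, (∏ j, g j (y (i.succAbove j))) * G (∑ j, σ j * y j) =
      (∏ j, ∫⁻ t, g j t) * ∫⁻ t, G t := by
  have hmp := (volume_preserving_piFinSuccAbove (fun _ : Fin (n + 1) => ℝ) i).symm
  have hm : Measurable fun z : Fin n → ℝ => ∏ j, g j (z j) :=
    Finset.measurable_fun_prod _ fun j _ => (hg j).comp (measurable_pi_apply j)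
  rw [← hmp.lintegral_comp_emb (MeasurableEquiv.measurableEmbedding _)]
  simp only [MeasurableEquiv.piFinSuccAbove_symm_apply, Fin.insertNthEquiv, Equiv.coe_fn_mk,
    Fin.insertNth_apply_succAbove, Fin.sum_univ_succAbove _ i, Fin.insertNth_apply_same]
  rw [Measure.volume_eq_prod, lintegral_prod_symm]
  · simp only []
    have : ∀ z : Fin n → ℝ, ∫⁻ t : ℝ, (∏ j, g j (z j)) * G (σ i * t + ∑ j, σ (i.succAbove j) * z j) =
        (∏ j, g j (z j)) * ∫⁻ t, G t := fun z => by
      rw [lintegral_const_mul _ (show Measurable fun t => G (σ i * t + ∑ j, σ (i.succAbove j) * z j) from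
        hG.comp (by fun_prop)), lintegral_affine_of_abs_eq_one G hσ]
    simp_rw [this]
    rw [lintegral_mul_const _ hm, lintegral_pi_prod_eq_prod hg]
  · exact ((hm.comp measurable_snd).mul (hG.comp (by fun_prop))).aemeasurable

theorem lintegral_one_add_abs_rpow_lt_top {η : ℝ} (hη : 0 < η) :
    ∫⁻ t : ℝ, ENNReal.ofReal ((1 + |t|) ^ (-(1 + η))) < ∞ := by
  have := integrable_one_add_norm (E := ℝ) (μ := volume) (r := 1 + η) (by simpa using hη)
  exact this.lintegral_lt_top

/-- Let `i` be the largest coordinate and `s` the signed sum, so `|s| ≤ (n+1)|y i|`. The factor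
`(1+|y i|)⁻¹` is spent elsewhere: a power `η` goes to each of the `n` other coordinates and the
remaining `1 - ηn` to `s`, which already has `η(n+1)`. All exponents then equal `1 + η`. -/
theorem exists_prod_inv_mul_le {n : ℕ} {η : ℝ} (hη : 0 < η) (hη1 : η * (n + 1) ≤ 1)
    {σ : Fin (n + 1) → ℝ} (hσ : ∀ i, |σ i| = 1) (y : Fin (n + 1) → ℝ) :
    ∃ i : Fin (n + 1), (∏ j, (1 + |y j|)⁻¹) * (1 + |∑ j, σ j * y j|) ^ (-(η * (n + 1))) ≤
      (n + 1) * ((∏ j, (1 + |y (i.succAbove j)|) ^ (-(1 + η))) *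
        (1 + |∑ j, σ j * y j|) ^ (-(1 + η))) := by
  obtain ⟨i, hi⟩ := Finite.exists_max fun i => |y i|
  refine ⟨i, ?_⟩
  set s := ∑ j, σ j * y j with hs
  have hs0 : 0 < 1 + |s| := by positivity
  have hy0 : ∀ j, 0 < 1 + |y j| := fun j => by positivity
  have hsle : 1 + |s| ≤ (n + 1) * (1 + |y i|) := by
    have : |s| ≤ (n + 1) * |y i| := by
      calc |s| ≤ ∑ j, |σ j * y j| := Finset.abs_sum_le_sum_abs _ _
        _ ≤ ∑ _j : Fin (n + 1), |y i| := Finset.sum_le_sum fun j _ => by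
            rw [abs_mul, hσ, one_mul]; exact hi j
        _ = _ := by simp
    have h0 : (0 : ℝ) ≤ n := Nat.cast_nonneg n
    linarith
  set r := 1 - η * n with hr
  have hr0 : 0 ≤ r := by nlinarith
  have hr1 : r ≤ 1 := by have : (0 : ℝ) ≤ η * n := by positivity
                         linarith
  have h1 : (1 + |y i|) ^ (-r) ≤ (n + 1) * (1 + |s|) ^ (-r) := by
    rw [Real.rpow_neg (hy0 i).le, Real.rpow_neg hs0.le, ← div_eq_mul_inv,
      le_div_iff₀ (by positivity), inv_mul_le_iff₀ (by positivity)]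
    calc (1 + |s|) ^ r ≤ ((n + 1) * (1 + |y i|)) ^ r := by gcongr
      _ = (n + 1) ^ r * (1 + |y i|) ^ r := Real.mul_rpow (by positivity) (hy0 i).le
      _ ≤ (n + 1) ^ (1 : ℝ) * (1 + |y i|) ^ r := by
          gcongr
          have : (0 : ℝ) ≤ n := Nat.cast_nonneg n
          linarith
      _ = _ := by rw [Real.rpow_one]; ring
  have h2 : (1 + |y i|)⁻¹ ≤ (n + 1) * (1 + |s|) ^ (-r) *
      ∏ j : Fin n, (1 + |y (i.succAbove j)|) ^ (-η) := by
    calc (1 + |y i|)⁻¹ = (1 + |y i|) ^ (-r) * ∏ _j : Fin n, (1 + |y i|) ^ (-η) := by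
          rw [Finset.prod_const, Finset.card_univ, Fintype.card_fin, ← Real.rpow_natCast,
            ← Real.rpow_mul (hy0 i).le, ← Real.rpow_add (hy0 i), ← Real.rpow_neg_one]
          congr 1
          rw [hr]; ring
      _ ≤ _ := by
          refine mul_le_mul h1 (Finset.prod_le_prod (fun j _ => (Real.rpow_pos_of_pos (hy0 i) _).le)
            fun j _ => ?_) (by positivity) (by positivity)
          exact Real.rpow_le_rpow_of_nonpos (hy0 _) (by linarith [hi (i.succAbove j)])
            (by linarith)
  rw [Fin.prod_univ_succAbove _ i]
  have e1 : (1 + |s|) ^ (-(1 + η)) = (1 + |s|) ^ (-r) * (1 + |s|) ^ (-(η * (n + 1))) := by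
    rw [← Real.rpow_add hs0]
    congr 1
    rw [hr]; ring
  have e2 : ∏ j, (1 + |y (i.succAbove j)|) ^ (-(1 + η)) =
      (∏ j, (1 + |y (i.succAbove j)|) ^ (-η)) * ∏ j, (1 + |y (i.succAbove j)|)⁻¹ := by
    rw [← Finset.prod_mul_distrib]
    refine Finset.prod_congr rfl fun j _ => ?_
    rw [← Real.rpow_neg_one, ← Real.rpow_add (hy0 _)]
    congr 1; ring
  rw [e1, e2]
  calc _ ≤ ((n + 1) * (1 + |s|) ^ (-r) * ∏ j : Fin n, (1 + |y (i.succAbove j)|) ^ (-η)) *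
        (∏ j, (1 + |y (i.succAbove j)|)⁻¹) * (1 + |s|) ^ (-(η * (n + 1))) := by gcongr
    _ = _ := by ring

/-- The product `∏ (1+|y_j|)⁻¹` misses integrability by logarithms only, so any positive power of
decay in the signed sum repairs it. The choice `η = δ/d` shares `δ` out; the sum over `i` covers
every position of the largest coordinate. -/
theorem exists_lintegral_prod_inv_mul_le {d : ℕ} (hd : 1 ≤ d) {δ : ℝ} (hδ : 0 < δ) (hδ1 : δ ≤ 1) :
    ∃ C, 0 ≤ C ∧ ∀ σ : Fin d → ℝ, (∀ i, |σ i| = 1) →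
      ∫⁻ y : EuclideanSpace ℝ (Fin d), ENNReal.ofReal
        ((∏ j, (1 + |y j|)⁻¹) * (1 + |∑ j, σ j * y j|) ^ (-δ)) ≤ ENNReal.ofReal C := by
  obtain ⟨n, rfl⟩ : ∃ n, d = n + 1 := ⟨d - 1, by omega⟩
  set η := δ / (n + 1) with hη
  have hη0 : 0 < η := by positivity
  have hηδ : η * (n + 1) = δ := by rw [hη]; field_simp
  set G : ℝ → ℝ≥0∞ := fun t => ENNReal.ofReal ((1 + |t|) ^ (-(1 + η))) with hG
  have hGm : Measurable G := by fun_prop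
  have hGi : ∫⁻ t, G t < ∞ := lintegral_one_add_abs_rpow_lt_top hη0
  set T : ℝ≥0∞ := ∑ _i : Fin (n + 1), ENNReal.ofReal (n + 1) *
    ((∏ _j : Fin n, ∫⁻ t, G t) * ∫⁻ t, G t) with hT
  have hTfin : T ≠ ∞ := by
    refine ENNReal.sum_ne_top.mpr fun i _ => ENNReal.mul_ne_top ENNReal.ofReal_ne_top ?_
    exact ENNReal.mul_ne_top (ENNReal.prod_ne_top fun j _ => hGi.ne) hGi.ne
  refine ⟨T.toReal, ENNReal.toReal_nonneg, fun σ hσ => ?_⟩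
  rw [ENNReal.ofReal_toReal hTfin]
  have hmp := (PiLp.volume_preserving_ofLp (Fin (n + 1))).lintegral_comp_emb
    (MeasurableEquiv.toLp 2 (Fin (n + 1) → ℝ)).symm.measurableEmbedding
    (fun y : Fin (n + 1) → ℝ => ENNReal.ofReal
        ((∏ j, (1 + |y j|)⁻¹) * (1 + |∑ j, σ j * y j|) ^ (-δ)))
  rw [hmp]
  have hpt : ∀ y : Fin (n + 1) → ℝ, ENNReal.ofReal
        ((∏ j, (1 + |y j|)⁻¹) * (1 + |∑ j, σ j * y j|) ^ (-δ)) ≤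
      ∑ i : Fin (n + 1), ENNReal.ofReal (n + 1) *
        ((∏ j, G (y (i.succAbove j))) * G (∑ j, σ j * y j)) := fun y => by
    obtain ⟨i, hi⟩ := exists_prod_inv_mul_le hη0 (hηδ.trans_le hδ1) hσ y
    rw [hηδ] at hi
    refine le_trans ?_ (Finset.single_le_sum (f := fun i : Fin (n + 1) => ENNReal.ofReal (n + 1) *
        ((∏ j, G (y (i.succAbove j))) * G (∑ j, σ j * y j))) (fun _ _ => zero_le)
        (Finset.mem_univ i))
    refine (ENNReal.ofReal_le_ofReal hi).trans (le_of_eq ?_)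
    rw [ENNReal.ofReal_mul (by positivity), ENNReal.ofReal_mul (by positivity),
      ENNReal.ofReal_prod_of_nonneg fun j _ => by positivity]
  refine (lintegral_mono hpt).trans ?_
  rw [lintegral_finsetSum]
  · refine Finset.sum_le_sum fun i _ => ?_
    rw [lintegral_const_mul' _ _ ENNReal.ofReal_ne_top,
      lintegral_mul_shear (fun _ => hGm) hGm i (hσ i)]
  · intro i _
    refine Measurable.const_mul (Measurable.mul ?_ (hGm.comp (by fun_prop))) _
    exact Finset.measurable_fun_prod _ fun j _ => hGm.comp (measurable_pi_apply _)

end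

/-! ### Band estimate for the maximum norm -/

noncomputable section

variable {d : ℕ}

theorem mul_min_one_le_rpow {t δ : ℝ} (ht : 0 ≤ t) (hδ : 0 ≤ δ) (hδ1 : δ ≤ 1) :
    min 1 t ≤ t ^ δ := by
  rcases le_total t 1 with h | h
  · rw [min_eq_right h]
    exact Real.self_le_rpow_of_le_one ht h hδ1
  · rw [min_eq_left h]
    exact Real.one_le_rpow h hδ

theorem norm_integral_le_of_norm_le_on_Icc {f : ℝ → ℂ} {M : ℝ} (hf : ∀ u, u ∉ Set.Icc (0 : ℝ) 2 → f u = 0)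
    (hM : ∀ u ∈ Set.Icc (0 : ℝ) 2, ‖f u‖ ≤ M) : ∫ u, ‖f u‖ ≤ 2 * M := by
  rw [← setIntegral_eq_integral_of_forall_compl_eq_zero (s := Set.Icc (0 : ℝ) 2)
    fun u hu => by rw [hf u hu, norm_zero]]
  have := norm_setIntegral_le_of_norm_le_const (μ := volume) (s := Set.Icc (0 : ℝ) 2)
    (f := fun u => ‖f u‖) (C := M) (by simp) fun u hu => by rw [norm_norm]; exact hM u hu
  refine (le_abs_self _).trans (this.trans (le_of_eq ?_))
  simp [mul_comm]

/-- Interpolated decay of the Fourier transform of a `C¹` function supported in `[0, 2]`. -/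
theorem norm_fourier_le_of_hasDerivAt {f f' : ℝ → ℂ} (hf : ∀ u, HasDerivAt f (f' u) u)
    (hf' : Continuous f') (h0 : ∀ u, u ∉ Set.Icc (0 : ℝ) 2 → f u = 0) {M N δ : ℝ} (hN : 1 ≤ N)
    (hM : ∀ u ∈ Set.Icc (0 : ℝ) 2, ‖f u‖ ≤ M) (hM' : ∀ u ∈ Set.Icc (0 : ℝ) 2, ‖f' u‖ ≤ M * N)
    (hδ : 0 ≤ δ) (hδ1 : δ ≤ 1) (s : ℝ) : ‖𝓕 f s‖ ≤ 4 * M * (N ^ δ * (1 + |s|) ^ (-δ)) := by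
  have hM0 : 0 ≤ M := (norm_nonneg _).trans (hM 0 (by simp))
  have hfc : Continuous f := continuous_iff_continuousAt.mpr fun u => (hf u).continuousAt
  have hd : deriv f = f' := funext fun u => (hf u).deriv
  have h0' : ∀ u, u ∉ Set.Icc (0 : ℝ) 2 → f' u = 0 := fun u hu => by
    rw [← hd]
    have : f =ᶠ[nhds u] fun _ => 0 := by
      filter_upwards [isClosed_Icc.isOpen_compl.mem_nhds hu] with v hv using h0 v hv
    rw [this.deriv_eq, deriv_const]
  have hi : Integrable f := hfc.integrable_of_hasCompactSupport
    (HasCompactSupport.intro (isCompact_Icc (a := (0 : ℝ)) (b := 2)) h0)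
  have hi' : Integrable f' := hf'.integrable_of_hasCompactSupport
    (HasCompactSupport.intro (isCompact_Icc (a := (0 : ℝ)) (b := 2)) h0')
  have b1 : ‖𝓕 f s‖ ≤ 2 * M :=
    (norm_fourier_le_integral_norm f s).trans (norm_integral_le_of_norm_le_on_Icc h0 hM)
  have b2 : 2 * Real.pi * |s| * ‖𝓕 f s‖ ≤ 2 * (M * N) := by
    have e := congrFun (Real.fourier_deriv hi (fun u => (hf u).differentiableAt) (by rwa [hd])) s
    have : ‖𝓕 f' s‖ = 2 * Real.pi * |s| * ‖𝓕 f s‖ := by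
      rw [← hd, e]
      simp [abs_of_pos Real.pi_pos]
    rw [← this]
    exact (norm_fourier_le_integral_norm f' s).trans (norm_integral_le_of_norm_le_on_Icc h0' hM')
  have hs : 0 < 1 + |s| := by positivity
  have b3 : (1 + |s|) * ‖𝓕 f s‖ ≤ 4 * M * N := by
    have hpi := Real.pi_gt_three
    have : |s| * ‖𝓕 f s‖ ≤ 2 * Real.pi * |s| * ‖𝓕 f s‖ := by
      rw [mul_assoc (2 * Real.pi)]
      exact le_mul_of_one_le_left (by positivity) (by linarith)
    nlinarith [mul_nonneg hM0 (sub_nonneg.mpr hN)]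
  -- The trivial bound and one integration by parts; the `δ`-th power interpolates between them and
  -- loses only `N^δ`.
  have b4 : ‖𝓕 f s‖ ≤ 4 * M * min 1 (N / (1 + |s|)) := by
    rw [mul_min_of_nonneg _ _ (by positivity)]
    refine le_min (by linarith) ?_
    rw [← mul_div_assoc, le_div_iff₀ hs]
    linarith
  refine b4.trans ?_
  rw [Real.rpow_neg hs.le, ← div_eq_mul_inv, ← Real.div_rpow (by linarith) hs.le]
  gcongr
  exact mul_min_one_le_rpow (by positivity) hδ hδ1

/-- Superposition of the indicators of cubes. -/
def cubeSum (k : ℝ → ℂ) (x : EuclideanSpace ℝ (Fin d)) : ℂ :=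
  ∫ u, k u * ∏ j, (Set.Icc (-u) u).indicator (fun _ => (1 : ℂ)) (x j)

theorem fourier_cubeSum {k : ℝ → ℂ} (hk : Continuous k) (h0 : ∀ u, u ∉ Set.Icc (0 : ℝ) 2 → k u = 0)
    (y : EuclideanSpace ℝ (Fin d)) :
    𝓕 (cubeSum k) y = ∫ u, k u * ∏ j, (boxTransform u (y j) : ℂ) := by
  have hki : Integrable k := hk.integrable_of_hasCompactSupport
    (HasCompactSupport.intro (isCompact_Icc (a := (0 : ℝ)) (b := 2)) h0)
  set P : EuclideanSpace ℝ (Fin d) → ℝ → ℂ := fun x u =>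
    ∏ j, (Set.Icc (-u) u).indicator (fun _ => (1 : ℂ)) (x j) with hP
  set W : EuclideanSpace ℝ (Fin d) → ℂ := fun x =>
    Complex.exp ((-2 * Real.pi * inner ℝ x y : ℝ) * Complex.I) with hW
  have hWn : ∀ x, ‖W x‖ = 1 := fun x => Complex.norm_exp_ofReal_mul_I _
  set Q : Set (EuclideanSpace ℝ (Fin d)) := {x | ∀ i, |x i| ≤ 2} with hQ
  have hQm : MeasurableSet Q := by
    rw [hQ, Set.ofPred_forall]
    exact MeasurableSet.iInter fun i => measurableSet_le (by fun_prop) measurable_const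
  have hPm : Measurable (Function.uncurry P) := by
    refine Finset.measurable_fun_prod _ fun j _ => ?_
    have : (fun z : EuclideanSpace ℝ (Fin d) × ℝ =>
        (Set.Icc (-z.2) z.2).indicator (fun _ => (1 : ℂ)) (z.1 j)) =
        {z : EuclideanSpace ℝ (Fin d) × ℝ | -z.2 ≤ z.1 j ∧ z.1 j ≤ z.2}.indicator fun _ => 1 := rfl
    rw [this]
    refine measurable_const.indicator (MeasurableSet.inter
      (s₁ := {z : EuclideanSpace ℝ (Fin d) × ℝ | -z.2 ≤ z.1 j})
      (s₂ := {z : EuclideanSpace ℝ (Fin d) × ℝ | z.1 j ≤ z.2})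
      (measurableSet_le ?_ ?_) (measurableSet_le ?_ ?_)) <;> fun_prop
  have hWm : Continuous W := by fun_prop
  have hint : Integrable (Function.uncurry fun x u => W x * (k u * P x u))
      ((volume : Measure (EuclideanSpace ℝ (Fin d))).prod (volume : Measure ℝ)) := by
    have hdom : Integrable (fun z : EuclideanSpace ℝ (Fin d) × ℝ =>
        Q.indicator (fun _ => (1 : ℝ)) z.1 * ‖k z.2‖)
        ((volume : Measure (EuclideanSpace ℝ (Fin d))).prod (volume : Measure ℝ)) := by
      refine Integrable.mul_prod ((integrable_indicator_iff hQm).mpr ?_) hki.norm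
      refine integrableOn_const ?_
      rw [hQ, volume_euclidean_cube two_pos.le]
      exact ENNReal.ofReal_ne_top
    refine hdom.mono' ?_ (Filter.Eventually.of_forall fun z => ?_)
    · exact ((hWm.measurable.comp measurable_fst).mul
        ((hk.measurable.comp measurable_snd).mul hPm)).aestronglyMeasurable
    · obtain ⟨x, u⟩ := z
      simp only [Function.uncurry, norm_mul, hWn, one_mul]
      rw [mul_comm]
      by_cases hu : u ∈ Set.Icc (0 : ℝ) 2
      · refine mul_le_mul_of_nonneg_right ?_ (norm_nonneg _)
        by_cases hx : x ∈ Q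
        · rw [Set.indicator_of_mem hx, hP, norm_prod]
          refine Finset.prod_le_one (fun _ _ => norm_nonneg _) fun j _ => ?_
          exact (norm_indicator_le_norm_self _ _).trans (by simp)
        · rw [Set.indicator_of_notMem hx]
          obtain ⟨i, hi⟩ := not_forall.mp hx
          have : P x u = 0 := Finset.prod_eq_zero (Finset.mem_univ i)
            (Set.indicator_of_notMem (s := Set.Icc (-u) u) (fun h => hi ((abs_le.mpr h).trans hu.2)) _)
          rw [this, norm_zero]
      · simp [h0 u hu]
  rw [Real.fourier_eq']
  have e1 : ∀ x : EuclideanSpace ℝ (Fin d), Complex.exp ((-2 * Real.pi * inner ℝ x y : ℝ) * Complex.I) • cubeSum k x =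
      ∫ u, W x * (k u * P x u) := fun x => by
    rw [integral_const_mul]; rfl
  simp_rw [e1]
  rw [integral_integral_swap hint]
  congr 1 with u
  have e2 : ∫ x, W x * (k u * P x u) = k u * 𝓕 (fun x => P x u) y := by
    rw [Real.fourier_eq', ← integral_const_mul]
    congr 1 with x
    rw [smul_eq_mul]; ring
  rw [e2]
  by_cases hu : u ∈ Set.Icc (0 : ℝ) 2
  · rw [hP, fourier_euclidean_prod (fun _ => (Set.Icc (-u) u).indicator fun _ => (1 : ℂ)) y]
    simp_rw [fourier_indicator_Icc hu.1]
  · rw [h0 u hu, zero_mul, zero_mul]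

/-- The point `x` lies in the cube `[-u, u]^d` exactly when `u ≥ max |x_j|`, so the superposition is
the integral of `h'` from `max |x_j|` to infinity. -/
theorem cubeSum_eq [Nonempty (Fin d)] {h k : ℝ → ℂ} (hd : ∀ u, HasDerivAt h (k u) u)
    (hk : Integrable k) (h0 : ∀ s, 2 ≤ s → h s = 0) (x : EuclideanSpace ℝ (Fin d)) :
    cubeSum k x = -h (⨆ j, |x j|) := by
  have e : ∀ u, k u * ∏ j, (Set.Icc (-u) u).indicator (fun _ => (1 : ℂ)) (x j) =
      (Set.Ici (⨆ j, |x j|)).indicator k u := fun u => by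
    by_cases hu : u ∈ Set.Ici (⨆ j, |x j|)
    · have h' := (ciSup_le_iff (Set.finite_range _).bddAbove).mp (Set.mem_Ici.mp hu)
      rw [Set.indicator_of_mem hu, Finset.prod_eq_one, mul_one]
      intro j _
      exact Set.indicator_of_mem (s := Set.Icc (-u) u) (abs_le.mp (h' j)) _
    · have h' : ¬ ∀ j, |x j| ≤ u := fun h' => hu
        ((ciSup_le_iff (Set.finite_range _).bddAbove).mpr h')
      obtain ⟨j, hj⟩ := not_forall.mp h'
      rw [Set.indicator_of_notMem hu, Finset.prod_eq_zero (Finset.mem_univ j), mul_zero]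
      exact Set.indicator_of_notMem (s := Set.Icc (-u) u) (fun h => hj (abs_le.mpr h)) _
  rw [cubeSum]
  simp_rw [e]
  rw [integral_indicator measurableSet_Ici, integral_Ici_eq_integral_Ioi,
    integral_Ioi_of_hasDerivAt_of_tendsto (m := 0) (hd _).continuousAt.continuousWithinAt
      (fun u _ => hd u) hk.integrableOn, zero_sub]
  refine tendsto_const_nhds.congr' ?_
  filter_upwards [Filter.eventually_ge_atTop 2] with s hs using (h0 s hs).symm

/-- Differentiating in `u` costs no power of `y`: all oscillation has been moved into the plane
wave, so integration by parts loses nothing. -/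
theorem exists_hasDerivAt_prod_boxAmp (d : ℕ) : ∃ C, 0 ≤ C ∧ ∀ (ε : Fin d → Bool) (y : Fin d → ℝ),
    ∃ a' : ℝ → ℂ, (∀ u, HasDerivAt (fun u => ∏ j, boxAmp (ε j) (y j) u) (a' u) u) ∧ Continuous a' ∧
    ∀ u ∈ Set.Icc (0 : ℝ) 2, ‖∏ j, boxAmp (ε j) (y j) u‖ ≤ C * ∏ j, (1 + |y j|)⁻¹ ∧
      ‖a' u‖ ≤ C * ∏ j, (1 + |y j|)⁻¹ := by
  refine ⟨(1 + d) * 80 ^ d, by positivity, fun ε y => ?_⟩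
  choose a' h1 h2 h3 using fun j => exists_hasDerivAt_boxAmp (ε j) (y j)
  have hc : ∀ j, Continuous (boxAmp (ε j) (y j)) := fun j =>
    continuous_iff_continuousAt.mpr fun u => (h1 j u).continuousAt
  have hprod : ∏ j, 80 / (1 + |y j|) = 80 ^ d * ∏ j, (1 + |y j|)⁻¹ := by
    simp_rw [div_eq_mul_inv]
    rw [Finset.prod_mul_distrib]
    simp
  refine ⟨_, fun u => HasDerivAt.fun_finsetProd fun j _ => h1 j u, ?_, fun u hu => ⟨?_, ?_⟩⟩
  · exact continuous_finsetSum _ fun i _ =>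
      (continuous_finsetProd _ fun j _ => hc j).smul (h2 i)
  · rw [norm_prod]
    calc _ ≤ ∏ j, 80 / (1 + |y j|) :=
          Finset.prod_le_prod (fun _ _ => norm_nonneg _) fun j _ => (h3 j u hu.1 hu.2).1
      _ = 1 * 80 ^ d * ∏ j, (1 + |y j|)⁻¹ := by rw [hprod, one_mul]
      _ ≤ _ := by
          gcongr
          linarith [(Nat.cast_nonneg d : (0 : ℝ) ≤ d)]
  · refine (norm_sum_le _ _).trans ?_
    calc _ ≤ ∑ _i : Fin d, ∏ j, 80 / (1 + |y j|) := by
          refine Finset.sum_le_sum fun i _ => ?_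
          rw [norm_smul, norm_prod, ← Finset.prod_erase_mul _ _ (Finset.mem_univ i)]
          refine mul_le_mul (Finset.prod_le_prod (fun _ _ => norm_nonneg _) fun j _ =>
            (h3 j u hu.1 hu.2).1) (h3 i u hu.1 hu.2).2 (norm_nonneg _) ?_
          exact Finset.prod_nonneg fun j _ => by positivity
      _ = d * 80 ^ d * ∏ j, (1 + |y j|)⁻¹ := by rw [hprod]; simp [mul_assoc]
      _ ≤ _ := by
          gcongr
          linarith

theorem prod_boxTransform_eq (y : Fin d → ℝ) (u : ℝ) :
    ∏ j, (boxTransform u (y j) : ℂ) = ∑ ε : Fin d → Bool,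
      (∏ j, boxAmp (ε j) (y j) u) * planeWave (∑ j, boolSign (ε j) * y j) u := by
  simp_rw [boxTransform_eq_sum]
  rw [Finset.prod_univ_sum, Fintype.piFinset_univ]
  refine Finset.sum_congr rfl fun ε _ => ?_
  rw [Finset.prod_mul_distrib]
  congr 1
  simp only [planeWave]
  rw [← Complex.exp_sum, ← Finset.mul_sum]
  congr 2
  push_cast
  rw [Finset.mul_sum, Finset.sum_mul]

theorem integral_mul_planeWave (f : ℝ → ℂ) (s : ℝ) : ∫ u, f u * planeWave s u = 𝓕 f (-s) := by
  rw [Real.fourier_eq']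
  congr 1 with u
  rw [smul_eq_mul, mul_comm, planeWave]
  congr 2
  simp only [RCLike.inner_apply, conj_trivial]
  push_cast
  ring

theorem abs_boolSign (b : Bool) : |boolSign b| = 1 := by cases b <;> simp [boolSign]

/-- For each choice of signs the transform is a one-dimensional transform of `h'` times a slow
amplitude, taken at frequency `∓∑ ±y_j`; it is `O(A * N^(1+δ))` times an integrable function of `y`.
Constancy of `h` on the negative axis is asked instead of a support in `[1/2, 2]`, so that the
cutoff near the origin is covered as well. -/
theorem exists_wienerBound_comp_iSup (hd : 1 ≤ d) {δ : ℝ} (hδ : 0 < δ) (hδ1 : δ ≤ 1) (c : ℕ → ℝ) :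
    ∃ C, 0 ≤ C ∧ ∀ A N (h : ℝ → ℂ), 0 ≤ A → 1 ≤ N → DerivBound c A N h → (∀ s, 2 ≤ s → h s = 0) →
      (∀ s < 0, deriv h s = 0) →
      WienerBound (fun x : EuclideanSpace ℝ (Fin d) => h (⨆ j, |x j|)) (C * A * N ^ (1 + δ)) := by
  have : Nonempty (Fin d) := ⟨⟨0, hd⟩⟩
  obtain ⟨C₁, hC₁, H₁⟩ := exists_hasDerivAt_prod_boxAmp d
  obtain ⟨C₂, hC₂, H₂⟩ := exists_lintegral_prod_inv_mul_le hd hδ hδ1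
  -- Only `h'` and `h''` enter: the superposition uses `h'`, and one integration by parts reaches
  -- `h''`.
  set K := |c 1| + |c 2| with hK
  refine ⟨2 ^ d * (8 * K * C₁ * C₂), by positivity, fun A N h hA hN H h2 h0 => ?_⟩
  have hN0 : 0 ≤ N := by linarith
  have hdh : ∀ u, HasDerivAt h (deriv h u) u := fun u =>
    (H.contDiff.differentiable (by simp) u).hasDerivAt
  have hdk : ∀ u, HasDerivAt (deriv h) (iteratedDeriv 2 h u) u := fun u => by
    rw [iteratedDeriv_succ, iteratedDeriv_one]
    have := H.contDiff.differentiable_iteratedDeriv 1 (by exact_mod_cast WithTop.coe_lt_top 1)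
    rw [iteratedDeriv_one] at this
    exact (this u).hasDerivAt
  have hkc : Continuous (deriv h) :=
    continuous_iff_continuousAt.mpr fun u => (hdk u).continuousAt
  have hk0 : ∀ u, u ∉ Set.Icc (0 : ℝ) 2 → deriv h u = 0 := fun u hu => by
    rcases lt_or_ge u 0 with hu0 | hu0
    · exact h0 u hu0
    · have hu2 : 2 < u := not_le.mp fun h => hu ⟨hu0, h⟩
      have : h =ᶠ[nhds u] fun _ => 0 := by
        filter_upwards [lt_mem_nhds hu2] with v hv using h2 v hv.le
      rw [this.deriv_eq, deriv_const]
  have hki : Integrable (deriv h) := hkc.integrable_of_hasCompactSupport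
    (HasCompactSupport.intro (isCompact_Icc (a := (0 : ℝ)) (b := 2)) hk0)
  have hk1 : ∀ u, ‖deriv h u‖ ≤ K * A * N := fun u => by
    have := H.bound 1 u
    rw [iteratedDeriv_one, pow_one] at this
    refine this.trans ?_
    gcongr
    linarith [le_abs_self (c 1), abs_nonneg (c 2)]
  have hk2 : ∀ u, ‖iteratedDeriv 2 h u‖ ≤ K * A * N * N := fun u => by
    refine (H.bound 2 u).trans ?_
    rw [pow_two, ← mul_assoc]
    gcongr
    linarith [le_abs_self (c 2), abs_nonneg (c 1)]
  have hk2c : Continuous (iteratedDeriv 2 h) :=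
    H.continuous_iteratedDeriv 2
  have hF : ∀ x : EuclideanSpace ℝ (Fin d), h (⨆ j, |x j|) = -cubeSum (deriv h) x := fun x => by
    rw [cubeSum_eq hdh hki h2, neg_neg]
  have hfour : ∀ y : EuclideanSpace ℝ (Fin d), ‖𝓕 (cubeSum (deriv h)) y‖ ≤ ∑ ε : Fin d → Bool,
      8 * K * C₁ * A * N ^ (1 + δ) * ((∏ j, (1 + |y j|)⁻¹) *
        (1 + |∑ j, boolSign (ε j) * y j|) ^ (-δ)) := fun y => by
    rw [fourier_cubeSum hkc hk0]
    simp_rw [prod_boxTransform_eq, Finset.mul_sum]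
    have key : ∀ ε : Fin d → Bool, Continuous fun u => ∏ j, boxAmp (ε j) (y j) u := fun ε => by
      obtain ⟨a', ha, -, -⟩ := H₁ ε y
      exact continuous_iff_continuousAt.mpr fun u => (ha u).continuousAt
    have hpw : ∀ s, Continuous (planeWave s) := fun s =>
      continuous_iff_continuousAt.mpr fun u => (hasDerivAt_planeWave s u).continuousAt
    rw [integral_finsetSum]
    swap
    · exact fun ε _ => Continuous.integrable_of_hasCompactSupport (hkc.mul ((key ε).mul (hpw _)))
        (HasCompactSupport.intro (isCompact_Icc (a := (0 : ℝ)) (b := 2)) fun u hu => by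
          simp [hk0 u hu])
    refine (norm_sum_le _ _).trans (Finset.sum_le_sum fun ε _ => ?_)
    obtain ⟨a', ha, hac, hab⟩ := H₁ ε y
    have e : ∫ u, deriv h u * ((∏ j, boxAmp (ε j) (y j) u) *
        planeWave (∑ j, boolSign (ε j) * y j) u) =
        𝓕 (fun u => deriv h u * ∏ j, boxAmp (ε j) (y j) u) (-∑ j, boolSign (ε j) * y j) := by
      rw [← integral_mul_planeWave]
      simp_rw [mul_assoc]
    rw [e]
    set q := ∏ j, (1 + |y j|)⁻¹ with hq
    have hq0 : 0 ≤ q := Finset.prod_nonneg fun j _ => by positivity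
    -- The factor `2` in `M` absorbs the two Leibniz terms; the one with `h''` has the extra `N`.
    have := norm_fourier_le_of_hasDerivAt (f := fun u => deriv h u * ∏ j, boxAmp (ε j) (y j) u)
      (M := 2 * (K * A * N * (C₁ * q))) (δ := δ) (fun u => (hdk u).mul (ha u))
      (by exact (hk2c.mul (key ε)).add (hkc.mul hac)) (fun u hu => by simp [hk0 u hu]) hN
      (fun u hu => by
        rw [norm_mul]
        have h1 : ‖deriv h u‖ * ‖∏ j, boxAmp (ε j) (y j) u‖ ≤ K * A * N * (C₁ * q) :=
          mul_le_mul (hk1 u) (hab u hu).1 (norm_nonneg _) (by positivity)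
        have : 0 ≤ K * A * N * (C₁ * q) := by positivity
        linarith)
      (fun u hu => by
        refine (norm_add_le _ _).trans ?_
        rw [norm_mul, norm_mul]
        have h1 : ‖iteratedDeriv 2 h u‖ * ‖∏ j, boxAmp (ε j) (y j) u‖ ≤ K * A * N * N * (C₁ * q) :=
          mul_le_mul (hk2 u) (hab u hu).1 (norm_nonneg _) (by positivity)
        have h2 : ‖deriv h u‖ * ‖a' u‖ ≤ K * A * N * (C₁ * q) :=
          mul_le_mul (hk1 u) (hab u hu).2 (norm_nonneg _) (by positivity)
        have : K * A * N * (C₁ * q) ≤ K * A * N * (C₁ * q) * N :=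
          le_mul_of_one_le_right (by positivity) hN
        linarith) hδ.le hδ1 (-∑ j, boolSign (ε j) * y j)
    refine this.trans (le_of_eq ?_)
    rw [abs_neg, Real.rpow_add (by linarith), Real.rpow_one]
    ring
  have hcont : Continuous fun x : EuclideanSpace ℝ (Fin d) => h (⨆ j, |x j|) := by
    refine H.contDiff.continuous.comp ?_
    have : (fun x : EuclideanSpace ℝ (Fin d) => ⨆ j, |x j|) =
        fun x => Finset.univ.sup' Finset.univ_nonempty fun j => |x j| := by
      ext x; rw [Finset.sup'_univ_eq_ciSup]
    rw [this]
    exact Continuous.finset_sup'_apply _ fun j _ => by fun_prop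
  have hint : Integrable fun x : EuclideanSpace ℝ (Fin d) => h (⨆ j, |x j|) := by
    refine hcont.integrable_of_hasCompactSupport (HasCompactSupport.intro
      (K := Metric.closedBall 0 (√d * 2)) (isCompact_closedBall _ _) fun x hx => h2 _ ?_)
    by_contra hlt
    refine hx (mem_closedBall_zero_iff.mpr ?_)
    have hj := (ciSup_le_iff (Set.finite_range _).bddAbove).mp (not_le.mp hlt).le
    rw [EuclideanSpace.norm_eq]
    calc √(∑ i, ‖x i‖ ^ 2) ≤ √(∑ _i : Fin d, 2 ^ 2) := by
          refine Real.sqrt_le_sqrt (Finset.sum_le_sum fun i _ => ?_)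
          gcongr
          exact hj i
      _ = √d * 2 := by simp
  refine WienerBound.of_fourier hcont hint (by positivity) ?_
  have e : ∀ y, ‖𝓕 (fun x : EuclideanSpace ℝ (Fin d) => h (⨆ j, |x j|)) y‖ =
      ‖𝓕 (cubeSum (deriv h) : EuclideanSpace ℝ (Fin d) → ℂ) y‖ := fun y => by
    simp_rw [hF]
    rw [Real.fourier_eq, Real.fourier_eq]
    simp_rw [smul_neg]
    rw [integral_neg, norm_neg]
  have hcoef : 0 ≤ 8 * K * C₁ * A * N ^ (1 + δ) := by positivity
  calc ∫⁻ y, ‖𝓕 (fun x : EuclideanSpace ℝ (Fin d) => h (⨆ j, |x j|)) y‖ₑ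
      ≤ ∫⁻ y : EuclideanSpace ℝ (Fin d), ∑ ε : Fin d → Bool,
        ENNReal.ofReal (8 * K * C₁ * A * N ^ (1 + δ)) * ENNReal.ofReal ((∏ j, (1 + |y j|)⁻¹) *
        (1 + |∑ j, boolSign (ε j) * y j|) ^ (-δ)) := by
        refine lintegral_mono fun y => ?_
        rw [← ofReal_norm, e]
        refine (ENNReal.ofReal_le_ofReal (hfour y)).trans (le_of_eq ?_)
        rw [ENNReal.ofReal_sum_of_nonneg fun ε _ => by positivity]
        exact Finset.sum_congr rfl fun ε _ => ENNReal.ofReal_mul hcoef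
    _ = ∑ ε : Fin d → Bool, ENNReal.ofReal (8 * K * C₁ * A * N ^ (1 + δ)) *
        ∫⁻ y : EuclideanSpace ℝ (Fin d), ENNReal.ofReal ((∏ j, (1 + |y j|)⁻¹) *
        (1 + |∑ j, boolSign (ε j) * y j|) ^ (-δ)) := by
        rw [lintegral_finsetSum]
        · exact Finset.sum_congr rfl fun ε _ => lintegral_const_mul' _ _ ENNReal.ofReal_ne_top
        · intro ε _
          fun_prop
    _ ≤ ∑ _ε : Fin d → Bool, ENNReal.ofReal (8 * K * C₁ * A * N ^ (1 + δ)) * ENNReal.ofReal C₂ := by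
        gcongr with ε
        exact H₂ _ fun i => abs_boolSign _
    _ = ENNReal.ofReal (2 ^ d * (8 * K * C₁ * C₂) * A * N ^ (1 + δ)) := by
        rw [Finset.sum_const, ← ENNReal.ofReal_mul hcoef, nsmul_eq_mul, ← ENNReal.ofReal_natCast,
          ← ENNReal.ofReal_mul (by positivity)]
        congr 1
        simp
        ring

end

/-! ### Dyadic synthesis for a homogeneous gauge -/

noncomputable section

variable {d : ℕ}

/-- The radial profile `e^{iσ t^a} (1 + t^b)^{-β}`. -/
def oscRadial (σ a b β t : ℝ) : ℂ :=
  Complex.exp (Complex.I * ((σ * t ^ a : ℝ) : ℂ)) * (((1 + t ^ b) ^ (-β) : ℝ) : ℂ)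

/-- By homogeneity a rescaling of the profile is a dilation of `x`, which does not change the Wiener
norm; so estimates at unit scale may be summed. -/
theorem exists_wienerBound_comp_of_dyadic {Γ : EuclideanSpace ℝ (Fin d) → ℝ} (hΓ0 : ∀ x, 0 ≤ Γ x)
    (hΓ : ∀ t : ℝ, 0 < t → ∃ l : ℝ, 0 < l ∧ ∀ x, Γ (l • x) = t * Γ x) {Φ : ℝ → ℂ} {h : ℕ → ℝ → ℂ}
    {r : ℕ → ℝ} {b : ℕ → ℝ} (hr : ∀ j, 0 < r j) (hb : Summable b)
    (hh : ∀ j, WienerBound (fun x => h j (Γ x)) (b j))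
    (hs : ∀ t, 0 ≤ t → HasSum (fun j => h j (r j * t)) (Φ t)) :
    ∃ C, WienerBound (fun x => Φ (Γ x)) C := by
  refine ⟨_, WienerBound.hasSum (f := fun j x => h j (r j * Γ x)) (fun j => ?_) hb
    fun x => hs _ (hΓ0 x)⟩
  obtain ⟨l, hl, hl'⟩ := hΓ (r j) (hr j)
  have := (hh j).dilate hl
  simpa only [hl'] using this

/-- The shell at height `r`, rescaled: `(1 + (rs)^b)^(-β) = r^(-bβ) * (r^(-b) + s^b)^(-β)`. This
gives the amplitude, and the phase `(rs)^a` gives the frequency `r^a`. -/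
theorem exists_derivBound_high {a b β σ : ℝ} (ha : 0 < a) (hb : 0 < b) (hβ : 0 ≤ β) (hσ : |σ| ≤ 1) :
    ∃ c, ∀ r : ℝ, 1 ≤ r → DerivBound c (r ^ (-(b * β))) (r ^ a) (fun s =>
      ((r ^ (-(b * β)) : ℝ) : ℂ) * (Complex.exp (Complex.I * ((σ * r ^ a * powSymbol a s : ℝ) : ℂ)) *
        (((r ^ (-b) + 1 * powSymbol b s) ^ (-β) : ℝ) : ℂ) * (bumpCut s : ℂ))) := by
  obtain ⟨ca, hca⟩ := exists_derivBound_powSymbol a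
  obtain ⟨cb, hcb⟩ := exists_derivBound_powSymbol b
  have hda := hca.deriv_ofReal ((contDiff_powSymbol a).differentiable (by simp))
  have hdb := hcb.deriv_ofReal ((contDiff_powSymbol b).differentiable (by simp))
  obtain ⟨c1, h1⟩ := exists_derivBound_cexp (contDiff_powSymbol a) hda
  obtain ⟨c2, h2⟩ := exists_derivBound_rpow (contDiff_powSymbol b) hdb (κ := (1 / 4) ^ b)
    (by positivity) hβ
  obtain ⟨c3, h3⟩ := exists_derivBound_bumpCut
  refine ⟨leibnizConst (leibnizConst (fun n => |c1 n|) fun n => |c2 n|) fun n => |c3 n|, fun r hr => ?_⟩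
  have hr0 : 0 < r := by linarith
  have hra : 1 ≤ r ^ a := Real.one_le_rpow hr ha.le
  have k1 := (h1 (σ * r ^ a)).mono zero_le_one le_rfl (by positivity)
    (max_le hra (by
      rw [abs_mul, abs_of_pos (by positivity : 0 < r ^ a)]
      exact mul_le_of_le_one_left (by positivity) hσ))
  have k2 := (h2 ⟨(r ^ (-b), 1), by simp, fun x => by
    have := (powSymbol_mem hb.le x).1
    have : 0 < r ^ (-b) := by positivity
    simp only [one_mul]
    linarith⟩).mono zero_le_one le_rfl zero_le_one hra
  have k3 := h3.mono zero_le_one le_rfl zero_le_one hra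
  have := ((k1.mul k2).mul k3).const_mul ((r ^ (-(b * β)) : ℝ) : ℂ)
  rw [Complex.norm_real, Real.norm_eq_abs, abs_of_pos (by positivity)] at this
  simpa only [mul_one] using this

theorem high_eq {a b β σ r t : ℝ} (hr : 0 < r) (ht : 0 ≤ t) :
    ((r ^ (-(b * β)) : ℝ) : ℂ) * (Complex.exp (Complex.I * ((σ * r ^ a *
      powSymbol a (r⁻¹ * t) : ℝ) : ℂ)) *
        (((r ^ (-b) + 1 * powSymbol b (r⁻¹ * t)) ^ (-β) : ℝ) : ℂ) * (bumpCut (r⁻¹ * t) : ℂ)) =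
      oscRadial σ a b β t * (bumpCut (r⁻¹ * t) : ℂ) := by
  rcases le_or_gt (r⁻¹ * t) (1 / 2) with h | h
  · rw [bumpCut_of_le h]; simp
  rcases le_or_gt 2 (r⁻¹ * t) with h' | h'
  · rw [bumpCut_of_ge h']; simp
  have hri : 0 ≤ r⁻¹ := (inv_pos.mpr hr).le
  rw [powSymbol_of_mem h.le h'.le, powSymbol_of_mem h.le h'.le, oscRadial,
    Real.mul_rpow hri ht, Real.mul_rpow hri ht, Real.inv_rpow hr.le, Real.inv_rpow hr.le,
    mul_assoc σ, mul_inv_cancel_left₀ (by positivity)]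
  have e : (1 + t ^ b) ^ (-β) = r ^ (-(b * β)) * (r ^ (-b) + 1 * ((r ^ b)⁻¹ * t ^ b)) ^ (-β) := by
    rw [show -(b * β) = b * -β by ring, Real.rpow_mul hr.le, ← Real.mul_rpow (by positivity)
      (by positivity), Real.rpow_neg hr.le]
    congr 1
    field_simp
  rw [e]
  push_cast
  ring

/-- On a shell at height `r ≤ 1` the phase is at most of order `r^a`, so `e^{iφ} - 1` has that
amplitude at frequency `1`, and the pieces are summable over `r = 2^(-j)`. -/
theorem exists_derivBound_low_phase {a b β σ : ℝ} (ha : 0 < a) (hb : 0 < b) (hβ : 0 ≤ β)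
    (hσ : |σ| ≤ 1) :
    ∃ c, ∀ r : ℝ, 0 < r → r ≤ 1 → DerivBound c (r ^ a) 1 (fun s =>
      (Complex.exp (Complex.I * ((σ * r ^ a * powSymbol a s : ℝ) : ℂ)) - 1) *
        (((1 + r ^ b * powSymbol b s) ^ (-β) : ℝ) : ℂ) * (bumpCut s : ℂ)) := by
  obtain ⟨ca, hca⟩ := exists_derivBound_powSymbol a
  obtain ⟨cb, hcb⟩ := exists_derivBound_powSymbol b
  have hdb := hcb.deriv_ofReal ((contDiff_powSymbol b).differentiable (by simp))
  obtain ⟨c1, h1⟩ := exists_derivBound_cexp_sub_one (contDiff_powSymbol a) hca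
  obtain ⟨c2, h2⟩ := exists_derivBound_rpow (contDiff_powSymbol b) hdb one_pos hβ
  obtain ⟨c3, h3⟩ := exists_derivBound_bumpCut
  refine ⟨leibnizConst (leibnizConst (fun n => |c1 n|) c2) c3, fun r hr hr1 => ?_⟩
  have hra : r ^ a ≤ 1 := Real.rpow_le_one hr.le hr1 ha.le
  have hν : |σ * r ^ a| ≤ r ^ a := by
    rw [abs_mul, abs_of_pos (by positivity : 0 < r ^ a)]
    exact mul_le_of_le_one_left (by positivity) hσ
  have k1 := (h1 (σ * r ^ a)).mono (by positivity) ((min_le_right _ _).trans hν) (by positivity)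
    (max_le le_rfl (hν.trans hra))
  have k2 := h2 ⟨(1, r ^ b), by
    simpa [abs_of_pos (by positivity : 0 < r ^ b)] using Real.rpow_le_one hr.le hr1 hb.le, fun x => by
    have := (powSymbol_mem hb.le x).1
    have : 0 ≤ powSymbol b x := le_trans (by positivity) this
    simp only []
    have : 0 ≤ r ^ b * powSymbol b x := by positivity
    linarith⟩
  simpa only [mul_one] using (k1.mul k2).mul h3

theorem exists_derivBound_low_amp {b β : ℝ} (hb : 0 < b) (hβ : 0 ≤ β) :
    ∃ c, ∀ r : ℝ, 0 < r → r ≤ 1 → DerivBound c (r ^ b) 1 (fun s =>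
      ((((1 + r ^ b * powSymbol b s) ^ (-β) : ℝ) : ℂ) - 1) * (bumpCut s : ℂ)) := by
  obtain ⟨cb, hcb⟩ := exists_derivBound_powSymbol b
  have hdb := hcb.deriv_ofReal ((contDiff_powSymbol b).differentiable (by simp))
  obtain ⟨c2, h2⟩ := exists_derivBound_rpow_sub_one (contDiff_powSymbol b) hdb
    (fun x => le_trans (by positivity) (powSymbol_mem hb.le x).1)
    (fun x => (powSymbol_mem hb.le x).2) hβ
  obtain ⟨c3, h3⟩ := exists_derivBound_bumpCut
  refine ⟨leibnizConst c2 c3, fun r hr hr1 => ?_⟩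
  simpa only [mul_one] using (h2 (r ^ b) (by positivity) (Real.rpow_le_one hr.le hr1 hb.le)).mul h3

theorem rpow_mul_powSymbol_mul_bumpCut {a r t : ℝ} (hr : 0 < r) (ht : 0 ≤ t) {F : ℝ → ℂ} :
    F (r ^ a * powSymbol a (r⁻¹ * t)) * (bumpCut (r⁻¹ * t) : ℂ) =
      F (t ^ a) * (bumpCut (r⁻¹ * t) : ℂ) := by
  rcases le_or_gt (r⁻¹ * t) (1 / 2) with h | h
  · rw [bumpCut_of_le h]; simp
  rcases le_or_gt 2 (r⁻¹ * t) with h' | h'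
  · rw [bumpCut_of_ge h']; simp
  have hri : 0 ≤ r⁻¹ := (inv_pos.mpr hr).le
  rw [powSymbol_of_mem h.le h'.le, Real.mul_rpow hri ht, Real.inv_rpow hr.le,
    mul_inv_cancel_left₀ (by positivity)]

/-- All bumps vanish at `t = 0` while the cutoff is `1` there, hence the condition that `z` vanish
at the origin. -/
theorem hasSum_low_cut {t : ℝ} (ht : 0 ≤ t) {z : ℂ} (hz : t = 0 → z = 0) :
    HasSum (fun j : ℕ => z * (bumpCut (2 ^ (j + 1) * t) : ℂ)) (z * (lowCut (2 * t) : ℂ)) := by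
  rcases ht.eq_or_lt with h | h
  · rw [hz h.symm]; simp
  · refine HasSum.mul_left z ?_
    have := hasSum_bumpCut_two_pow (t := 2 * t) (by positivity)
    simp_rw [pow_succ, mul_assoc]
    exact_mod_cast this

theorem summable_mul_two_pow_rpow (C : ℝ) {e : ℝ} (he : e < 0) :
    Summable fun j : ℕ => C * ((2 : ℝ) ^ j) ^ e := by
  refine Summable.mul_left C ?_
  have : ∀ j : ℕ, ((2 : ℝ) ^ j) ^ e = ((2 : ℝ) ^ e) ^ j := fun j => by
    rw [← Real.rpow_natCast, ← Real.rpow_natCast, ← Real.rpow_mul two_pos.le,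
      ← Real.rpow_mul two_pos.le, mul_comm]
  simp_rw [this]
  exact summable_geometric_of_lt_one (by positivity)
    (Real.rpow_lt_one_of_one_lt_of_neg one_lt_two he)

/-- With `E` the exponential, `P` the power and `χ` the cutoff near zero, the profile is `χ +
EP(1-χ) + (E-1)Pχ + (P-1)χ`. The first term has no dyadic decay and is a separate hypothesis. The
shells of the other three have norms `2^{j(aκ-bβ)}`, `2^{-ja}` and `2^{-jb}`, up to constants. -/
theorem exists_wienerBound_oscRadial_comp {Γ : EuclideanSpace ℝ (Fin d) → ℝ} (hΓ0 : ∀ x, 0 ≤ Γ x)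
    (hΓ : ∀ t : ℝ, 0 < t → ∃ l : ℝ, 0 < l ∧ ∀ x, Γ (l • x) = t * Γ x) {κ : ℝ}
    (hlow : ∃ C, WienerBound (fun x => (lowCut (2 * Γ x) : ℂ)) C)
    (hband : ∀ c : ℕ → ℝ, ∃ C, 0 ≤ C ∧ ∀ A N (h : ℝ → ℂ), 0 ≤ A → 1 ≤ N → DerivBound c A N h →
      (∀ s, s ≤ 1 / 2 → h s = 0) → (∀ s, 2 ≤ s → h s = 0) →
      WienerBound (fun x => h (Γ x)) (C * A * N ^ κ))
    {a b β σ : ℝ} (ha : 0 < a) (hb : 0 < b) (hβ : 0 ≤ β) (hσ : |σ| ≤ 1) (hκ : a * κ < b * β) :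
    ∃ C, WienerBound (fun x => oscRadial σ a b β (Γ x)) C := by
  obtain ⟨C0, H0⟩ := hlow
  have high : ∃ C, WienerBound (fun x => (fun t => oscRadial σ a b β t *
      ((1 - lowCut (2 * t) : ℝ) : ℂ)) (Γ x)) C := by
    obtain ⟨c, hc⟩ := exists_derivBound_high ha hb hβ hσ
    obtain ⟨C, hC, H⟩ := hband c
    refine exists_wienerBound_comp_of_dyadic hΓ0 hΓ (Φ := fun t => oscRadial σ a b β t * ((1 - lowCut (2 * t) : ℝ) : ℂ))
      (r := fun j => ((2 : ℝ) ^ j)⁻¹)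
      (b := fun j => C * ((2 : ℝ) ^ j) ^ (a * κ - b * β)) (fun j => by positivity)
      (summable_mul_two_pow_rpow C (by linarith)) (fun j => ?_) (fun t ht => ?_)
      (h := fun j s => (((2 ^ j : ℝ) ^ (-(b * β)) : ℝ) : ℂ) * (Complex.exp (Complex.I *
        ((σ * (2 ^ j : ℝ) ^ a * powSymbol a s : ℝ) : ℂ)) *
        ((((2 ^ j : ℝ) ^ (-b) + 1 * powSymbol b s) ^ (-β) : ℝ) : ℂ) * (bumpCut s : ℂ)))
    · have h2 : (1 : ℝ) ≤ 2 ^ j := one_le_pow₀ one_le_two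
      have := H _ _ _ (by positivity) (Real.one_le_rpow h2 ha.le) (hc (2 ^ j) h2)
        (fun s hs => by rw [bumpCut_of_le hs]; simp) (fun s hs => by rw [bumpCut_of_ge hs]; simp)
      refine this.mono (le_of_eq ?_)
      rw [mul_assoc, ← Real.rpow_mul (by positivity), ← Real.rpow_add (by positivity)]
      congr 2
      ring
    · simp_rw [high_eq (pow_pos two_pos _) ht]
      refine HasSum.mul_left _ ?_
      have := hasSum_bumpCut_two_inv_pow t
      simp_rw [inv_pow] at this
      exact_mod_cast this
  have hr0 : ∀ j : ℕ, (0 : ℝ) < (2 ^ (j + 1))⁻¹ := fun j => by positivity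
  have hr1 : ∀ j : ℕ, ((2 : ℝ) ^ (j + 1))⁻¹ ≤ 1 := fun j => inv_le_one_of_one_le₀ (one_le_pow₀ one_le_two)
  have hsum : ∀ (C : ℝ) {e : ℝ}, 0 < e → Summable fun j : ℕ => C * (((2 : ℝ) ^ (j + 1))⁻¹) ^ e :=
    fun C e he => by
      have := (summable_nat_add_iff 1).mpr (summable_mul_two_pow_rpow C (neg_neg_of_pos he))
      simpa only [Real.inv_rpow (pow_nonneg two_pos.le _), Real.rpow_neg (pow_nonneg two_pos.le _)]
        using this
  have low_phase : ∃ C, WienerBound (fun x => (fun t =>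
      ((Complex.exp (Complex.I * ((σ * t ^ a : ℝ) : ℂ)) - 1) * (((1 + t ^ b) ^ (-β) : ℝ) : ℂ)) *
        (lowCut (2 * t) : ℂ)) (Γ x)) C := by
    obtain ⟨c, hc⟩ := exists_derivBound_low_phase ha hb hβ hσ
    obtain ⟨C, hC, H⟩ := hband c
    refine exists_wienerBound_comp_of_dyadic hΓ0 hΓ (Φ := fun t => ((Complex.exp (Complex.I * ((σ * t ^ a : ℝ) : ℂ)) - 1) *
        (((1 + t ^ b) ^ (-β) : ℝ) : ℂ)) * (lowCut (2 * t) : ℂ))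
      (r := fun j => (2 : ℝ) ^ (j + 1))
      (b := fun j => C * (((2 : ℝ) ^ (j + 1))⁻¹) ^ a) (fun j => by positivity)
      (hsum C ha) (fun j => ?_) (fun t ht => ?_)
      (h := fun j s => (Complex.exp (Complex.I *
        ((σ * ((2 ^ (j + 1))⁻¹ : ℝ) ^ a * powSymbol a s : ℝ) : ℂ)) - 1) *
        (((1 + ((2 ^ (j + 1))⁻¹ : ℝ) ^ b * powSymbol b s) ^ (-β) : ℝ) : ℂ) * (bumpCut s : ℂ))
    · have := H _ _ _ (by positivity) le_rfl (hc _ (hr0 j) (hr1 j))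
        (fun s hs => by rw [bumpCut_of_le hs]; simp) (fun s hs => by rw [bumpCut_of_ge hs]; simp)
      simpa only [Real.one_rpow, mul_one] using this
    · refine (hasSum_low_cut ht (z := (Complex.exp (Complex.I * ((σ * t ^ a : ℝ) : ℂ)) - 1) *
        (((1 + t ^ b) ^ (-β) : ℝ) : ℂ)) fun h => ?_).congr_fun ?_
      · simp [h, Real.zero_rpow ha.ne']
      · intro j
        have e1 := rpow_mul_powSymbol_mul_bumpCut (a := a) (hr0 j) ht (F := fun v =>
          (Complex.exp (Complex.I * ((σ * v : ℝ) : ℂ)) - 1))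
        have e2 := rpow_mul_powSymbol_mul_bumpCut (a := b) (hr0 j) ht (F := fun v =>
          (((1 + v) ^ (-β) : ℝ) : ℂ))
        simp only [inv_inv] at e1 e2
        rw [mul_assoc σ, mul_assoc, e2, mul_left_comm, e1]
        ring
  have low_amp : ∃ C, WienerBound (fun x => (fun t =>
      ((((1 + t ^ b) ^ (-β) : ℝ) : ℂ) - 1) * (lowCut (2 * t) : ℂ)) (Γ x)) C := by
    obtain ⟨c, hc⟩ := exists_derivBound_low_amp hb hβ
    obtain ⟨C, hC, H⟩ := hband c
    refine exists_wienerBound_comp_of_dyadic hΓ0 hΓ (Φ := fun t => ((((1 + t ^ b) ^ (-β) : ℝ) : ℂ) - 1) *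
        (lowCut (2 * t) : ℂ))
      (r := fun j => (2 : ℝ) ^ (j + 1))
      (b := fun j => C * (((2 : ℝ) ^ (j + 1))⁻¹) ^ b) (fun j => by positivity)
      (hsum C hb) (fun j => ?_) (fun t ht => ?_)
      (h := fun j s => ((((1 + ((2 ^ (j + 1))⁻¹ : ℝ) ^ b * powSymbol b s) ^ (-β) : ℝ) : ℂ) - 1) *
        (bumpCut s : ℂ))
    · have := H _ _ _ (by positivity) le_rfl (hc _ (hr0 j) (hr1 j))
        (fun s hs => by rw [bumpCut_of_le hs]; simp) (fun s hs => by rw [bumpCut_of_ge hs]; simp)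
      simpa only [Real.one_rpow, mul_one] using this
    · refine (hasSum_low_cut ht (z := (((1 + t ^ b) ^ (-β) : ℝ) : ℂ) - 1) fun h => ?_).congr_fun ?_
      · simp [h, Real.zero_rpow hb.ne']
      · intro j
        have e2 := rpow_mul_powSymbol_mul_bumpCut (a := b) (hr0 j) ht (F := fun v =>
          (((1 + v) ^ (-β) : ℝ) : ℂ) - 1)
        simpa only [inv_inv] using e2
  obtain ⟨C1, H1⟩ := high
  obtain ⟨C2, H2⟩ := low_phase
  obtain ⟨C3, H3⟩ := low_amp
  refine ⟨C0 + C1 + C2 + C3, ?_⟩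
  convert ((H0.add H1).add H2).add H3 using 2 with x
  simp only [oscRadial]
  push_cast
  ring

end

/-! ### The three ranges of `p` -/

noncomputable section

variable {d : ℕ}

theorem oscProfile_rpow_eq_oscRadial {α b β v : ℝ} (hv : 0 ≤ v) :
    oscProfile α β (v ^ b) = oscRadial 1 (b * α) b β v := by
  rw [oscProfile, oscRadial, Real.rpow_mul hv, one_mul, Real.rpow_neg (by positivity),
    div_eq_mul_inv]
  push_cast
  rfl

theorem oscProfile_zero_rpow_eq_oscRadial {a b β v : ℝ} (hv : 0 ≤ v) :
    oscProfile 0 β (v ^ b) = Complex.exp Complex.I * oscRadial 0 a b β v := by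
  rw [oscProfile, oscRadial, zero_mul, Real.rpow_zero, Real.rpow_neg (by positivity),
    div_eq_mul_inv]
  push_cast
  simp

/-- Dyadic synthesis: a gauge admitting band estimates of order `κ` carries the oscillating
profile into the Wiener algebra as soon as `α κ < β`. -/
theorem exists_wienerBound_oscProfile_comp {Γ : EuclideanSpace ℝ (Fin d) → ℝ} (hΓ0 : ∀ x, 0 ≤ Γ x)
    (hΓ : ∀ t : ℝ, 0 < t → ∃ l : ℝ, 0 < l ∧ ∀ x, Γ (l • x) = t * Γ x) {κ : ℝ} (hκ0 : 0 ≤ κ)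
    (hlow : ∃ C, WienerBound (fun x => (lowCut (2 * Γ x) : ℂ)) C)
    (hband : ∀ c : ℕ → ℝ, ∃ C, 0 ≤ C ∧ ∀ A N (h : ℝ → ℂ), 0 ≤ A → 1 ≤ N → DerivBound c A N h →
      (∀ s, s ≤ 1 / 2 → h s = 0) → (∀ s, 2 ≤ s → h s = 0) →
      WienerBound (fun x => h (Γ x)) (C * A * N ^ κ))
    {α b β : ℝ} (hα : 0 ≤ α) (hb : 0 < b) (hβ : 0 < β) (hκ : α * κ < β) :
    ∃ C, WienerBound (fun x => oscProfile α β (Γ x ^ b)) C := by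
  rcases hα.eq_or_lt with rfl | hα
  -- For `α = 0` the phase is constant and is pulled out as `e^i`; with `σ = 0` the exponent `a` is
  -- free, and this value is positive and small enough.
  · have hκ1 : b * β / (κ + 1) * κ < b * β := by
      rw [div_mul_eq_mul_div, div_lt_iff₀ (by positivity)]
      nlinarith [mul_pos hb hβ]
    obtain ⟨C, H⟩ := exists_wienerBound_oscRadial_comp hΓ0 hΓ hlow hband
      (a := b * β / (κ + 1)) (σ := 0) (by positivity) hb hβ.le (by simp) hκ1
    refine ⟨‖Complex.exp Complex.I‖ * C, ?_⟩
    convert H.const_mul (Complex.exp Complex.I) using 2 with x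
    exact oscProfile_zero_rpow_eq_oscRadial (hΓ0 x)
  · obtain ⟨C, H⟩ := exists_wienerBound_oscRadial_comp hΓ0 hΓ hlow hband
      (a := b * α) (σ := 1) (by positivity) hb hβ.le (by simp) (by
        rw [mul_assoc]; exact mul_lt_mul_of_pos_left hκ hb)
    refine ⟨C, ?_⟩
    convert H using 2 with x
    exact oscProfile_rpow_eq_oscRadial (hΓ0 x)

theorem powGauge_nonneg (p : ℝ) (x : EuclideanSpace ℝ (Fin d)) : 0 ≤ powGauge p x :=
  mul_nonneg (by positivity) (Finset.sum_nonneg fun _ _ => by positivity)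

theorem exists_powGauge_smul {p : ℝ} (hp : 0 < p) {t : ℝ} (ht : 0 < t) :
    ∃ l : ℝ, 0 < l ∧ ∀ x : EuclideanSpace ℝ (Fin d), powGauge p (l • x) = t * powGauge p x := by
  have hl : 0 < t ^ p⁻¹ := by positivity
  refine ⟨t ^ p⁻¹, hl, fun x => ?_⟩
  have e : ∀ j, |(t ^ p⁻¹ • x) j| ^ p = t * |x j| ^ p := fun j => by
    rw [PiLp.smul_apply, smul_eq_mul, abs_mul, abs_of_pos hl, Real.mul_rpow hl.le (abs_nonneg _),
      Real.rpow_inv_rpow ht.le hp.ne']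
  simp_rw [powGauge, e]
  rw [← Finset.mul_sum]
  ring

/-- Since `powGauge` is a multiple of the `p`-th power of the gauge, the synthesis is applied with
`b = 1/p`, and one dilation removes the factor `2^(p+1)`. The low cutoff agrees on nonnegative
arguments with the even one, which has compact support, so the same band estimate covers it. -/
theorem oscProfile_lpGauge_mem_of_band {p : ℝ≥0∞} (hp0 : p ≠ 0) (hp : p ≠ ∞) {κ : ℝ} (hκ0 : 0 ≤ κ)
    (hband : ∀ c : ℕ → ℝ, ∃ C, 0 ≤ C ∧ ∀ A N (h : ℝ → ℂ), 0 ≤ A → 1 ≤ N → DerivBound c A N h →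
      (∀ s : ℝ, 2 < |s| → h s = 0) →
      WienerBound (fun x : EuclideanSpace ℝ (Fin d) => h (powGauge p.toReal x)) (C * A * N ^ κ))
    {α β : ℝ} (hα : 0 ≤ α) (hβ : 0 < β) (hκ : α * κ < β) :
    (fun x : EuclideanSpace ℝ (Fin d) => oscProfile α β (lpGauge p x)) ∈ wienerAlgebra d := by
  have hq : 0 < p.toReal := ENNReal.toReal_pos hp0 hp
  obtain ⟨C, H⟩ := exists_wienerBound_oscProfile_comp (Γ := powGauge (d := d) p.toReal) (κ := κ)
    (b := 1 / p.toReal) (powGauge_nonneg _) (fun t ht => exists_powGauge_smul hq ht) hκ0 (by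
      obtain ⟨c, hc⟩ := exists_derivBound_evenCut
      obtain ⟨C, -, H⟩ := hband c
      refine ⟨C * 1 * 1 ^ κ, ?_⟩
      simp_rw [lowCut_eq_evenCut (powGauge_nonneg _ _)]
      exact H 1 1 _ zero_le_one le_rfl hc fun s hs => by rw [evenCut_of_le_abs (by linarith)]; simp)
    (fun c => by
      obtain ⟨C, hC, H⟩ := hband c
      refine ⟨C, hC, fun A N h hA hN hd h1 h2 => H A N h hA hN hd fun s hs => ?_⟩
      rcases lt_abs.mp hs with hs | hs
      · exact h2 s hs.le
      · exact h1 s (by linarith))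
    hα (by positivity) hβ hκ
  obtain ⟨l, hl, hl'⟩ := exists_powGauge_smul (d := d) hq
    (t := ((2 : ℝ) ^ (p.toReal + 1))⁻¹) (by positivity)
  convert (H.dilate hl).mem_wienerAlgebra using 3 with x
  rw [hl', powGauge, inv_mul_cancel_left₀ (by positivity), lpGauge, if_neg hp]

theorem exists_mul_one_add_lt {m β : ℝ} (hm : 0 ≤ m) (h : m < β) :
    ∃ ε, 0 < ε ∧ ε ≤ 1 ∧ m * (1 + ε) < β := by
  have h0 : 0 < (β - m) / (m + 1) := div_pos (sub_pos.mpr h) (by linarith)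
  refine ⟨min 1 ((β - m) / (m + 1)), lt_min one_pos h0, min_le_left _ _, ?_⟩
  have h1 := mul_le_mul_of_nonneg_left (min_le_right 1 ((β - m) / (m + 1))) hm
  have h2 : m * ((β - m) / (m + 1)) < β - m := by
    rw [← mul_div_assoc, div_lt_iff₀ (by linarith)]
    nlinarith
  linarith

theorem oscProfile_lpGauge_mem_of_lt_one {p : ℝ≥0∞} (hd : 1 ≤ d) (hp0 : 0 < p) (hp : p < 1)
    {α β : ℝ} (hα : 0 ≤ α) (hβ : 0 < β) (h : d * α < β) :
    (fun x : EuclideanSpace ℝ (Fin d) => oscProfile α β (lpGauge p x)) ∈ wienerAlgebra d := by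
  have hpt : p ≠ ∞ := (hp.trans ENNReal.one_lt_top).ne
  -- The exponent `(d+1)/2` is at most `d` because `d ≥ 1`.
  refine oscProfile_lpGauge_mem_of_band hp0.ne' hpt (κ := ((d : ℝ) + 1) / 2) (by positivity)
    (fun c => exists_wienerBound_comp_powGauge d (ENNReal.toReal_pos hp0.ne' hpt) c) hα hβ ?_
  have hd' : (1 : ℝ) ≤ d := by exact_mod_cast hd
  nlinarith

theorem oscProfile_lpGauge_mem_of_one_le {p : ℝ≥0∞} (hd : 1 ≤ d) (hp1 : 1 ≤ p) (hp : p ≠ ∞)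
    {α β : ℝ} (hα : 0 ≤ α) (hβ : 0 < β) (h : d * α < 2 * β) :
    (fun x : EuclideanSpace ℝ (Fin d) => oscProfile α β (lpGauge p x)) ∈ wienerAlgebra d := by
  obtain ⟨ε, hε, -, hε'⟩ := exists_mul_one_add_lt (m := α * (d / 2)) (β := β) (by positivity)
    (by linarith)
  refine oscProfile_lpGauge_mem_of_band (one_pos.trans_le hp1).ne' hp
    (κ := (1 + ε) * ((d : ℝ) / 2)) (by positivity)
    (fun c => exists_wienerBound_comp_powGauge_of_one_le hd ?_ hε c) hα hβ (by linarith)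
  simpa using ENNReal.toReal_mono hp hp1

/-- The function has different limits at the two ends, so it is its derivative that is constant off
a compact set. -/
theorem exists_derivBound_lowCut_two_mul :
    ∃ c, DerivBound c 1 1 (fun x => (lowCut (2 * x) : ℂ)) := by
  have hs : ContDiff ℝ ((⊤ : ℕ∞) : WithTop ℕ∞) fun x : ℝ => (lowCut (2 * x) : ℂ) :=
    Complex.ofRealCLM.contDiff.comp (contDiff_lowCut.comp (contDiff_const.mul contDiff_id))
  obtain ⟨c, hc⟩ := exists_derivBound_of_eq_const (r := 1) (a := 0)
    (contDiff_infty_iff_deriv.mp hs).2 fun x hx => by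
      rcases lt_abs.mp hx with hx | hx
      · have : (fun x : ℝ => (lowCut (2 * x) : ℂ)) =ᶠ[nhds x] fun _ => 0 := by
          filter_upwards [lt_mem_nhds hx] with v hv
          rw [lowCut_of_ge (by linarith)]; simp
        rw [this.deriv_eq, deriv_const]
      · have : (fun x : ℝ => (lowCut (2 * x) : ℂ)) =ᶠ[nhds x] fun _ => 1 := by
          filter_upwards [gt_mem_nhds (show x < 0 by linarith)] with v hv
          rw [lowCut_of_le (by linarith)]; simp
        rw [this.deriv_eq, deriv_const]
  refine ⟨_, DerivBound.of_deriv (C := 1) (hs.differentiable (by simp)) (fun _ => rfl)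
    (by rwa [one_mul]) fun x => ?_⟩
  rw [Complex.norm_real, Real.norm_eq_abs, mul_one, lowCut,
    abs_of_nonneg (Real.smoothTransition.nonneg _)]
  exact Real.smoothTransition.le_one _

theorem oscProfile_lpGauge_top_mem (hd : 2 ≤ d) {α β : ℝ} (hα : 0 ≤ α) (hβ : 0 < β)
    (h : d * α < 2 * β) :
    (fun x : EuclideanSpace ℝ (Fin d) => oscProfile α β (lpGauge ∞ x)) ∈ wienerAlgebra d := by
  have hd1 : 1 ≤ d := by omega
  have : Nonempty (Fin d) := ⟨⟨0, hd1⟩⟩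
  have hd' : (2 : ℝ) ≤ d := by exact_mod_cast hd
  -- For `d ≥ 2` the hypothesis gives `α < β`, which leaves room for `δ`.
  obtain ⟨δ, hδ, hδ1, hδ'⟩ := exists_mul_one_add_lt (m := α) (β := β) hα (by nlinarith)
  have h0 : ∀ x : EuclideanSpace ℝ (Fin d), 0 ≤ ⨆ j, |x j| := fun x =>
    Real.iSup_nonneg fun _ => abs_nonneg _
  have hderiv : ∀ g : ℝ → ℂ, ∀ a : ℂ, (∀ s, s ≤ 1 / 2 → g s = a) → ∀ s < 0, deriv g s = 0 :=
    fun g a hg s hs => by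
      have : g =ᶠ[nhds s] fun _ => a := by
        filter_upwards [gt_mem_nhds hs] with v hv using hg v (by linarith)
      rw [this.deriv_eq, deriv_const]
  obtain ⟨C, H⟩ := exists_wienerBound_oscProfile_comp (d := d) (Γ := fun x => ⨆ j, |x j|)
    (κ := 1 + δ) (b := 1) h0 (fun t ht => ⟨t, ht, fun x => by
      simp_rw [PiLp.smul_apply, smul_eq_mul, abs_mul, abs_of_pos ht]
      rw [Real.mul_iSup_of_nonneg ht.le]⟩) (by positivity) (by
      obtain ⟨c, hc⟩ := exists_derivBound_lowCut_two_mul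
      obtain ⟨C, -, H⟩ := exists_wienerBound_comp_iSup hd1 hδ hδ1 c
      exact ⟨_, H 1 1 _ zero_le_one le_rfl hc (fun s hs => by rw [lowCut_of_ge (by linarith)]; simp)
        (hderiv _ 1 fun s hs => by rw [lowCut_of_le (by linarith)]; simp)⟩)
    (fun c => by
      obtain ⟨C, hC, H⟩ := exists_wienerBound_comp_iSup hd1 hδ hδ1 c
      exact ⟨C, hC, fun A N h hA hN hd h1 h2 => H A N h hA hN hd h2 (hderiv _ 0 h1)⟩)
    hα one_pos hβ hδ'
  convert H.mem_wienerAlgebra using 3 with x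
  rw [lpGauge, if_pos rfl, Real.rpow_one]

theorem lpGauge_top_eq_one (x : EuclideanSpace ℝ (Fin 1)) : lpGauge ∞ x = lpGauge 1 x := by
  simp [lpGauge]

end

theorem mainTheorem6 (d : ℕ) (hd : 1 ≤ d) (α β : ℝ) (hα : 0 ≤ α) (hβ : 0 < β) :
    ((d : ℝ) * α < 2 * β → ∀ p : ℝ≥0∞, 1 ≤ p →
      (fun x : EuclideanSpace ℝ (Fin d) => oscProfile α β (lpGauge p x)) ∈ wienerAlgebra d) ∧
    ((d : ℝ) * α < β → ∀ p : ℝ≥0∞, 0 < p → p < 1 →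
      (fun x : EuclideanSpace ℝ (Fin d) => oscProfile α β (lpGauge p x)) ∈ wienerAlgebra d) := by
  refine ⟨fun h p hp => ?_, fun h p hp0 hp1 => oscProfile_lpGauge_mem_of_lt_one hd hp0 hp1 hα hβ h⟩
  by_cases hpt : p = ∞
  · subst hpt
    -- In dimension one the exponent `1 + δ` of the maximum norm would be too large, but there all
    -- gauges are `|x|` and `p = 1` applies.
    rcases hd.eq_or_lt with rfl | hd2
    · simp_rw [lpGauge_top_eq_one]
      exact oscProfile_lpGauge_mem_of_one_le le_rfl le_rfl ENNReal.one_ne_top hα hβ h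
    · exact oscProfile_lpGauge_top_mem hd2 hα hβ h
  · exact oscProfile_lpGauge_mem_of_one_le hd hp hpt hα hβ h
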